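/- Let $\mathcal X=\mathbb R^{n_X}\times L^2((0,1);\mathbb R^{n_z})$ with $\|(Z,\zeta)\|_{\mathcal X}^2=\|Z\|_2^2+\|\zeta\|_{L^2}^2$. Consider, for $\xi\in(0,1)$, $t>0$, the ODE-PDE system \[ \dot X=A_1X+G_1\mathscr K_1z+G_1\Theta\Sigma(v)\mathscr K_2z+G_1h_1(v),\qquad z_t+\Lambda z_\xi=\Theta\Sigma(v)z+h_2(v),\qquad z(0,t)=0, \] with $v=v(X,U)=A_2X+G_2U$, $\mathscr K_1\zeta=\int_0^1K_1\zeta\,d\xi+K_2\zeta(1)$, $\mathscr K_2\zeta=\int_0^1K_3\zeta\,d\xi$, where $A_1,A_2,G_1,G_2,K_2$ are constant real matrices of compatible sizes, $K_1,K_3\in C^0([0,1];\mathbb R^{n_z\times n_z})$, $\Lambda=\operatorname{diag}(\lambda_i)\succ0$, $\Theta=\operatorname{diag}(\theta_i)\succ0$ (unknown), $\Sigma:\mathbb R^{n_z}\to\mathbb R^{n_z\times n_z}$ and $h_1,h_2:\mathbb R^{n_z}\to\mathbb R^{n_z}$ are locally Lipschitz continuous, and $h_2$ is bijective. Let the input $U:[0,\infty)\to\mathbb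 R^{n_U}$ be continuous and bounded, and let $(X,z)\in C^0([0,\infty);\mathcal X)$ be a mild solution that is global and bounded in $\mathcal X$ (forward completeness and boundedness). Here mild solutions are defined by the variation-of-constants formula with the $C_0$-semigroup on $\mathcal X$ generated by $(Z,\zeta)\mapsto(AZ+G_1\mathscr K_1\zeta,-\Lambda\zeta')$ with domain $\{(Z,\zeta)\in\mathbb R^{n_X}\times H^1((0,1);\mathbb R^{n_z}):\zeta(0)=0\}$, where $A$ is the constant matrix multiplying the lumped state ($A=A_1$ for the system and the observer, $A=A_1+L_1A_2$ for the error dynamics below). The measurements are $Y_1=h_2(v(X,U))$ and $Y_2=\Theta\Lambda\Sigma(h_2^{-1}(Y_1))\Lambda^{-1}Y_1+\dot Y_1$ (the last derivative in the sense of distributions). With $\mathbf 1=(1,\dots,1)^{\mathrm T}$, $Z_i=\mathbf 1^{\mathrm T}Y_i$, $\theta=(\theta_1,\dots,\theta_{n_z})^{\mathrm T}$ and gains $\varrho,\psi>0$, $\Gamma=\Gamma^{\mathrm T}\succ0$, let $\zeta_1,\zeta_2,\varphi,R,Q,\hat\theta$ solve on $[0,\infty)$, with arbitrary initial values, \[ \dot\zeta_1=-\varrho(\zeta_1-Z_1),\quad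 \dot\zeta_2=-\varrho\zeta_2+Z_2,\quad \dot\varphi=-\varrho\varphi-\Lambda\Sigma(h_2^{-1}(Y_1))\Lambda^{-1}Y_1, \] \[ \dot R=-\psi R+\frac{\varphi\varphi^{\mathrm T}}{1+\|\varphi\|_2^2},\quad \dot Q=-\psi Q-\frac{(Z_1-\zeta_1-\zeta_2)\varphi}{1+\|\varphi\|_2^2},\quad \dot{\hat\theta}=-\Gamma(R\hat\theta+Q) \] (the equation for $\zeta_2$ is understood in integrated form), and put $\hat\Theta=\operatorname{diag}(\hat\theta_i)$, $\tilde\Theta=\Theta-\hat\Theta$. Assume that $(A_1,A_2)$ is detectable, i.e. $A_1+LA_2$ is Hurwitz for some matrix $L$. Then a matrix $L_1$ with $A_1+L_1A_2$ Hurwitz exists, and for every such $L_1$ the following holds. Let $(\tilde X,\tilde z)\in C^0([0,\infty);\mathcal X)$ be a mild solution of the observer error dynamics \[ \dot{\tilde X}=(A_1+L_1A_2)\tilde X+G_1\mathscr K_1\tilde z+G_1\hat\Theta\Sigma(v)\mathscr K_2\tilde z+G_1\tilde\Theta\Sigma(v)\mathscr K_2z,\quad \tilde z_t+\Lambda\tilde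 z_\xi=\hat\Theta\Sigma(v)\tilde z+\tilde\Theta\Sigma(v)z,\quad \tilde z(0,t)=0, \] with $v=v(X(t),U(t))$; or let $(\tilde X,\tilde z)=(X-\hat X,z-\hat z)$, where $(\hat X,\hat z)$ is a mild solution on $[0,\infty)$ of the observer \[ \dot{\hat X}=A_1\hat X+G_1\mathscr K_1\hat z+G_1\hat\Theta\Sigma(h_2^{-1}(Y_1))\mathscr K_2\hat z+G_1h_1(h_2^{-1}(Y_1))-L_1\bigl(h_2^{-1}(Y_1)-h_2^{-1}(\hat Y_1)\bigr), \] \[ \hat z_t+\Lambda\hat z_\xi=\hat\Theta\Sigma(h_2^{-1}(Y_1))\hat z+Y_1,\quad \hat z(0,t)=0,\qquad \hat Y_1=h_2(v(\hat X,U)). \] In both cases: 1. $(\tilde X,\tilde z)\in L^\infty(\mathbb R_{\ge0};\mathcal X)$, i.e. $\sup_{t\ge0}\|(\tilde X(t),\tilde z(\cdot,t))\|_{\mathcal X}<\infty$. 2. If $\varphi$ is bounded and persistently exciting, i.e. there are $T_0,\alpha>0$ with $\int_t^{t+T_0}\varphi(s)\varphi(s)^{\mathrm T}ds\succeq\alpha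 I$ for all $t\ge0$, then there are $M\geq 0$ and $\sigma>0$ with $\|(\tilde X(t),\tilde z(\cdot,t))\|_{\mathcal X}\le Me^{-\sigma t}$ for all $t\ge0$. -/

import Mathlib

open MeasureTheory Set Filter Topology

noncomputable section

namespace RollingContact

/-! ## Spaces and matrices -/

/-- `ℝⁿ` with the Euclidean norm. -/
abbrev Vec (n : ℕ) : Type := EuclideanSpace ℝ (Fin n)

/-- The space `L²((0,1); ℝⁿ)`. -/
abbrev L2 (n : ℕ) : Type := Lp (Vec n) 2 (volume.restrict (Ioo (0 : ℝ) 1))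

/-- The state space `ℝᵐ × L²((0,1); ℝⁿ)` with
`‖(Z, ζ)‖² = ‖Z‖₂² + ‖ζ‖²_{L²}`. -/
abbrev State (m n : ℕ) : Type := WithLp 2 (Vec m × L2 n)

/-- The pair `(Z, ζ)` as an element of the state space. -/
def State.mk {m n : ℕ} (Z : Vec m) (ζ : L2 n) : State m n := WithLp.toLp 2 (Z, ζ)

/-- A real matrix acting on Euclidean vectors, `x ↦ M x`. -/
def act {m n : ℕ} (M : Matrix (Fin m) (Fin n) ℝ) : Vec n →L[ℝ] Vec m :=
  LinearMap.toContinuousLinearMap (Matrix.toEuclideanLin M)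

/-- A real matrix acting pointwise on square integrable functions,
`(M ζ)(ξ) = M ζ(ξ)`. -/
def actL2 {m n : ℕ} (M : Matrix (Fin m) (Fin n) ℝ) : L2 n →L[ℝ] L2 m :=
  (act M).compLpL 2 (volume.restrict (Ioo (0 : ℝ) 1))

/-- The constant function `ξ ↦ c` in `L²((0,1); ℝⁿ)`. -/
def constL2 {n : ℕ} (c : Vec n) : L2 n := Lp.const 2 (volume.restrict (Ioo (0 : ℝ) 1)) c

/-- `A` is Hurwitz: all its complex eigenvalues have negative real part. -/
def IsHurwitz {n : ℕ} (A : Matrix (Fin n) (Fin n) ℝ) : Prop :=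
  ∀ μ ∈ spectrum ℂ (A.map (fun a : ℝ => (a : ℂ))), μ.re < 0

/-- The pair `(A, C)` is detectable: some output injection makes `A + L C` Hurwitz. -/
def Detectable {n k : ℕ} (A : Matrix (Fin n) (Fin n) ℝ) (C : Matrix (Fin k) (Fin n) ℝ) : Prop :=
  ∃ L : Matrix (Fin n) (Fin k) ℝ, IsHurwitz (A + L * C)

/-! ## Signals on the half line -/

/-- Boundedness on `[0, ∞)`. For continuous signals this is membership in `L^∞`. -/
def BoundedSignal {E : Type*} [Norm E] (f : ℝ → E) : Prop :=
  ∃ M : ℝ, ∀ t : ℝ, 0 ≤ t → ‖f t‖ ≤ M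

/-- Exponential convergence to zero in norm. -/
def TendsToZeroExp {E : Type*} [Norm E] (f : ℝ → E) : Prop :=
  ∃ M σ : ℝ, 0 < σ ∧ ∀ t : ℝ, 0 ≤ t → ‖f t‖ ≤ M * Real.exp (-σ * t)

/-- Persistent excitation: `∫_t^{t+T₀} φ φᵀ ds ≽ α I` for all `t ≥ 0`,
with `T₀, α > 0` independent of `t`. -/
def PersistentlyExciting {n : ℕ} (φ : ℝ → Vec n) : Prop :=
  ∃ T₀ α : ℝ, 0 < T₀ ∧ 0 < α ∧ ∀ t : ℝ, 0 ≤ t → ∀ x : Vec n,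
    α * ‖x‖ ^ 2 ≤ ∫ s in t..(t + T₀), (inner ℝ (φ s) x) ^ 2

/-- `f` is continuous on `[0, ∞)` and `ḟ(t) = rhs(t)` for `t > 0`. -/
def SolvesODE {E : Type*} [NormedAddCommGroup E] [NormedSpace ℝ E] (f rhs : ℝ → E) : Prop :=
  ContinuousOn f (Ici 0) ∧ ∀ t : ℝ, 0 < t → HasDerivAt f (rhs t) t

/-! ## Strongly continuous semigroups and mild solutions -/

/-- `T(t)`, `t ≥ 0`, is a `C₀`-semigroup of bounded operators (values at `t < 0` are irrelevant). -/
structure IsC0Semigroup {E : Type*} [NormedAddCommGroup E] [NormedSpace ℝ E]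
    (T : ℝ → E →L[ℝ] E) : Prop where
  zero : T 0 = ContinuousLinearMap.id ℝ E
  add : ∀ s t : ℝ, 0 ≤ s → 0 ≤ t → T (s + t) = (T s).comp (T t)
  strongly_continuous : ∀ x : E, ContinuousOn (fun t => T t x) (Ici 0)

/-- The operator with graph `𝒜` (`𝒜 x y` reads `x ∈ D(𝒜)` and `𝒜 x = y`) is the infinitesimal
generator of `T`: `𝒜 x = lim_{h ↓ 0} (T(h) x - x) / h`, with domain the set of all `x` for which
the limit exists. -/
def IsGenerator {E : Type*} [NormedAddCommGroup E] [NormedSpace ℝ E]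
    (T : ℝ → E →L[ℝ] E) (𝒜 : E → E → Prop) : Prop :=
  ∀ x y : E, 𝒜 x y ↔ Tendsto (fun h : ℝ => h⁻¹ • (T h x - x)) (𝓝[>] 0) (𝓝 y)

/-- `u ∈ C⁰([0, ∞); E)` is a global mild solution of `u̇(t) = 𝒜 u(t) + F(t, u(t))`:
with `T` the `C₀`-semigroup generated by `𝒜`,
`u(t) = T(t) u(0) + ∫_0^t T(t - s) F(s, u(s)) ds` for all `t ≥ 0`. -/
def IsMildSolution {E : Type*} [NormedAddCommGroup E] [NormedSpace ℝ E]
    (𝒜 : E → E → Prop) (F : ℝ → E → E) (u : ℝ → E) : Prop :=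
  ∃ T : ℝ → E →L[ℝ] E, IsC0Semigroup T ∧ IsGenerator T 𝒜 ∧ ContinuousOn u (Ici 0) ∧
    ∀ t : ℝ, 0 ≤ t → u t = T t (u 0) + ∫ s in (0 : ℝ)..t, T (t - s) (F s (u s))

/-- `ζ ∈ H¹((0,1); ℝⁿ)` with weak derivative `dζ ∈ L²` and absolutely continuous
representative `w` on `[0,1]`; the boundary values of `ζ` are `w 0` and `w 1`. -/
structure IsH1 {n : ℕ} (ζ dζ : L2 n) (w : ℝ → Vec n) : Prop where
  ae_eq : ∀ᵐ ξ ∂(volume.restrict (Ioo (0 : ℝ) 1)), ζ ξ = w ξ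
  eq_integral : ∀ ξ ∈ Icc (0 : ℝ) 1, w ξ = w 0 + ∫ s in (0 : ℝ)..ξ, dζ s

/-! ## The ODE-PDE system -/

/-- The data of the semilinear ODE-PDE system
`Ẋ = A₁ X + G₁ 𝒦₁ z + G₁ Θ Σ(v) 𝒦₂ z + G₁ h₁(v)`,
`z_t + Λ z_ξ = Θ Σ(v) z + h₂(v)` on `(0,1)`, `z(0,t) = 0`, `v = A₂ X + G₂ U`, where
`𝒦₁ ζ = ∫ K₁ ζ + K₂ ζ(1)`, `𝒦₂ ζ = ∫ K₃ ζ`, `Λ = diag(lam) ≻ 0`, `Θ = diag(θ) ≻ 0`, and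
`h₂` is invertible. -/
structure Plant (nX nz nU : ℕ) where
  A₁ : Matrix (Fin nX) (Fin nX) ℝ
  A₂ : Matrix (Fin nz) (Fin nX) ℝ
  G₁ : Matrix (Fin nX) (Fin nz) ℝ
  G₂ : Matrix (Fin nz) (Fin nU) ℝ
  lam : Vec nz
  θ : Vec nz
  Sig : Vec nz → Matrix (Fin nz) (Fin nz) ℝ
  h₁ : Vec nz → Vec nz
  h₂ : Vec nz ≃ Vec nz
  K₁ : ℝ → Matrix (Fin nz) (Fin nz) ℝ
  K₂ : Matrix (Fin nz) (Fin nz) ℝ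
  K₃ : ℝ → Matrix (Fin nz) (Fin nz) ℝ
  lam_pos : ∀ i, 0 < lam i
  θ_pos : ∀ i, 0 < θ i
  K₁_cont : ContinuousOn K₁ (Icc 0 1)
  K₃_cont : ContinuousOn K₃ (Icc 0 1)

/-- The diagonal matrix with diagonal `a`. -/
def diag {n : ℕ} (a : Vec n) : Matrix (Fin n) (Fin n) ℝ := Matrix.diagonal fun i => a i

namespace Plant

variable {nX nz nU : ℕ} (S : Plant nX nz nU)

/-- The rigid relative velocity `v(X, U) = A₂ X + G₂ U`. -/
def vel (X : Vec nX) (U : Vec nU) : Vec nz := act S.A₂ X + act S.G₂ U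

/-- `𝒦₁ ζ = ∫_0^1 K₁ ζ dξ + K₂ ζ(1)`, for the continuous representative `w` of `ζ ∈ H¹`. -/
def K1op (w : ℝ → Vec nz) : Vec nz :=
  (∫ ξ in (0 : ℝ)..1, act (S.K₁ ξ) (w ξ)) + act S.K₂ (w 1)

/-- `𝒦₂ ζ = ∫_0^1 K₃ ζ dξ` for `ζ ∈ L²`. -/
def K2op (ζ : L2 nz) : Vec nz := ∫ ξ in Ioo (0 : ℝ) 1, act (S.K₃ ξ) (ζ ξ)

/-- Graph of the linear operator `𝒜(Z, ζ) = (A Z + G₁ 𝒦₁ ζ, -Λ ∂ζ/∂ξ)` with domain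
`{(Z, ζ) ∈ ℝ^{nX} × H¹ : ζ(0) = 0}`. -/
def linOp (A : Matrix (Fin nX) (Fin nX) ℝ) (p q : State nX nz) : Prop :=
  ∃ (dζ : L2 nz) (w : ℝ → Vec nz), IsH1 p.snd dζ w ∧ w 0 = 0 ∧
    q = State.mk (act A p.fst + act S.G₁ (S.K1op w)) (-(actL2 (diag S.lam) dζ))

/-- The nonlinear part of the system. -/
def plantForcing (U : ℝ → Vec nU) (t : ℝ) (p : State nX nz) : State nX nz :=
  let v := S.vel p.fst (U t)
  State.mk
    (act (S.G₁ * diag S.θ * S.Sig v) (S.K2op p.snd) + act S.G₁ (S.h₁ v))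
    (actL2 (diag S.θ * S.Sig v) p.snd + constL2 (S.h₂ v))

/-- `u = (X, z)` is a global mild solution of the ODE-PDE system with input `U`. -/
def IsPlantSolution (U : ℝ → Vec nU) (u : ℝ → State nX nz) : Prop :=
  IsMildSolution (S.linOp S.A₁) (S.plantForcing U) u

/-! ## Measurements, filters and adaptive law -/

/-- First measured output `Y₁(t) = h₂(v(X(t), U(t)))`. -/
def Y₁ (U : ℝ → Vec nU) (u : ℝ → State nX nz) (t : ℝ) : Vec nz :=
  S.h₂ (S.vel (u t).fst (U t))

/-- The matrix `Λ Σ(h₂⁻¹(Y₁(t))) Λ⁻¹`. -/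
def sourceMat (U : ℝ → Vec nU) (u : ℝ → State nX nz) (t : ℝ) : Matrix (Fin nz) (Fin nz) ℝ :=
  diag S.lam * S.Sig (S.h₂.symm (S.Y₁ U u t)) * (diag S.lam)⁻¹

/-- The time primitive `t ↦ ∫_0^t Y₂` of the second measured output
`Y₂ = Θ Λ Σ(h₂⁻¹(Y₁)) Λ⁻¹ Y₁ + Ẏ₁`. Along a mild solution `Y₁` is only continuous, so `Y₂` is
a distribution in time, while its primitive is a continuous function. -/
def Y₂prim (U : ℝ → Vec nU) (u : ℝ → State nX nz) (t : ℝ) : Vec nz :=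
  (∫ s in (0 : ℝ)..t, act (diag S.θ * S.sourceMat U u s) (S.Y₁ U u s))
    + (S.Y₁ U u t - S.Y₁ U u 0)

/-- `Z₁ = 1ᵀ Y₁`. -/
def Z₁ (U : ℝ → Vec nU) (u : ℝ → State nX nz) (t : ℝ) : ℝ := ∑ i, S.Y₁ U u t i

/-- The time primitive of `Z₂ = 1ᵀ Y₂`. -/
def Z₂prim (U : ℝ → Vec nU) (u : ℝ → State nX nz) (t : ℝ) : ℝ := ∑ i, S.Y₂prim U u t i

/-- The unfiltered regressor `ϕ(t) = -Λ Σ(h₂⁻¹(Y₁(t))) Λ⁻¹ Y₁(t)`. -/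
def rawRegressor (U : ℝ → Vec nU) (u : ℝ → State nX nz) (t : ℝ) : Vec nz :=
  -(act (S.sourceMat U u t) (S.Y₁ U u t))

end Plant

/-- The signals of the parameter identifier: filter states `ζ₁, ζ₂, φ`, the matrices `R, Q` of the
gradient law with integral cost, and the parameter estimate `θhat`. -/
structure Identifier (nz : ℕ) where
  ζ₁ : ℝ → ℝ
  ζ₂ : ℝ → ℝ
  φ : ℝ → Vec nz
  R : ℝ → Matrix (Fin nz) (Fin nz) ℝ
  Q : ℝ → Vec nz
  θhat : ℝ → Vec nz

/-- The identifier signals satisfy the filter equations (gain `ϱ`) and the adaptive law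
(gains `ψ`, `Γ`), driven by the measurements taken along `u`; the initial values are arbitrary.
The equation `ζ̇₂ = -ϱ ζ₂ + Z₂` is integrated in time, since `Z₂` is in general
only the distributional derivative of `Z₂prim`. -/
structure Identifier.IsDriven {nX nz nU : ℕ} (I : Identifier nz) (S : Plant nX nz nU)
    (U : ℝ → Vec nU) (u : ℝ → State nX nz) (ϱ ψ : ℝ) (Γ : Matrix (Fin nz) (Fin nz) ℝ) :
    Prop where
  ζ₁_ode : SolvesODE I.ζ₁ fun t => -ϱ * (I.ζ₁ t - S.Z₁ U u t)
  ζ₂_cont : ContinuousOn I.ζ₂ (Ici 0)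
  ζ₂_ode : ∀ t : ℝ, 0 ≤ t →
    I.ζ₂ t = I.ζ₂ 0 + (∫ s in (0 : ℝ)..t, -ϱ * I.ζ₂ s) + S.Z₂prim U u t
  φ_ode : SolvesODE I.φ fun t => -(ϱ • I.φ t) + S.rawRegressor U u t
  R_ode : ∀ i j, SolvesODE (fun t => I.R t i j)
    fun t => -ψ * I.R t i j + I.φ t i * I.φ t j / (1 + ‖I.φ t‖ ^ 2)
  Q_ode : SolvesODE I.Q fun t => -(ψ • I.Q t)
    - ((S.Z₁ U u t - (I.ζ₁ t + I.ζ₂ t)) / (1 + ‖I.φ t‖ ^ 2)) • I.φ t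
  θhat_ode : SolvesODE I.θhat fun t => -(act Γ (act (I.R t) (I.θhat t) + I.Q t))

namespace Plant

variable {nX nz nU : ℕ} (S : Plant nX nz nU)

/-! ## Observer and observer error -/

/-- The non-transport part of the observer
`X̂' = A₁ X̂ + G₁ 𝒦₁ ẑ + G₁ Θ̂ Σ(h₂⁻¹(Y₁)) 𝒦₂ ẑ + G₁ h₁(h₂⁻¹(Y₁)) - L₁ (h₂⁻¹(Y₁) - h₂⁻¹(Ŷ₁))`,
`ẑ_t + Λ ẑ_ξ = Θ̂ Σ(h₂⁻¹(Y₁)) ẑ + Y₁`, with `Ŷ₁ = h₂(v(X̂, U))`. -/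
def observerForcing (U : ℝ → Vec nU) (u : ℝ → State nX nz) (θhat : ℝ → Vec nz)
    (L₁ : Matrix (Fin nX) (Fin nz) ℝ) (t : ℝ) (p : State nX nz) : State nX nz :=
  let v := S.h₂.symm (S.Y₁ U u t)
  let Yhat := S.h₂ (S.vel p.fst (U t))
  State.mk
    (act (S.G₁ * diag (θhat t) * S.Sig v) (S.K2op p.snd) + act S.G₁ (S.h₁ v)
      - act L₁ (v - S.h₂.symm Yhat))
    (actL2 (diag (θhat t) * S.Sig v) p.snd + constL2 (S.Y₁ U u t))

/-- `o = (X̂, ẑ)` is a global mild solution of the observer. -/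
def IsObserverSolution (U : ℝ → Vec nU) (u : ℝ → State nX nz) (θhat : ℝ → Vec nz)
    (L₁ : Matrix (Fin nX) (Fin nz) ℝ) (o : ℝ → State nX nz) : Prop :=
  IsMildSolution (S.linOp S.A₁) (S.observerForcing U u θhat L₁) o

/-- The non-transport part of the observer error dynamics: with `v = v(X(t), U(t))` and
`Θ̃ = Θ - Θ̂`, it is
`(G₁ Θ̂ Σ(v) 𝒦₂ z̃ + G₁ Θ̃ Σ(v) 𝒦₂ z, Θ̂ Σ(v) z̃ + Θ̃ Σ(v) z)`. -/
def errorForcing (U : ℝ → Vec nU) (u : ℝ → State nX nz) (θhat : ℝ → Vec nz)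
    (t : ℝ) (p : State nX nz) : State nX nz :=
  let v := S.vel (u t).fst (U t)
  let Θhat := diag (θhat t)
  let Θtil := diag S.θ - diag (θhat t)
  State.mk
    (act (S.G₁ * Θhat * S.Sig v) (S.K2op p.snd) + act (S.G₁ * Θtil * S.Sig v) (S.K2op (u t).snd))
    (actL2 (Θhat * S.Sig v) p.snd + actL2 (Θtil * S.Sig v) (u t).snd)

/-- `e = (X̃, z̃)` is a global mild solution of the observer error dynamics
`X̃' = (A₁ + L₁ A₂) X̃ + G₁ 𝒦₁ z̃ + F₁ 𝒦₂ z̃ + f₁`, `z̃_t + Λ z̃_ξ = F₂ z̃ + f₂`, `z̃(0,t) = 0`. -/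
def IsErrorSolution (U : ℝ → Vec nU) (u : ℝ → State nX nz) (θhat : ℝ → Vec nz)
    (L₁ : Matrix (Fin nX) (Fin nz) ℝ) (e : ℝ → State nX nz) : Prop :=
  IsMildSolution (S.linOp (S.A₁ + L₁ * S.A₂)) (S.errorForcing U u θhat) e

end Plant

end RollingContact

end

open RollingContact

noncomputable section

namespace RollingContact

/-! ## Strongly continuous semigroups and quadratic energies -/

section Semigroup

variable {E : Type*} [NormedAddCommGroup E] [NormedSpace ℝ E] {T : ℝ → E →L[ℝ] E}

/-! The parameter error and the observer error form a cascade, and each stage is settled by a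
quadratic energy.

Parameters: the filters are built so that `ζ₁ + ζ₂ - Z₁ + φᵀθ` solves `ṙ = -ϱ r`, the distributional
`Ẏ₁` cancelling against `Z₁`. Hence `Rθ + Q` decays exponentially
(`Identifier.IsDriven.gradient_error`). With `θ̃ = θ - θhat`, the energy `θ̃ᵀ Γ⁻¹ θ̃` has derivative
`2 θ̃ᵀ(Rθ + Q) - 2 θ̃ᵀ R θ̃`. The form of `R` is nonnegative up to a term of order `e^{-ψt}` left by
the arbitrary `R(0)`, which gives boundedness; persistent excitation makes it eventually uniformly
positive, which gives exponential decay.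

Observer: the error solves a transport equation feeding an ODE. Its coefficient `Θ̂Σ(v)` is bounded
but not small; since everything leaves through `ξ = 1`, a steep enough weight `e^{-2κξ}` still
yields any prescribed decay rate (`Plant.transport_decay`). The distributed error does not see the
lumped one, so afterwards all terms with `Θ̂` or `Θ̃` are known forcing. The remaining linear
cascade has the energy `ZᵀPZ + c∫e^{-2ξ}|ζ|²`, where `P` belongs to the Hurwitz matrix and the
outflow dissipation at `ξ = 1` absorbs the trace `ζ(1)`, which the `L²` norm does not control
(`Plant.exists_lyapunov`).

Mild solutions need not lie in the domain of the generator, so the energies cannot be differentiated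
directly. A dissipation inequality on the domain is integrated along orbits, extended by density,
and turned into an upper Dini derivative bound along mild solutions
(`IsGenerator.energy_mild_dini`); `le_exp_of_dini` concludes. Boundedness is the case of decay rate
zero, so both claims share one argument. The plant and the observer come with separate semigroups of
the same generator, hence the uniqueness result. -/

theorem IsC0Semigroup.exists_norm_le [CompleteSpace E] (hT : IsC0Semigroup T) (b : ℝ) :
    ∃ M : ℝ, 0 ≤ M ∧ ∀ t ∈ Icc 0 b, ‖T t‖ ≤ M := by
  obtain ⟨C, hC⟩ := banach_steinhaus (g := fun t : Icc (0 : ℝ) b => T t) (fun x => by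
    obtain ⟨C, hC⟩ := isCompact_Icc.exists_bound_of_continuousOn
      ((hT.strongly_continuous x).mono (Icc_subset_Ici_self : Icc 0 b ⊆ Ici 0))
    exact ⟨C, fun i => hC i i.2⟩)
  exact ⟨max C 0, le_max_right _ _, fun t ht => (hC ⟨t, ht⟩).trans (le_max_left _ _)⟩

/-- Joint continuity in time and state: strong continuity at the fixed vector `x`, plus the local
uniform bound for the difference `g a - x`. -/
theorem IsC0Semigroup.tendsto_apply [CompleteSpace E] (hT : IsC0Semigroup T) {α : Type*}
    {l : Filter α} {τ : α → ℝ} {g : α → E} {t₀ : ℝ} {x : E} (ht₀ : 0 ≤ t₀)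
    (hτ : Tendsto τ l (𝓝[Ici 0] t₀)) (hg : Tendsto g l (𝓝 x)) :
    Tendsto (fun a => T (τ a) (g a)) l (𝓝 (T t₀ x)) := by
  obtain ⟨M, hM0, hM⟩ := hT.exists_norm_le (t₀ + 1)
  have h1 : Tendsto (fun a => T (τ a) x) l (𝓝 (T t₀ x)) :=
    (hT.strongly_continuous x t₀ ht₀).tendsto.comp hτ
  have h2 : Tendsto (fun a => T (τ a) (g a - x)) l (𝓝 0) := by
    have h3 : Tendsto (fun a => M * ‖g a - x‖) l (𝓝 0) := by
      have := ((hg.sub_const x).norm.const_mul M)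
      simpa using this
    refine squeeze_zero_norm' ?_ h3
    have h4 : ∀ᶠ s in 𝓝[Ici 0] t₀, s ∈ Icc (0 : ℝ) (t₀ + 1) := by
      filter_upwards [self_mem_nhdsWithin,
        mem_nhdsWithin_of_mem_nhds (Iio_mem_nhds (show t₀ < t₀ + 1 by linarith))] with s h1 h2
      exact ⟨h1, le_of_lt h2⟩
    filter_upwards [hτ.eventually h4] with a ha
    exact (T (τ a)).le_of_opNorm_le (hM _ ha) _
  simpa using h2.add h1

theorem IsC0Semigroup.continuousOn_convolution [CompleteSpace E] (hT : IsC0Semigroup T)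
    {g : ℝ → E} (hg : ContinuousOn g (Ici 0)) (t : ℝ) :
    ContinuousOn (fun s => T (t - s) (g s)) (Icc 0 t) := by
  intro s hs
  refine hT.tendsto_apply (by linarith [hs.2]) ?_
    ((hg s hs.1).mono Icc_subset_Ici_self)
  refine tendsto_nhdsWithin_iff.2 ⟨?_, ?_⟩
  · exact ((continuous_const.sub continuous_id).tendsto s).mono_left nhdsWithin_le_nhds
  · filter_upwards [self_mem_nhdsWithin] with r hr
    exact sub_nonneg.2 hr.2

variable {𝒜 : E → E → Prop}

/-- The semigroup law factors `T t` out of the difference quotient. Only the right derivative is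
obtained, which is all that the comparison arguments below require. -/
theorem IsGenerator.tendsto_slope (hT : IsC0Semigroup T) (h𝒜 : IsGenerator T 𝒜) {x y : E}
    (hxy : 𝒜 x y) {t : ℝ} (ht : 0 ≤ t) :
    HasDerivWithinAt (fun s => T s x) (T t y) (Ici t) t := by
  rw [hasDerivWithinAt_iff_tendsto_slope, Ici_sdiff_left]
  have h1 : Tendsto (fun z : ℝ => z - t) (𝓝[>] t) (𝓝[>] 0) := by
    refine tendsto_nhdsWithin_iff.2 ⟨?_, ?_⟩
    · have : Tendsto (fun z : ℝ => z - t) (𝓝 t) (𝓝 (t - t)) :=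
        (continuous_id.sub continuous_const).tendsto t
      rw [sub_self] at this
      exact this.mono_left nhdsWithin_le_nhds
    · filter_upwards [self_mem_nhdsWithin] with z hz
      exact sub_pos.2 (mem_Ioi.1 hz)
  have h2 := ((T t).continuous.tendsto y).comp (((h𝒜 x y).1 hxy).comp h1)
  refine h2.congr' ?_
  filter_upwards [self_mem_nhdsWithin] with z hz
  have hz' : t ≤ z := le_of_lt hz
  have h3 : T z x = T t (T (z - t) x) := by
    have := hT.add t (z - t) ht (by linarith)
    rw [show t + (z - t) = z by ring] at this
    rw [this]; rfl
  simp only [Function.comp_apply, slope_def_module, map_smul, map_sub, h3]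

theorem IsGenerator.apply_mem (hT : IsC0Semigroup T) (h𝒜 : IsGenerator T 𝒜) {x y : E}
    (hxy : 𝒜 x y) {t : ℝ} (ht : 0 ≤ t) : 𝒜 (T t x) (T t y) := by
  rw [h𝒜]
  have h2 := ((T t).continuous.tendsto y).comp ((h𝒜 x y).1 hxy)
  refine h2.congr' ?_
  filter_upwards [self_mem_nhdsWithin] with z hz
  have hz' : 0 ≤ z := le_of_lt hz
  have h3 : T z (T t x) = T t (T z x) := by
    have h4 := hT.add t z ht hz'
    have h5 := hT.add z t hz' ht
    rw [add_comm] at h5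
    exact (congrArg (fun L => L x) (h5.symm.trans h4))
  simp only [Function.comp_apply, map_smul, map_sub, h3]

theorem IsGenerator.sub (h𝒜 : IsGenerator T 𝒜) {x y x' y' : E} (h : 𝒜 x y) (h' : 𝒜 x' y') :
    𝒜 (x - x') (y - y') := by
  rw [h𝒜] at *
  refine (h.sub h').congr fun z => ?_
  rw [← smul_sub, map_sub]
  congr 1
  abel

omit [NormedSpace ℝ E] in
theorem intervalIntegrable_of_continuousOn_Ici {f : ℝ → E} (hf : ContinuousOn f (Ici 0))
    {a b : ℝ} (ha : 0 ≤ a) (hb : 0 ≤ b) : IntervalIntegrable f volume a b :=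
  (hf.mono fun _ hs => (le_min ha hb).trans hs.1).intervalIntegrable

theorem hasDerivWithinAt_integral_of_continuousOn_Ici [CompleteSpace E] {f : ℝ → E}
    (hf : ContinuousOn f (Ici 0)) {a t : ℝ} (ha : 0 ≤ a) (ht : 0 ≤ t) :
    HasDerivWithinAt (fun z => ∫ r in a..z, f r) (f t) (Ici t) t := by
  refine intervalIntegral.integral_hasDerivWithinAt_right (t := Ioi t)
    (intervalIntegrable_of_continuousOn_Ici hf ha ht) ?_
    ((hf t ht).mono fun s hs => ht.trans (le_of_lt (mem_Ioi.1 hs)))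
  exact (hf.mono fun s hs => ht.trans (le_of_lt (mem_Ioi.1 hs))
    ).stronglyMeasurableAtFilter_nhdsWithin measurableSet_Ioi t

/-- The domain of the generator is dense. -/
theorem IsGenerator.dense_domain [CompleteSpace E] (hT : IsC0Semigroup T)
    (h𝒜 : IsGenerator T 𝒜) : Dense {x | ∃ y, 𝒜 x y} := by
  intro x
  have hcont := hT.strongly_continuous x
  have hint : ∀ a b : ℝ, 0 ≤ a → 0 ≤ b → IntervalIntegrable (fun r => T r x) volume a b :=
    fun a b ha hb => intervalIntegrable_of_continuousOn_Ici hcont ha hb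
  have hderiv : ∀ a : ℝ, 0 ≤ a →
      Tendsto (fun z => z⁻¹ • ∫ r in a..(a + z), T r x) (𝓝[>] 0) (𝓝 (T a x)) := by
    intro a ha
    have h1 := hasDerivWithinAt_integral_of_continuousOn_Ici hcont ha ha
    rw [hasDerivWithinAt_iff_tendsto_slope, Ici_sdiff_left] at h1
    have h2 : Tendsto (fun z : ℝ => a + z) (𝓝[>] 0) (𝓝[>] a) := by
      refine tendsto_nhdsWithin_iff.2 ⟨?_, ?_⟩
      · have : Tendsto (fun z : ℝ => a + z) (𝓝 0) (𝓝 (a + 0)) :=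
          (continuous_const.add continuous_id).tendsto 0
        rw [add_zero] at this
        exact this.mono_left nhdsWithin_le_nhds
      · filter_upwards [self_mem_nhdsWithin] with z hz
        exact lt_add_of_pos_right a (mem_Ioi.1 hz)
    refine (h1.comp h2).congr fun z => ?_
    simp [slope_def_module]
  -- Orbit averages lie in the domain: applying `T z - 1` to the integral shifts its window, so only
  -- the two end pieces survive. Dividing by `h` and letting `h ↓ 0` recovers `x`.
  have hmem : ∀ h : ℝ, 0 < h → 𝒜 (∫ r in (0 : ℝ)..h, T r x) (T h x - x) := by
    intro h hh
    rw [h𝒜]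
    have h0 := (hderiv h hh.le).sub (hderiv 0 le_rfl)
    rw [hT.zero] at h0
    refine h0.congr' ?_
    filter_upwards [self_mem_nhdsWithin] with z hz
    have hz' : 0 ≤ z := le_of_lt (mem_Ioi.1 hz)
    rw [← smul_sub]
    congr 1
    have h3 : T z (∫ r in (0 : ℝ)..h, T r x) = ∫ r in z..(z + h), T r x := by
      rw [← ContinuousLinearMap.intervalIntegral_comp_comm _ (hint 0 h le_rfl hh.le)]
      have h4 : ∫ r in (0 : ℝ)..h, T z (T r x) = ∫ r in (0 : ℝ)..h, T (z + r) x := by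
        refine intervalIntegral.integral_congr fun r hr => ?_
        rw [uIcc_of_le hh.le] at hr
        rw [hT.add z r hz' hr.1]; rfl
      rw [h4, intervalIntegral.integral_comp_add_left (fun r => T r x)]
      simp
    rw [h3, zero_add]
    have e1 := intervalIntegral.integral_add_adjacent_intervals
      (hint 0 z le_rfl hz') (hint z (z + h) hz' (by linarith))
    have e2 := intervalIntegral.integral_add_adjacent_intervals
      (hint 0 h le_rfl hh.le) (hint h (h + z) hh.le (by linarith))
    rw [add_comm h z] at e2 ⊢
    rw [← e1] at e2
    rw [sub_eq_sub_iff_add_eq_add, add_comm, e2, add_comm]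
  have hsmul : ∀ (c : ℝ) (p q : E), 𝒜 p q → 𝒜 (c • p) (c • q) := by
    intro c p q hpq
    rw [h𝒜] at *
    refine (hpq.const_smul c).congr fun z => ?_
    rw [map_smul, ← smul_sub, smul_comm]
  refine mem_closure_of_tendsto (f := fun z : ℝ => z⁻¹ • ∫ r in (0 : ℝ)..(0 + z), T r x)
    (b := 𝓝[>] 0) ?_ ?_
  · simpa [hT.zero] using hderiv 0 le_rfl
  · filter_upwards [self_mem_nhdsWithin] with z hz
    rw [zero_add]
    exact ⟨_, hsmul _ _ _ (hmem z hz)⟩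

/-- A dissipation inequality for the generator holds in integrated form along all orbits. -/
theorem IsGenerator.energy_orbit_le [CompleteSpace E] (hT : IsC0Semigroup T)
    (h𝒜 : IsGenerator T 𝒜) {b c : E →L[ℝ] E →L[ℝ] ℝ} (hb : ∀ x y, b x y = b y x)
    (hbc : ∀ x y, 𝒜 x y → 2 * b x y ≤ c x x) (x : E) {δ : ℝ} (hδ : 0 ≤ δ) :
    b (T δ x) (T δ x) ≤ b x x + ∫ r in (0 : ℝ)..δ, c (T r x) (T r x) := by
  have hcc : ∀ x, ContinuousOn (fun r => c (T r x) (T r x)) (Ici 0) := fun x =>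
    (c.continuous.comp_continuousOn (hT.strongly_continuous x)).clm_apply
      (hT.strongly_continuous x)
  have hbb : ∀ x, ContinuousOn (fun r => b (T r x) (T r x)) (Ici 0) := fun x =>
    (b.continuous.comp_continuousOn (hT.strongly_continuous x)).clm_apply
      (hT.strongly_continuous x)
  -- Both sides are continuous in `x`, the integral by dominated convergence, so it suffices to
  -- treat the dense domain, where orbits are right differentiable.
  have hclosed : IsClosed {x | b (T δ x) (T δ x) ≤
      b x x + ∫ r in (0 : ℝ)..δ, c (T r x) (T r x)} := by
    refine isClosed_le ?_ (Continuous.add ?_ ?_)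
    · exact (b.continuous.comp (T δ).continuous).clm_apply (T δ).continuous
    · exact b.continuous.clm_apply continuous_id
    · refine continuous_iff_continuousAt.2 fun x₀ => ?_
      obtain ⟨M, hM0, hM⟩ := hT.exists_norm_le δ
      refine intervalIntegral.continuousAt_of_dominated_interval
        (bound := fun _ => ‖c‖ * (M * (‖x₀‖ + 1)) * (M * (‖x₀‖ + 1))) ?_ ?_
        intervalIntegrable_const ?_
      · refine Eventually.of_forall fun x => ?_
        exact (intervalIntegrable_of_continuousOn_Ici (hcc x) le_rfl hδ
          ).aestronglyMeasurable_restrict_uIoc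
      · have h1 : ∀ᶠ x in 𝓝 x₀, ‖x‖ < ‖x₀‖ + 1 :=
          continuous_norm.continuousAt.eventually (gt_mem_nhds (lt_add_one _))
        filter_upwards [h1] with x hx
        refine Eventually.of_forall fun r hr => ?_
        rw [uIoc_of_le hδ] at hr
        have h2 : ‖T r x‖ ≤ M * (‖x₀‖ + 1) :=
          ((T r).le_of_opNorm_le (hM r ⟨hr.1.le, hr.2⟩) x).trans (by gcongr)
        refine (c.le_opNorm₂ _ _).trans ?_
        gcongr
      · refine Eventually.of_forall fun r _ => Continuous.continuousAt ?_
        exact (c.continuous.comp (T r).continuous).clm_apply (T r).continuous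
  refine hclosed.closure_subset_iff.2 ?_ (h𝒜.dense_domain hT x)
  rintro x ⟨y, hxy⟩
  have hB : ∀ t ∈ Ico 0 δ, HasDerivWithinAt
      (fun t => b x x + ∫ r in (0 : ℝ)..t, c (T r x) (T r x))
      (c (T t x) (T t x)) (Ici t) t := fun t ht =>
    (hasDerivWithinAt_integral_of_continuousOn_Ici (hcc x) le_rfl ht.1).const_add _
  refine image_le_of_liminf_slope_right_le_deriv_boundary
    (f := fun t => b (T t x) (T t x)) (a := 0) (b := δ)
    (B := fun t => b x x + ∫ r in (0 : ℝ)..t, c (T r x) (T r x))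
    ((hbb x).mono Icc_subset_Ici_self) ?_ ?_ hB ?_ ⟨hδ, le_rfl⟩
  · simp [hT.zero]
  · have hi := intervalIntegral.continuousOn_primitive_interval'
      (intervalIntegrable_of_continuousOn_Ici (hcc x) le_rfl hδ) left_mem_uIcc
    rw [uIcc_of_le hδ] at hi
    exact continuousOn_const.add hi
  · intro t ht r hr
    have h1 := h𝒜.tendsto_slope hT hxy ht.1
    have h2 : HasDerivWithinAt (fun t => b (T t x) (T t x))
        (b (T t y) (T t x) + b (T t x) (T t y)) (Ici t) t :=
      (b.hasFDerivAt.comp_hasDerivWithinAt t h1).clm_apply h1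
    have h3 : b (T t y) (T t x) + b (T t x) (T t y) < r := by
      have := hbc _ _ (h𝒜.apply_mem hT hxy ht.1)
      rw [hb (T t y)]
      linarith
    rw [hasDerivWithinAt_iff_tendsto_slope, Ici_sdiff_left] at h2
    exact (h2.eventually (gt_mem_nhds h3)).frequently

/-- A semigroup is determined by its generator, if the latter is quasi-dissipative. -/
theorem IsGenerator.unique [CompleteSpace E] {T' : ℝ → E →L[ℝ] E} (hT : IsC0Semigroup T)
    (h𝒜 : IsGenerator T 𝒜) (hT' : IsC0Semigroup T') (h𝒜' : IsGenerator T' 𝒜)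
    {b : E →L[ℝ] E →L[ℝ] ℝ} {K : ℝ} (hb : ∀ x y, b x y = b y x)
    (hb0 : ∀ x, b x x ≤ 0 → x = 0) (hbK : ∀ x y, 𝒜 x y → 2 * b x y ≤ K * b x x)
    {t : ℝ} (ht : 0 ≤ t) : T t = T' t := by
  suffices h : ∀ x ∈ {x | ∃ y, 𝒜 x y}, T t x = T' t x by
    ext1 x
    exact congrFun (Continuous.ext_on (h𝒜.dense_domain hT) (T t).continuous (T' t).continuous h) x
  rintro x ⟨y, hxy⟩
  set d : ℝ → E := fun s => T s x - T' s x with hd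
  have hdc : ContinuousOn d (Ici 0) :=
    (hT.strongly_continuous x).sub (hT'.strongly_continuous x)
  have hderiv : ∀ s, 0 ≤ s → HasDerivWithinAt d (T s y - T' s y) (Ici s) s := fun s hs =>
    (h𝒜.tendsto_slope hT hxy hs).sub (h𝒜'.tendsto_slope hT' hxy hs)
  have hmem : ∀ s, 0 ≤ s → 𝒜 (d s) (T s y - T' s y) := fun s hs =>
    h𝒜.sub (h𝒜.apply_mem hT hxy hs) (h𝒜'.apply_mem hT' hxy hs)
  -- The difference of the two orbits stays in the domain, starts at zero and satisfies `ḋ = 𝒜 d`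
  -- from the right; Grönwall keeps its energy at zero.
  have h := le_gronwallBound_of_liminf_deriv_right_le (f := fun s => b (d s) (d s))
    (f' := fun s => 2 * b (d s) (T s y - T' s y)) (δ := 0) (K := K) (ε := 0) (a := 0) (b := t)
    (((b.continuous.comp_continuousOn hdc).clm_apply hdc).mono Icc_subset_Ici_self) ?_ ?_ ?_
    t ⟨ht, le_rfl⟩
  · rw [gronwallBound_ε0, zero_mul] at h
    exact sub_eq_zero.1 (hb0 _ h)
  · intro s hs r hr
    have h1 := hderiv s hs.1
    have h2 := (b.hasFDerivAt.comp_hasDerivWithinAt s h1).clm_apply h1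
    rw [hasDerivWithinAt_iff_tendsto_slope, Ici_sdiff_left] at h2
    refine ((h2.eventually_lt_const (u := r) ?_).mono fun z hz => ?_).frequently
    · rw [hb (T s y - T' s y)]
      simp only [Function.comp_apply] at *
      linarith
    · simpa [slope_def_field, div_eq_inv_mul] using hz
  · simp [hd, hT.zero, hT'.zero]
  · intro s hs
    simpa using hbK _ _ (hmem s hs.1)

/-! ### Energies along mild solutions -/

section Mild

variable {e g : ℝ → E}

/-- The semigroup law moves the initial time to `t`, which makes increments on short intervals
accessible. -/
theorem IsC0Semigroup.mild_restart [CompleteSpace E] (hT : IsC0Semigroup T)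
    (hg : ContinuousOn g (Ici 0))
    (he : ∀ t, 0 ≤ t → e t = T t (e 0) + ∫ s in (0 : ℝ)..t, T (t - s) (g s))
    {t z : ℝ} (ht : 0 ≤ t) (htz : t ≤ z) :
    e z = T (z - t) (e t) + ∫ s in t..z, T (z - s) (g s) := by
  have hz : 0 ≤ z := ht.trans htz
  have hi : IntervalIntegrable (fun s => T (z - s) (g s)) volume 0 z := by
    refine ContinuousOn.intervalIntegrable ?_
    rw [uIcc_of_le hz]
    exact hT.continuousOn_convolution hg z
  have hi' : IntervalIntegrable (fun s => T (t - s) (g s)) volume 0 t := by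
    refine ContinuousOn.intervalIntegrable ?_
    rw [uIcc_of_le ht]
    exact hT.continuousOn_convolution hg t
  have hadd : ∀ s, 0 ≤ s → s ≤ t → ∀ x, T (z - s) x = T (z - t) (T (t - s) x) := by
    intro s hs hst x
    have := hT.add (z - t) (t - s) (by linarith) (by linarith)
    rw [show z - t + (t - s) = z - s by ring] at this
    rw [this]; rfl
  rw [he z hz, he t ht, map_add, ← ContinuousLinearMap.intervalIntegral_comp_comm _ hi',
    ← intervalIntegral.integral_add_adjacent_intervals (b := t)
      (hi.mono_set (uIcc_subset_uIcc_left (by rw [uIcc_of_le hz]; exact ⟨ht, htz⟩)))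
      (hi.mono_set (uIcc_subset_uIcc_right (by rw [uIcc_of_le hz]; exact ⟨ht, htz⟩))), add_assoc]
  congr 1
  · simpa using hadd 0 le_rfl ht (e 0)
  · congr 1
    refine intervalIntegral.integral_congr fun s hs => ?_
    rw [uIcc_of_le ht] at hs
    exact hadd s hs.1 hs.2 _

theorem IsC0Semigroup.tendsto_convolution [CompleteSpace E] (hT : IsC0Semigroup T)
    (hg : ContinuousOn g (Ici 0)) {t : ℝ} (ht : 0 ≤ t) :
    Tendsto (fun z => (z - t)⁻¹ • ∫ s in t..z, T (z - s) (g s)) (𝓝[>] t) (𝓝 (g t)) := by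
  have h1 : Tendsto (fun p : ℝ × ℝ => T p.1 (g p.2)) (𝓝[Ici 0] 0 ×ˢ 𝓝[Ici t] t)
      (𝓝 (g t)) := by
    have := hT.tendsto_apply (l := 𝓝[Ici 0] (0 : ℝ) ×ˢ 𝓝[Ici t] t) (τ := Prod.fst)
      (g := fun p => g p.2) (x := g t) le_rfl tendsto_fst
      (((hg t ht).mono fun s hs => ht.trans (mem_Ici.1 hs)).tendsto.comp tendsto_snd)
    simpa [hT.zero] using this
  rw [Metric.tendsto_nhds]
  intro ε hε
  have h2 := (Metric.tendsto_nhds.1 h1) (ε / 2) (by positivity)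
  obtain ⟨A, hA, B, hB, hAB⟩ := eventually_prod_iff.1 h2
  obtain ⟨a, ha, haA⟩ := mem_nhdsGE_iff_exists_Ico_subset.1 hA
  obtain ⟨c, hc, hcB⟩ := mem_nhdsGE_iff_exists_Ico_subset.1 hB
  have h3 : ∀ᶠ z in 𝓝[>] t, z < min (t + a) c :=
    mem_nhdsWithin_of_mem_nhds (Iio_mem_nhds (lt_min (lt_add_of_pos_right t ha) hc))
  filter_upwards [h3, self_mem_nhdsWithin] with z hz htz
  have htz' : t < z := htz
  have hi : IntervalIntegrable (fun s => T (z - s) (g s)) volume t z := by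
    refine ContinuousOn.intervalIntegrable ?_
    rw [uIcc_of_le htz'.le]
    exact (hT.continuousOn_convolution hg z).mono (Icc_subset_Icc_left ht)
  have h4 : ‖∫ s in t..z, (T (z - s) (g s) - g t)‖ ≤ ε / 2 * |z - t| := by
    refine intervalIntegral.norm_integral_le_of_norm_le_const fun s hs => ?_
    rw [uIoc_of_le htz'.le] at hs
    have := hAB (haA (show z - s ∈ Ico 0 a from
        ⟨by linarith [hs.2], by linarith [hs.1, hz.trans_le (min_le_left _ _)]⟩))
      (hcB (show s ∈ Ico t c from ⟨hs.1.le, by linarith [hs.2, hz.trans_le (min_le_right _ _)]⟩))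
    rw [dist_eq_norm] at this
    exact this.le
  rw [intervalIntegral.integral_sub hi intervalIntegrable_const,
    intervalIntegral.integral_const, abs_of_pos (sub_pos.2 htz')] at h4
  have h5 : (z - t)⁻¹ • (∫ s in t..z, T (z - s) (g s)) - g t =
      (z - t)⁻¹ • ((∫ s in t..z, T (z - s) (g s)) - (z - t) • g t) := by
    rw [smul_sub, inv_smul_smul₀ (sub_pos.2 htz').ne']
  rw [dist_eq_norm, h5, norm_smul, norm_inv, Real.norm_eq_abs, abs_of_pos (sub_pos.2 htz'),
    inv_mul_lt_iff₀ (sub_pos.2 htz')]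
  have := sub_pos.2 htz'
  nlinarith

/-- Upper right Dini derivative of an energy along a mild solution with continuous forcing. -/
theorem IsGenerator.energy_mild_dini [CompleteSpace E] (hT : IsC0Semigroup T)
    (h𝒜 : IsGenerator T 𝒜) {b c : E →L[ℝ] E →L[ℝ] ℝ} (hb : ∀ x y, b x y = b y x)
    (hbc : ∀ x y, 𝒜 x y → 2 * b x y ≤ c x x) (hg : ContinuousOn g (Ici 0))
    (he : ∀ t, 0 ≤ t → e t = T t (e 0) + ∫ s in (0 : ℝ)..t, T (t - s) (g s))
    {t : ℝ} (ht : 0 ≤ t) {r : ℝ} (hr : c (e t) (e t) + 2 * b (e t) (g t) < r) :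
    ∃ᶠ z in 𝓝[>] t, slope (fun s => b (e s) (e s)) t z < r := by
  set x := e t with hx
  set G : ℝ → E := fun z => (z - t)⁻¹ • ∫ s in t..z, T (z - s) (g s) with hG
  have hGt : Tendsto G (𝓝[>] t) (𝓝 (g t)) := hT.tendsto_convolution hg ht
  have hsub : Tendsto (fun z : ℝ => z - t) (𝓝[>] t) (𝓝[>] 0) := by
    refine tendsto_nhdsWithin_iff.2 ⟨?_, ?_⟩
    · have : Tendsto (fun z : ℝ => z - t) (𝓝 t) (𝓝 (t - t)) :=
        (continuous_id.sub continuous_const).tendsto t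
      rw [sub_self] at this
      exact this.mono_left nhdsWithin_le_nhds
    · filter_upwards [self_mem_nhdsWithin] with z hz
      exact sub_pos.2 (mem_Ioi.1 hz)
  have hcc : ContinuousOn (fun r => c (T r x) (T r x)) (Ici 0) :=
    (c.continuous.comp_continuousOn (hT.strongly_continuous x)).clm_apply
      (hT.strongly_continuous x)
  have hI : Tendsto (fun z => (z - t)⁻¹ * ∫ r in (0 : ℝ)..(z - t), c (T r x) (T r x))
      (𝓝[>] t) (𝓝 (c x x)) := by
    have h1 := hasDerivWithinAt_integral_of_continuousOn_Ici hcc le_rfl le_rfl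
    rw [hasDerivWithinAt_iff_tendsto_slope, Ici_sdiff_left] at h1
    have h2 := h1.comp hsub
    simpa [Function.comp_def, slope_def_module, hT.zero] using h2
  have hTx : Tendsto (fun z => T (z - t) x) (𝓝[>] t) (𝓝 x) := by
    have := hT.tendsto_apply (l := 𝓝[>] t) (τ := fun z => z - t) (g := fun _ => x) (x := x)
      le_rfl (hsub.mono_right (nhdsWithin_mono _ Ioi_subset_Ici_self)) tendsto_const_nhds
    simpa [hT.zero] using this
  have hbt : ∀ {p q : ℝ → E} {p₀ q₀ : E}, Tendsto p (𝓝[>] t) (𝓝 p₀) →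
      Tendsto q (𝓝[>] t) (𝓝 q₀) → Tendsto (fun z => b (p z) (q z)) (𝓝[>] t) (𝓝 (b p₀ q₀)) :=
    fun hp hq => (b.isBoundedBilinearMap.continuous.tendsto (_, _)).comp (hp.prodMk_nhds hq)
  -- With `δ = z - t`, restarting gives `e z = T(δ) x + δ G z`. The difference quotient of the
  -- energy is then at most an averaged `c`, a cross term, and a quadratic term carrying a factor
  -- `δ` that vanishes.
  have hlim : Tendsto (fun z => (z - t)⁻¹ * (∫ r in (0 : ℝ)..(z - t), c (T r x) (T r x))
      + 2 * b (T (z - t) x) (G z) + (z - t) * b (G z) (G z)) (𝓝[>] t)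
      (𝓝 (c x x + 2 * b x (g t) + 0 * b (g t) (g t))) :=
    (hI.add ((hbt hTx hGt).const_mul 2)).add
      ((hsub.mono_right nhdsWithin_le_nhds).mul (hbt hGt hGt))
  rw [zero_mul, add_zero] at hlim
  refine Eventually.frequently ?_
  filter_upwards [hlim.eventually (gt_mem_nhds hr), self_mem_nhdsWithin] with z hz htz
  have hδ : 0 < z - t := sub_pos.2 (mem_Ioi.1 htz)
  refine lt_of_le_of_lt ?_ hz
  have hez : e z = T (z - t) x + (z - t) • G z := by
    rw [hT.mild_restart hg he ht (le_of_lt (mem_Ioi.1 htz)), hG]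
    simp only
    rw [smul_inv_smul₀ hδ.ne']
  have hen := h𝒜.energy_orbit_le hT hb hbc x hδ.le
  rw [slope_def_field, div_le_iff₀ hδ]
  have hexp : b (e z) (e z) = b (T (z - t) x) (T (z - t) x)
      + 2 * (z - t) * b (T (z - t) x) (G z) + (z - t) ^ 2 * b (G z) (G z) := by
    rw [hez]
    simp only [map_add, map_smul, add_apply, smul_apply,
      smul_eq_mul]
    rw [hb (G z) (T (z - t) x)]
    ring
  have hinv : (z - t)⁻¹ * (z - t) = 1 := inv_mul_cancel₀ hδ.ne'
  calc b (e z) (e z) - b (e t) (e t)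
      ≤ (∫ r in (0 : ℝ)..(z - t), c (T r x) (T r x))
        + 2 * (z - t) * b (T (z - t) x) (G z) + (z - t) ^ 2 * b (G z) (G z) := by
        rw [hexp]; linarith
    _ = _ := by
        rw [add_mul, add_mul, mul_right_comm (z - t)⁻¹, hinv]; ring

end Mild

end Semigroup

/-- Exponential comparison principle with upper right Dini derivatives. -/
theorem le_exp_of_dini {f f' : ℝ → ℝ} {a C μ : ℝ} (hf : ContinuousOn f (Ici 0)) (hμ : μ < a)
    (hC : 0 ≤ C) (hf' : ∀ t, 0 ≤ t → ∀ r, f' t < r → ∃ᶠ z in 𝓝[>] t, slope f t z < r)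
    (hbound : ∀ t, 0 ≤ t → f' t ≤ -a * f t + C * Real.exp (-μ * t)) (t : ℝ) (ht : 0 ≤ t) :
    f t ≤ (|f 0| + C / (a - μ) + 1) * Real.exp (-μ * t) := by
  have haμ : 0 < a - μ := sub_pos.2 hμ
  have hder : ∀ x : ℝ, HasDerivAt
      (fun t => (|f 0| + C / (a - μ) + 1) * Real.exp (-μ * t))
      ((|f 0| + C / (a - μ) + 1) * (Real.exp (-μ * x) * (-μ))) x := fun x => by
    have h1 : HasDerivAt (fun t : ℝ => -μ * t) (-μ) x := by
      simpa using (hasDerivAt_id x).const_mul (-μ)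
    exact h1.exp.const_mul _
  -- The exponential is a barrier. The `+ 1` in its constant makes it a strict supersolution
  -- wherever `f` touches it.
  refine image_le_of_liminf_slope_right_lt_deriv_boundary' (f := f) (f' := f') (a := 0) (b := t)
    (hf.mono Icc_subset_Ici_self) (fun x hx r hr => hf' x hx.1 r hr) ?_
    (fun x _ => (hder x).continuousAt.continuousWithinAt)
    (fun x _ => (hder x).hasDerivWithinAt) ?_ ⟨ht, le_rfl⟩
  · have : 0 ≤ C / (a - μ) := by positivity
    simp only [mul_zero, Real.exp_zero, mul_one]
    linarith [le_abs_self (f 0)]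
  · intro x hx hfx
    refine (hbound x hx.1).trans_lt ?_
    have hE := Real.exp_pos (-μ * x)
    have hK : C < (a - μ) * (|f 0| + C / (a - μ) + 1) := by
      have h1 : (a - μ) * (C / (a - μ)) = C := by field_simp
      have h2 : 0 ≤ (a - μ) * |f 0| := by positivity
      nlinarith
    have := mul_lt_mul_of_pos_right hK hE
    rw [hfx]
    nlinarith

/-! ## Matrices acting on Euclidean vectors -/

section Act

variable {l m n : ℕ}

theorem act_apply (M : Matrix (Fin m) (Fin n) ℝ) (x : Vec n) (i : Fin m) :
    act M x i = ∑ j, M i j * x j := by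
  simp [act, Matrix.toLpLin_apply, Matrix.mulVec, dotProduct]

theorem act_mul (M : Matrix (Fin l) (Fin m) ℝ) (N : Matrix (Fin m) (Fin n) ℝ) (x : Vec n) :
    act (M * N) x = act M (act N x) := by
  ext i
  simp only [act_apply, Matrix.mul_apply, Finset.sum_mul, Finset.mul_sum]
  rw [Finset.sum_comm]
  simp only [mul_assoc]

theorem act_one (x : Vec n) : act (1 : Matrix (Fin n) (Fin n) ℝ) x = x := by
  ext i
  simp [act_apply, Matrix.one_apply]

theorem act_transpose (M : Matrix (Fin m) (Fin n) ℝ) (x : Vec n) (y : Vec m) :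
    inner ℝ (act M x) y = inner ℝ x (act M.transpose y) := by
  simp only [PiLp.inner_apply, act_apply, RCLike.inner_apply, conj_trivial, Finset.mul_sum,
    Matrix.transpose_apply, Finset.sum_mul]
  rw [Finset.sum_comm]
  refine Finset.sum_congr rfl fun i _ => Finset.sum_congr rfl fun j _ => by ring

/-- The linear map `M ↦ act M`. -/
def actLin (m n : ℕ) : Matrix (Fin m) (Fin n) ℝ →ₗ[ℝ] (Vec n →L[ℝ] Vec m) where
  toFun := act
  map_add' M N := by
    ext x i
    simp [act_apply, add_mul, Finset.sum_add_distrib]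
  map_smul' c M := by
    ext x i
    simp [act_apply, Finset.mul_sum, mul_assoc]

theorem act_add (M N : Matrix (Fin m) (Fin n) ℝ) : act (M + N) = act M + act N :=
  (actLin m n).map_add M N

theorem act_sub (M N : Matrix (Fin m) (Fin n) ℝ) : act (M - N) = act M - act N :=
  (actLin m n).map_sub M N

theorem act_zero : act (0 : Matrix (Fin m) (Fin n) ℝ) = 0 := (actLin m n).map_zero

theorem continuous_act : Continuous (act : Matrix (Fin m) (Fin n) ℝ → _) :=
  (actLin m n).continuous_of_finiteDimensional

end Act

/-! ## Lyapunov functions of Hurwitz matrices -/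

section Lyapunov

/-- The spectrum of a Cayley transform of an element whose spectrum lies in the open left half
plane is contained in the open unit disc. -/
theorem norm_lt_one_of_mem_spectrum_cayley {R : Type*} [Ring R] [Algebra ℂ R] {a c : R}
    (ha : ∀ μ ∈ spectrum ℂ a, μ.re < 0) (hu : IsUnit (1 - a)) (hc : c * (1 - a) = 1 + a)
    {μ : ℂ} (hμ : μ ∈ spectrum ℂ c) : ‖μ‖ < 1 := by
  rw [spectrum.mem_iff] at hμ
  -- Since `(μ - c)(1 - a) = (μ - 1) - (μ + 1)a`, the Möbius image `(μ - 1)/(μ + 1)` is in the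
  -- spectrum of `a`; it has negative real part exactly when `|μ| < 1`. The value `μ = -1` is
  -- excluded, as it leaves the unit `-2`.
  have h1 : ¬ IsUnit (algebraMap ℂ R (μ - 1) - algebraMap ℂ R (μ + 1) * a) := by
    intro h
    apply hμ
    have h2 : (algebraMap ℂ R μ - c) * (1 - a) =
        algebraMap ℂ R (μ - 1) - algebraMap ℂ R (μ + 1) * a := by
      rw [sub_mul, hc, map_sub, map_add, map_one]
      noncomm_ring
    rw [← h2] at h
    obtain ⟨u, hu⟩ := hu
    rw [← hu, Units.isUnit_mul_units] at h
    exact h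
  have hne : μ + 1 ≠ 0 := by
    intro h0
    apply h1
    rw [h0, map_zero, zero_mul, sub_zero]
    have : μ - 1 ≠ 0 := by
      have : μ = -1 := by linear_combination h0
      rw [this]; norm_num
    exact (IsUnit.mk0 _ this).map (algebraMap ℂ R)
  have h2 : (μ - 1) / (μ + 1) ∈ spectrum ℂ a := by
    rw [spectrum.mem_iff]
    intro h
    apply h1
    have := ((IsUnit.mk0 _ hne).map (algebraMap ℂ R)).mul h
    rwa [mul_sub, ← map_mul, mul_div_cancel₀ _ hne] at this
  have h3 := ha _ h2
  rw [Complex.div_re, ← add_div, div_lt_iff₀ (Complex.normSq_pos.2 hne), zero_mul] at h3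
  simp only [Complex.sub_re, Complex.add_re, Complex.one_re, Complex.sub_im, Complex.add_im,
    Complex.one_im, sub_zero, add_zero] at h3
  have h4 : ‖μ‖ ^ 2 = μ.re * μ.re + μ.im * μ.im := by
    rw [← Complex.normSq_eq_norm_sq, Complex.normSq_apply]
  nlinarith [norm_nonneg μ]

attribute [local instance] Matrix.linftyOpNormedAddCommGroup Matrix.linftyOpNormedSpace
  Matrix.linftyOpNormedRing Matrix.linftyOpNormedAlgebra

/-- Gelfand's formula for the complexified matrix bounds its powers by `r ^ k` with `r < 1`. The
`ℓ^∞` operator norm is used because complexification preserves it, and it dominates the Euclidean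
operator norm up to a constant. -/
theorem summable_norm_act_pow_sq {n : ℕ} {C : Matrix (Fin n) (Fin n) ℝ}
    (hC : ∀ μ ∈ spectrum ℂ (C.map (fun a : ℝ => (a : ℂ))), ‖μ‖ < 1) :
    Summable fun k : ℕ => ‖act (C ^ k)‖ ^ 2 := by
  set D : Matrix (Fin n) (Fin n) ℂ := C.map (fun a : ℝ => (a : ℂ)) with hD
  have hpow : ∀ k : ℕ, (C ^ k).map (fun a : ℝ => (a : ℂ)) = D ^ k := fun k =>
    map_pow (Complex.ofRealHom.mapMatrix) C k
  have hnorm : ∀ M : Matrix (Fin n) (Fin n) ℝ, ‖M.map (fun a : ℝ => (a : ℂ))‖ = ‖M‖ := by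
    intro M
    simp [Matrix.linfty_opNorm_def]
  obtain ⟨r, hr0, hr1, hr⟩ : ∃ r : ℝ, 0 ≤ r ∧ r < 1 ∧ ∀ᶠ k : ℕ in atTop, ‖D ^ k‖ ≤ r ^ k := by
    have hrad : spectralRadius ℂ D < 1 := by
      rcases (spectrum ℂ D).eq_empty_or_nonempty with h | h
      · simp [spectralRadius, h]
      · exact_mod_cast spectrum.spectralRadius_lt_of_forall_lt_of_nonempty h (r := 1)
          fun k hk => by exact_mod_cast hC k hk
    obtain ⟨r, hr1, hr2⟩ := exists_between hrad
    have hrtop : r ≠ ⊤ := (hr2.trans ENNReal.one_lt_top).ne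
    refine ⟨r.toReal, ENNReal.toReal_nonneg, ?_, ?_⟩
    · simpa using (ENNReal.toReal_lt_toReal hrtop ENNReal.one_ne_top).2 hr2
    · filter_upwards [(spectrum.pow_norm_pow_one_div_tendsto_nhds_spectralRadius D
        ).eventually_lt_const hr1, eventually_gt_atTop 0] with k hk hk0
      rw [← ENNReal.ofReal_toReal hrtop, ENNReal.ofReal_lt_ofReal_iff_of_nonneg (by positivity)]
        at hk
      have h1 := pow_le_pow_left₀ (by positivity) hk.le k
      rwa [one_div, Real.rpow_inv_natCast_pow (norm_nonneg _) hk0.ne'] at h1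
  obtain ⟨K, hK⟩ : ∃ K : ℝ, ∀ M : Matrix (Fin n) (Fin n) ℝ, ‖act M‖ ≤ K * ‖M‖ := by
    let e := EuclideanSpace.equiv (Fin n) ℝ
    refine ⟨‖e.symm.toContinuousLinearMap‖ * ‖e.toContinuousLinearMap‖, fun M => ?_⟩
    refine (act M).opNorm_le_bound (by positivity) fun x => ?_
    calc ‖act M x‖ = ‖e.symm.toContinuousLinearMap (M.mulVec (e x))‖ := rfl
      _ ≤ ‖e.symm.toContinuousLinearMap‖ * (‖M‖ * (‖e.toContinuousLinearMap‖ * ‖x‖)) := by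
          refine (e.symm.toContinuousLinearMap.le_opNorm _).trans ?_
          gcongr
          refine (Matrix.linfty_opNorm_mulVec M _).trans ?_
          gcongr
          exact e.toContinuousLinearMap.le_opNorm x
      _ = _ := by ring
  have hK' : ∀ M : Matrix (Fin n) (Fin n) ℝ, ‖act M‖ ≤ |K| * ‖M‖ := fun M =>
    (hK M).trans (by gcongr; exact le_abs_self K)
  have hsum : Summable fun k : ℕ => (|K| * r ^ k) ^ 2 := by
    have : Summable fun k : ℕ => |K| ^ 2 * (r ^ 2) ^ k :=
      (summable_geometric_of_lt_one (by positivity) (by nlinarith)).mul_left _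
    refine this.congr fun k => ?_
    rw [mul_pow, ← pow_mul, ← pow_mul, mul_comm 2 k]
  refine Summable.of_norm_bounded_eventually_nat hsum ?_
  filter_upwards [hr] with k hk
  rw [norm_pow, norm_norm]
  gcongr
  refine (hK' _).trans ?_
  gcongr
  rw [← hnorm, hpow]
  exact hk

/-- Solution of the Stein equation `P = 1 + cᵀ P c`. -/
theorem exists_stein {n : ℕ} {c : Vec n →L[ℝ] Vec n} (hc : Summable fun k : ℕ => ‖c ^ k‖ ^ 2) :
    ∃ P : Vec n →L[ℝ] Vec n, (∀ x y, inner ℝ (P x) y = inner ℝ (P y) x) ∧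
      (∀ x, 0 ≤ inner ℝ (P x) x) ∧
      ∀ x, inner ℝ (P x) x = ‖x‖ ^ 2 + inner ℝ (P (c x)) (c x) := by
  have hs : Summable fun k : ℕ => (c ^ k).adjoint ∘L (c ^ k) := by
    refine Summable.of_norm_bounded hc fun k => ?_
    refine (ContinuousLinearMap.opNorm_comp_le _ _).trans ?_
    rw [LinearIsometryEquiv.norm_map, sq]
  have hP : ∀ x y, HasSum (fun k : ℕ => inner ℝ ((c ^ k) x) ((c ^ k) y))
      (inner ℝ ((∑' k : ℕ, (c ^ k).adjoint ∘L (c ^ k)) x) y) := by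
    intro x y
    have h1 := hs.hasSum.mapL (((innerSL ℝ).flip y).comp
      (ContinuousLinearMap.apply ℝ (Vec n) x))
    refine (h1.congr_fun fun k => ?_)
    change _ = inner ℝ ((c ^ k).adjoint ((c ^ k) x)) y
    rw [ContinuousLinearMap.adjoint_inner_left]
  refine ⟨_, fun x y => (hP x y).unique (((hP y x)).congr_fun fun k => real_inner_comm _ _),
    fun x => (hP x x).nonneg fun k => real_inner_self_nonneg, fun x => ?_⟩
  -- Removing the term `k = 0` turns the series at `x` into the series at `c x`.
  have h1 := (hasSum_nat_add_iff' 1).2 (hP x x)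
  have h2 := hP (c x) (c x)
  have h3 := h1.unique (h2.congr_fun fun k => by simp [pow_succ])
  simp only [Finset.range_one, Finset.sum_singleton, pow_zero, one_apply_eq_self,
    real_inner_self_eq_norm_sq] at h3
  linarith

/-- A Hurwitz matrix admits a quadratic Lyapunov function. -/
theorem IsHurwitz.exists_lyapunov {n : ℕ} {A : Matrix (Fin n) (Fin n) ℝ} (hA : IsHurwitz A) :
    ∃ (P : Vec n →L[ℝ] Vec n) (m : ℝ), 0 < m ∧ (∀ x y, inner ℝ (P x) y = inner ℝ (P y) x) ∧
      (∀ x, m * ‖x‖ ^ 2 ≤ inner ℝ (P x) x) ∧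
      ∀ x, 2 * inner ℝ (P x) (act A x) ≤ -m * ‖x‖ ^ 2 := by
  set φ := (Complex.ofRealHom.mapMatrix : Matrix (Fin n) (Fin n) ℝ →+* _) with hφ
  have hu' : IsUnit (1 - φ A) := by
    by_contra h
    have h1 : (1 : ℂ) ∈ spectrum ℂ (φ A) := by
      rw [spectrum.mem_iff, map_one]; exact h
    have := hA 1 h1
    norm_num at this
  have hu : IsUnit (1 - A) := by
    rw [Matrix.isUnit_iff_isUnit_det, isUnit_iff_ne_zero] at hu' ⊢
    intro h0
    apply hu'
    rw [← map_one φ, ← map_sub, hφ, ← RingHom.map_det, h0, map_zero]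
  obtain ⟨N, hN⟩ := hu.exists_left_inv
  obtain ⟨N', hN'⟩ := hu.exists_right_inv
  have hNN : N = N' := left_inv_eq_right_inv hN hN'
  set C := (1 + A) * N with hC
  have hCA : C * (1 - A) = 1 + A := by rw [hC, mul_assoc, hN, mul_one]
  have hspec : ∀ μ ∈ spectrum ℂ (C.map (fun a : ℝ => (a : ℂ))), ‖μ‖ < 1 := fun μ hμ =>
    norm_lt_one_of_mem_spectrum_cayley (a := φ A) (c := φ C) hA hu'
      (by rw [← map_one φ, ← map_sub, ← map_mul, hCA, map_add]) hμ
  have hpow : ∀ k : ℕ, (act C) ^ k = act (C ^ k) := by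
    intro k
    induction k with
    | zero => ext1 x; simp [act_one]
    | succ k ih =>
      ext1 x
      rw [pow_succ, pow_succ, ih, act_mul]; rfl
  obtain ⟨P, hsymm, hpos, hP⟩ := exists_stein (c := act C)
    (by simpa only [hpow] using summable_norm_act_pow_sq hspec)
  -- Evaluate the Stein equation at `x = (1 - A)y`, where `C x = (1 + A)y`: the squares cancel and
  -- only the cross term remains. The Cayley transform thus replaces an integral of matrix
  -- exponentials by a power series.
  have hdiss : ∀ y, 4 * inner ℝ (P y) (act A y) = -‖act (1 - A) y‖ ^ 2 := by
    intro y
    have h1 := hP (act (1 - A) y)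
    have h2 : act C (act (1 - A) y) = y + act A y := by
      rw [← act_mul, hCA, act_add, add_apply, act_one]
    have h3 : act (1 - A) y = y - act A y := by
      rw [act_sub, sub_apply, act_one]
    rw [h2] at h1
    rw [h3] at h1 ⊢
    simp only [map_sub, map_add, inner_sub_left, inner_sub_right, inner_add_left,
      inner_add_right] at h1
    linarith [hsymm y (act A y)]
  have hlow : ∀ y, ‖y‖ ≤ ‖act N‖ * ‖act (1 - A) y‖ := fun y => by
    calc ‖y‖ = ‖act N (act (1 - A) y)‖ := by rw [← act_mul, hN, act_one]
      _ ≤ _ := (act N).le_opNorm _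
  have hK : (0 : ℝ) < 2 * (‖act N‖ ^ 2 + 1) := by positivity
  refine ⟨P, 1 / (2 * (‖act N‖ ^ 2 + 1)), by positivity, hsymm, fun x => ?_, fun x => ?_⟩
  · have h1 := hP x
    have h2 := hpos (act C x)
    have h3 : 1 / (2 * (‖act N‖ ^ 2 + 1)) ≤ 1 := by
      rw [div_le_one hK]; nlinarith [sq_nonneg ‖act N‖]
    nlinarith [sq_nonneg ‖x‖]
  · have h1 := hdiss x
    have h2 : ‖x‖ ^ 2 ≤ (‖act N‖ ^ 2 + 1) * ‖act (1 - A) x‖ ^ 2 := by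
      have := pow_le_pow_left₀ (norm_nonneg _) (hlow x) 2
      rw [mul_pow] at this
      nlinarith [sq_nonneg ‖act (1 - A) x‖]
    have h3 : 1 / (2 * (‖act N‖ ^ 2 + 1)) * ‖x‖ ^ 2 ≤ ‖act (1 - A) x‖ ^ 2 / 2 := by
      rw [one_div, inv_mul_le_iff₀ hK]
      linarith
    linarith

end Lyapunov

/-! ## Operators on `L²((0,1); ℝⁿ)` -/

section L2ops

variable {m n : ℕ}

instance : IsProbabilityMeasure (volume.restrict (Ioo (0 : ℝ) 1)) := ⟨by simp⟩

theorem coeFn_actL2 (M : Matrix (Fin m) (Fin n) ℝ) (ζ : L2 n) :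
    actL2 M ζ =ᵐ[volume.restrict (Ioo (0 : ℝ) 1)] fun ξ => act M (ζ ξ) :=
  (act M).coeFn_compLpL ζ

theorem norm_actL2_le (M : Matrix (Fin m) (Fin n) ℝ) : ‖actL2 M‖ ≤ ‖act M‖ :=
  (act M).norm_compLpL_le

theorem actL2_add (M N : Matrix (Fin m) (Fin n) ℝ) : actL2 (M + N) = actL2 M + actL2 N := by
  rw [actL2, act_add, ContinuousLinearMap.add_compLpL]; rfl

theorem actL2_sub (M N : Matrix (Fin m) (Fin n) ℝ) : actL2 (M - N) = actL2 M - actL2 N := by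
  rw [eq_sub_iff_add_eq, ← actL2_add, sub_add_cancel]

theorem continuous_actL2 : Continuous (actL2 : Matrix (Fin m) (Fin n) ℝ → _) := by
  let L : Matrix (Fin m) (Fin n) ℝ →ₗ[ℝ] (L2 n →L[ℝ] L2 m) :=
    { toFun := actL2
      map_add' := actL2_add
      map_smul' := fun c M => by
        rw [actL2, show act (c • M) = c • act M from (actLin m n).map_smul c M,
          ContinuousLinearMap.smul_compLpL]; rfl }
  exact L.continuous_of_finiteDimensional

theorem memLp_exp_smul (κ : ℝ) (ζ : L2 n) :
    MemLp (fun ξ => Real.exp (-κ * ξ) • ζ ξ) 2 (volume.restrict (Ioo (0 : ℝ) 1)) := by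
  refine MemLp.of_le_mul (c := Real.exp |κ|) (Lp.memLp ζ) ?_ ?_
  · exact (by fun_prop : Continuous fun ξ : ℝ => Real.exp (-κ * ξ)).aestronglyMeasurable.smul
      (Lp.aestronglyMeasurable ζ)
  · filter_upwards [ae_restrict_mem measurableSet_Ioo] with ξ hξ
    rw [norm_smul, Real.norm_eq_abs, Real.abs_exp]
    gcongr
    have h1 := neg_abs_le κ
    have h2 := abs_nonneg κ
    nlinarith [hξ.1, hξ.2]

/-- Multiplication by the weight `ξ ↦ e^{-κ ξ}` on `L²((0,1); ℝⁿ)`. -/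
def expWeight (n : ℕ) (κ : ℝ) : L2 n →L[ℝ] L2 n :=
  LinearMap.mkContinuous
    { toFun := fun ζ => (memLp_exp_smul κ ζ).toLp _
      map_add' := fun ζ η => by
        rw [← MemLp.toLp_add]
        refine MemLp.toLp_congr _ _ ?_
        filter_upwards [Lp.coeFn_add ζ η] with ξ h
        change Real.exp (-κ * ξ) • (ζ + η) ξ = Real.exp (-κ * ξ) • ζ ξ + Real.exp (-κ * ξ) • η ξ
        rw [h, Pi.add_apply, smul_add]
      map_smul' := fun c ζ => by
        rw [RingHom.id_apply, ← MemLp.toLp_const_smul]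
        refine MemLp.toLp_congr _ _ ?_
        filter_upwards [Lp.coeFn_smul c ζ] with ξ h
        simp [h, smul_comm c] }
    (Real.exp |κ|) (fun ζ => by
      refine Lp.norm_le_mul_norm_of_ae_le_mul ?_
      filter_upwards [(memLp_exp_smul κ ζ).coeFn_toLp, ae_restrict_mem measurableSet_Ioo]
        with ξ h hξ
      simp only [LinearMap.coe_mk, AddHom.coe_mk]
      rw [h, norm_smul, Real.norm_eq_abs, Real.abs_exp]
      gcongr
      have h1 := neg_abs_le κ
      have h2 := abs_nonneg κ
      nlinarith [hξ.1, hξ.2])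

theorem coeFn_expWeight (κ : ℝ) (ζ : L2 n) :
    expWeight n κ ζ =ᵐ[volume.restrict (Ioo (0 : ℝ) 1)] fun ξ => Real.exp (-κ * ξ) • ζ ξ :=
  (memLp_exp_smul κ ζ).coeFn_toLp

/-- The weight is at least `e^{-κ}` on the unit interval, so the weighted energy controls the `L²`
norm. -/
theorem norm_le_expWeight {κ : ℝ} (hκ : 0 ≤ κ) (ζ : L2 n) :
    ‖ζ‖ ≤ Real.exp κ * ‖expWeight n κ ζ‖ := by
  refine Lp.norm_le_mul_norm_of_ae_le_mul ?_
  filter_upwards [coeFn_expWeight κ ζ, ae_restrict_mem measurableSet_Ioo] with ξ h hξ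
  rw [h, norm_smul, Real.norm_eq_abs, Real.abs_exp, ← mul_assoc, ← Real.exp_add]
  refine le_mul_of_one_le_left (norm_nonneg _) (Real.one_le_exp ?_)
  nlinarith [hξ.2]

theorem expWeight_actL2 (κ : ℝ) (M : Matrix (Fin n) (Fin n) ℝ) (ζ : L2 n) :
    expWeight n κ (actL2 M ζ) = actL2 M (expWeight n κ ζ) := by
  apply Lp.ext
  filter_upwards [coeFn_expWeight κ (actL2 M ζ), coeFn_actL2 M ζ,
    coeFn_actL2 M (expWeight n κ ζ), coeFn_expWeight κ ζ] with ξ h1 h2 h3 h4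
  rw [h1, h2, h3, h4, map_smul]

theorem integral_norm_le_norm_L2 (ζ : L2 n) : ∫ ξ in Ioo (0 : ℝ) 1, ‖ζ ξ‖ ≤ ‖ζ‖ := by
  rw [integral_norm_eq_lintegral_enorm (Lp.aestronglyMeasurable ζ), Lp.norm_def,
    ← eLpNorm_one_eq_lintegral_enorm]
  exact ENNReal.toReal_mono (Lp.eLpNorm_ne_top ζ)
    (eLpNorm_le_eLpNorm_of_exponent_le (by norm_num) (Lp.aestronglyMeasurable ζ))

/-- Integration against a continuous matrix kernel is a bounded operator on `L²`. -/
theorem exists_kernelOp {K : ℝ → Matrix (Fin m) (Fin n) ℝ} (hK : ContinuousOn K (Icc 0 1)) :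
    ∃ 𝒦 : L2 n →L[ℝ] Vec m, ∀ ζ, 𝒦 ζ = ∫ ξ in Ioo (0 : ℝ) 1, act (K ξ) (ζ ξ) := by
  have hact : ContinuousOn (fun ξ => act (K ξ)) (Icc 0 1) := continuous_act.comp_continuousOn hK
  obtain ⟨k, hk⟩ := isCompact_Icc.exists_bound_of_continuousOn hact
  have hmeas : ∀ ζ : L2 n, AEStronglyMeasurable (fun ξ => act (K ξ) (ζ ξ))
      (volume.restrict (Ioo (0 : ℝ) 1)) := fun ζ =>
    (ContinuousLinearMap.id ℝ (Vec n →L[ℝ] Vec m)).aestronglyMeasurable_comp₂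
      ((hact.mono Ioo_subset_Icc_self).aestronglyMeasurable measurableSet_Ioo)
      (Lp.aestronglyMeasurable ζ)
  have hbd : ∀ ζ : L2 n, ∀ᵐ ξ ∂(volume.restrict (Ioo (0 : ℝ) 1)),
      ‖act (K ξ) (ζ ξ)‖ ≤ k * ‖ζ ξ‖ := fun ζ => by
    filter_upwards [ae_restrict_mem measurableSet_Ioo] with ξ hξ
    exact (act (K ξ)).le_of_opNorm_le (hk ξ (Ioo_subset_Icc_self hξ)) _
  have hi : ∀ ζ : L2 n, Integrable ζ (volume.restrict (Ioo (0 : ℝ) 1)) := fun ζ =>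
    (Lp.memLp ζ).integrable (by norm_num)
  have hint : ∀ ζ : L2 n, Integrable (fun ξ => act (K ξ) (ζ ξ))
      (volume.restrict (Ioo (0 : ℝ) 1)) := fun ζ =>
    ((hi ζ).norm.const_mul k).mono' (hmeas ζ) (hbd ζ)
  refine ⟨LinearMap.mkContinuous
    { toFun := fun ζ => ∫ ξ in Ioo (0 : ℝ) 1, act (K ξ) (ζ ξ)
      map_add' := fun ζ η => ?_
      map_smul' := fun c ζ => ?_ } |k| (fun ζ => ?_), fun ζ => rfl⟩
  · rw [← integral_add (hint ζ) (hint η)]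
    refine integral_congr_ae ?_
    filter_upwards [Lp.coeFn_add ζ η] with ξ h
    change act (K ξ) ((ζ + η) ξ) = act (K ξ) (ζ ξ) + act (K ξ) (η ξ)
    rw [h, Pi.add_apply, map_add]
  · rw [RingHom.id_apply, ← integral_smul]
    refine integral_congr_ae ?_
    filter_upwards [Lp.coeFn_smul c ζ] with ξ h
    simp [h]
  · calc ‖∫ ξ in Ioo (0 : ℝ) 1, act (K ξ) (ζ ξ)‖ ≤ ∫ ξ in Ioo (0 : ℝ) 1, k * ‖ζ ξ‖ :=
          norm_integral_le_of_norm_le ((hi ζ).norm.const_mul k) (hbd ζ)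
      _ = k * ∫ ξ in Ioo (0 : ℝ) 1, ‖ζ ξ‖ := integral_const_mul _ _
      _ ≤ |k| * ∫ ξ in Ioo (0 : ℝ) 1, ‖ζ ξ‖ := by
          gcongr; exact le_abs_self k
      _ ≤ |k| * ‖ζ‖ := by gcongr; exact integral_norm_le_norm_L2 ζ

end L2ops

/-! ## Dissipation of the transport operator -/

section Transport

/-- Integration by parts for `E f²`, where `E = e^{-2κξ}` satisfies `E' = -2κE` and `f(0) = 0`. As
`d` is merely integrable, `f` is only absolutely continuous. -/
theorem integral_exp_mul_primitive_mul {d : ℝ → ℝ} (hd : IntervalIntegrable d volume 0 1)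
    (κ : ℝ) :
    2 * ∫ ξ in (0 : ℝ)..1, Real.exp (-κ * ξ) ^ 2 * ((∫ s in (0 : ℝ)..ξ, d s) * d ξ) =
      Real.exp (-κ) ^ 2 * (∫ s in (0 : ℝ)..1, d s) ^ 2
        + 2 * κ * ∫ ξ in (0 : ℝ)..1, Real.exp (-κ * ξ) ^ 2 * (∫ s in (0 : ℝ)..ξ, d s) ^ 2 := by
  set f : ℝ → ℝ := fun ξ => ∫ s in (0 : ℝ)..ξ, d s with hf
  set E : ℝ → ℝ := fun ξ => Real.exp (-κ * ξ) ^ 2 with hE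
  have hfac : AbsolutelyContinuousOnInterval f 0 1 :=
    hd.absolutelyContinuousOnInterval_intervalIntegral (by simp)
  have hEac : AbsolutelyContinuousOnInterval E 0 1 :=
    ContDiffOn.absolutelyContinuousOnInterval (by
      have : ContDiff ℝ 1 E := by rw [hE]; fun_prop
      exact this.contDiffOn)
  have hEd : ∀ ξ, HasDerivAt E (-(2 * κ) * E ξ) ξ := fun ξ => by
    have h1 : HasDerivAt (fun t : ℝ => -κ * t) (-κ) ξ := by
      simpa using (hasDerivAt_id ξ).const_mul (-κ)
    refine (h1.exp.pow 2).congr_deriv ?_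
    simp only [hE]; push_cast; ring
  have hfd : ∀ᵐ ξ, ξ ∈ uIcc (0 : ℝ) 1 → HasDerivAt f (d ξ) ξ := by
    filter_upwards [hd.ae_hasDerivAt_integral] with ξ h hξ
    exact h hξ 0 (by simp)
  have hfc : ContinuousOn f (uIcc 0 1) := hfac.continuousOn
  have hEc : ContinuousOn E (uIcc 0 1) := hEac.continuousOn
  have key := (hEac.fun_mul hfac).integral_deriv_mul_eq_sub hfac
  have h0 : f 0 = 0 := by simp [hf]
  have hI1 : IntervalIntegrable (fun ξ => E ξ * (f ξ * d ξ)) volume 0 1 :=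
    (hd.continuousOn_mul hfc).continuousOn_mul hEc
  have hI2 : IntervalIntegrable (fun ξ => E ξ * f ξ ^ 2) volume 0 1 :=
    (hEc.mul (hfc.pow 2)).intervalIntegrable
  have hcongr : ∫ ξ in (0 : ℝ)..1, (deriv (fun x => E x * f x) ξ * f ξ + E ξ * f ξ * deriv f ξ)
      = ∫ ξ in (0 : ℝ)..1, (2 * (E ξ * (f ξ * d ξ)) - 2 * κ * (E ξ * f ξ ^ 2)) := by
    refine intervalIntegral.integral_congr_ae ?_
    filter_upwards [hfd] with ξ h hξ
    have h1 := h (uIoc_subset_uIcc hξ)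
    rw [((hEd ξ).fun_mul h1).deriv, h1.deriv]
    ring
  rw [hcongr, intervalIntegral.integral_sub (hI1.const_mul 2) (hI2.const_mul _),
    intervalIntegral.integral_const_mul, intervalIntegral.integral_const_mul, h0] at key
  have hE1 : E 1 = Real.exp (-κ) ^ 2 := by simp [hE]
  rw [hE1] at key
  linear_combination key

variable {n : ℕ}

theorem inner_expWeight (κ : ℝ) (ζ η : L2 n) :
    inner ℝ (expWeight n κ ζ) (expWeight n κ η) =
      ∫ ξ in Ioo (0 : ℝ) 1, ∑ i, Real.exp (-κ * ξ) ^ 2 * (ζ ξ i * η ξ i) := by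
  rw [MeasureTheory.L2.inner_def]
  refine integral_congr_ae ?_
  filter_upwards [coeFn_expWeight κ ζ, coeFn_expWeight κ η] with ξ h1 h2
  rw [h1, h2, PiLp.inner_apply]
  refine Finset.sum_congr rfl fun i _ => ?_
  simp; ring

/-- The slope of the weight produces dissipation at a rate proportional to the free parameter `κ`,
and outflow at `ξ = 1` leaves a negative boundary term. The inflow term vanishes because `w 0 = 0`.
-/
theorem transport_dissipation {lam : Vec n} {l κ : ℝ} (hκ : 0 ≤ κ) (hl : ∀ i, l ≤ lam i)
    {ζ dζ : L2 n} {w : ℝ → Vec n} (h : IsH1 ζ dζ w) (hw : w 0 = 0) :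
    2 * inner ℝ (expWeight n κ ζ) (expWeight n κ (-(actL2 (diag lam) dζ))) ≤
      -(2 * κ * l) * ‖expWeight n κ ζ‖ ^ 2 - Real.exp (-κ) ^ 2 * l * ‖w 1‖ ^ 2 := by
  have hdi : IntervalIntegrable dζ volume 0 1 := by
    rw [intervalIntegrable_iff_integrableOn_Ioo_of_le zero_le_one]
    exact (Lp.memLp dζ).integrable (by norm_num)
  have hdc : ∀ i, IntervalIntegrable (fun s => dζ s i) volume 0 1 := fun i =>
    ⟨(EuclideanSpace.proj (𝕜 := ℝ) i).integrable_comp hdi.1,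
      (EuclideanSpace.proj (𝕜 := ℝ) i).integrable_comp hdi.2⟩
  have hwi : ∀ i, ∀ ξ ∈ Icc (0 : ℝ) 1, w ξ i = ∫ s in (0 : ℝ)..ξ, dζ s i := by
    intro i ξ hξ
    have h1 := h.eq_integral ξ hξ
    rw [hw, zero_add] at h1
    rw [h1]
    have h2 : IntervalIntegrable dζ volume 0 ξ :=
      hdi.mono_set (uIcc_subset_uIcc_left (by rw [uIcc_of_le zero_le_one]; exact hξ))
    exact ((EuclideanSpace.proj (𝕜 := ℝ) i).intervalIntegral_comp_comm h2).symm
  have hae : ∀ᵐ ξ ∂(volume.restrict (Ioo (0 : ℝ) 1)), ∀ i,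
      ζ ξ i = ∫ s in (0 : ℝ)..ξ, dζ s i := by
    filter_upwards [h.ae_eq, ae_restrict_mem measurableSet_Ioo] with ξ h1 hξ i
    rw [h1, hwi i ξ (Ioo_subset_Icc_self hξ)]
  have hfc : ∀ i, ContinuousOn (fun ξ => ∫ s in (0 : ℝ)..ξ, dζ s i) (uIcc 0 1) := fun i =>
    ((hdc i).absolutelyContinuousOnInterval_intervalIntegral (c := 0) (by simp)).continuousOn
  have hEc : ContinuousOn (fun ξ : ℝ => Real.exp (-κ * ξ) ^ 2) (uIcc 0 1) := by fun_prop
  have hI1 : ∀ i, IntervalIntegrable (fun ξ => Real.exp (-κ * ξ) ^ 2 *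
      ((∫ s in (0 : ℝ)..ξ, dζ s i) * dζ ξ i)) volume 0 1 := fun i =>
    ((hdc i).continuousOn_mul (hfc i)).continuousOn_mul hEc
  have hI2 : ∀ i, IntervalIntegrable (fun ξ => Real.exp (-κ * ξ) ^ 2 *
      (∫ s in (0 : ℝ)..ξ, dζ s i) ^ 2) volume 0 1 := fun i =>
    (hEc.mul ((hfc i).pow 2)).intervalIntegrable
  have hnorm : ‖expWeight n κ ζ‖ ^ 2 = ∑ i, ∫ ξ in (0 : ℝ)..1, Real.exp (-κ * ξ) ^ 2 *
      (∫ s in (0 : ℝ)..ξ, dζ s i) ^ 2 := by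
    rw [← real_inner_self_eq_norm_sq, inner_expWeight, ← intervalIntegral.integral_finsetSum
      (fun i _ => hI2 i), intervalIntegral.integral_of_le zero_le_one,
      integral_Ioc_eq_integral_Ioo]
    refine integral_congr_ae ?_
    filter_upwards [hae] with ξ h1
    simp only [h1, sq]
  have hinner : inner ℝ (expWeight n κ ζ) (expWeight n κ (-(actL2 (diag lam) dζ))) =
      ∑ i, -(lam i) * ∫ ξ in (0 : ℝ)..1, Real.exp (-κ * ξ) ^ 2 *
        ((∫ s in (0 : ℝ)..ξ, dζ s i) * dζ ξ i) := by
    simp_rw [← intervalIntegral.integral_const_mul]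
    rw [inner_expWeight, ← intervalIntegral.integral_finsetSum
      (fun i _ => (hI1 i).const_mul _), intervalIntegral.integral_of_le zero_le_one,
      integral_Ioc_eq_integral_Ioo]
    refine integral_congr_ae ?_
    filter_upwards [hae, Lp.coeFn_neg (actL2 (diag lam) dζ), coeFn_actL2 (diag lam) dζ]
      with ξ h1 h2 h3
    refine Finset.sum_congr rfl fun i _ => ?_
    rw [h1, h2, Pi.neg_apply, h3, PiLp.neg_apply, act_apply]
    simp [diag, Matrix.diagonal_apply]
    ring
  rw [hnorm, hinner, EuclideanSpace.norm_sq_eq, Finset.mul_sum, Finset.mul_sum, Finset.mul_sum,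
    ← Finset.sum_sub_distrib]
  refine Finset.sum_le_sum fun i _ => ?_
  have hkey := integral_exp_mul_primitive_mul (hdc i) κ
  rw [← hwi i 1 ⟨zero_le_one, le_rfl⟩] at hkey
  have hnn : 0 ≤ ∫ ξ in (0 : ℝ)..1, Real.exp (-κ * ξ) ^ 2 * (∫ s in (0 : ℝ)..ξ, dζ s i) ^ 2 :=
    intervalIntegral.integral_nonneg zero_le_one fun ξ _ => by positivity
  rw [Real.norm_eq_abs, sq_abs]
  have hsq : 0 ≤ Real.exp (-κ) ^ 2 * w 1 i ^ 2 := by positivity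
  have hA := mul_nonneg (sub_nonneg.2 (hl i))
    (add_nonneg hsq (mul_nonneg (mul_nonneg two_pos.le hκ) hnn))
  linear_combination hA + (-lam i) * hkey

end Transport

/-! ## Quadratic forms on the state space -/

section Forms

variable {m n : ℕ}

@[simp] theorem State.mk_fst (Z : Vec m) (ζ : L2 n) : (State.mk Z ζ).fst = Z := rfl
@[simp] theorem State.mk_snd (Z : Vec m) (ζ : L2 n) : (State.mk Z ζ).snd = ζ := rfl

/-- The lumped component of the state. -/
def fstOp (m n : ℕ) : State m n →L[ℝ] Vec m := WithLp.fstL 2 ℝ (Vec m) (L2 n)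

/-- The distributed component of the state. -/
def sndOp (m n : ℕ) : State m n →L[ℝ] L2 n := WithLp.sndL 2 ℝ (Vec m) (L2 n)

/-- The form `(p, q) ↦ ∫ e^{-2 κ ξ} ζ_pᵀ ζ_q dξ`. -/
def weightForm (m n : ℕ) (κ : ℝ) : State m n →L[ℝ] State m n →L[ℝ] ℝ :=
  (innerSL ℝ : L2 n →L[ℝ] L2 n →L[ℝ] ℝ).bilinearComp (expWeight n κ ∘L sndOp m n)
    (expWeight n κ ∘L sndOp m n)

@[simp] theorem weightForm_apply (κ : ℝ) (p q : State m n) :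
    weightForm m n κ p q = inner ℝ (expWeight n κ p.snd) (expWeight n κ q.snd) := rfl

/-- The form `(p, q) ↦ Z_pᵀ P Z_q`. -/
def lumpedForm (n : ℕ) (P : Vec m →L[ℝ] Vec m) : State m n →L[ℝ] State m n →L[ℝ] ℝ :=
  (innerSL ℝ : Vec m →L[ℝ] Vec m →L[ℝ] ℝ).bilinearComp (P ∘L fstOp m n) (fstOp m n)

@[simp] theorem lumpedForm_apply (P : Vec m →L[ℝ] Vec m) (p q : State m n) :
    lumpedForm n P p q = inner ℝ (P p.fst) q.fst := rfl

end Forms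

/-! ### Lyapunov function of the linear cascade -/

namespace Plant

variable {nX nz nU : ℕ} (S : Plant nX nz nU)

theorem exists_lam_lower : ∃ l : ℝ, 0 < l ∧ ∀ i, l ≤ S.lam i := by
  rcases isEmpty_or_nonempty (Fin nz) with h | h
  · exact ⟨1, one_pos, fun i => h.elim i⟩
  · obtain ⟨i, hi⟩ := Finite.exists_min (fun i => S.lam i)
    exact ⟨S.lam i, S.lam_pos i, hi⟩

variable {S}

theorem linOp_transport {A : Matrix (Fin nX) (Fin nX) ℝ} {l κ : ℝ} (hκ : 0 ≤ κ) (hl0 : 0 ≤ l)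
    (hl : ∀ i, l ≤ S.lam i) {p q : State nX nz} (h : S.linOp A p q) :
    2 * weightForm nX nz κ p q ≤ -(2 * κ * l) * weightForm nX nz κ p p := by
  obtain ⟨dζ, w, hH, hw, rfl⟩ := h
  have h1 := transport_dissipation hκ hl hH hw
  rw [weightForm_apply, weightForm_apply, State.mk_snd, real_inner_self_eq_norm_sq]
  have : 0 ≤ Real.exp (-κ) ^ 2 * l * ‖w 1‖ ^ 2 := by positivity
  linarith

/-- A quadratic Lyapunov function for the ODE-PDE cascade with a Hurwitz matrix `A + B`. -/
theorem exists_lyapunov {A B : Matrix (Fin nX) (Fin nX) ℝ} (hAB : IsHurwitz (A + B)) :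
    ∃ (b : State nX nz →L[ℝ] State nX nz →L[ℝ] ℝ) (a m : ℝ), 0 < a ∧ 0 < m ∧
      (∀ p q, b p q = b q p) ∧ (∀ p, m * ‖p‖ ^ 2 ≤ b p p) ∧
      ∀ p q, S.linOp A p q →
        2 * b p q ≤ -a * b p p - 2 * b p (State.mk (act B p.fst) 0) := by
  obtain ⟨P, m, hm, hsymm, hlow, hdiss⟩ := hAB.exists_lyapunov
  obtain ⟨l, hl0, hl⟩ := S.exists_lam_lower
  obtain ⟨𝒦, h𝒦⟩ := exists_kernelOp S.K₁_cont
  set N := ‖P‖ * ‖act S.G₁‖ with hN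
  set k := ‖𝒦‖ with hk
  set g := ‖act S.K₂‖ with hg
  set E := Real.exp 1 ^ 2 with hE
  have hE1 : 1 ≤ E := one_le_pow₀ (Real.one_le_exp zero_le_one)
  have hEinv : Real.exp (-1) ^ 2 = E⁻¹ := by rw [Real.exp_neg, inv_pow]
  -- `D` is the price of the coupling `G₁𝒦₁` after Young's inequality has spent half of the lumped
  -- dissipation `m`. The choice of `c` gives `D E ≤ c l`, so the weighted part pays for both the
  -- interior and the trace contribution.
  set D := 4 * N ^ 2 / m * (k ^ 2 * E + g ^ 2) with hD
  have hD0 : 0 ≤ D := by positivity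
  set c := D * E / l + 1 with hc
  have hc0 : 0 < c := by positivity
  have hcl : D * E ≤ c * l := by
    rw [hc, add_mul, div_mul_cancel₀ _ hl0.ne']; linarith
  refine ⟨lumpedForm nz P + c • weightForm nX nz 1, min (m / (2 * (‖P‖ + 1))) l,
    min m (c * E⁻¹), by positivity, by positivity, ?_, ?_, ?_⟩
  · intro p q
    simp only [add_apply, smul_apply, lumpedForm_apply, weightForm_apply]
    rw [hsymm, real_inner_comm (expWeight nz 1 q.snd)]
  · intro p
    simp only [add_apply, smul_apply, lumpedForm_apply, weightForm_apply, smul_eq_mul,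
      real_inner_self_eq_norm_sq]
    rw [WithLp.prod_norm_sq_eq_of_L2, mul_add]
    refine add_le_add ((mul_le_mul_of_nonneg_right (min_le_left _ _) (sq_nonneg _)).trans
      (hlow _)) ((mul_le_mul_of_nonneg_right (min_le_right _ _) (sq_nonneg _)).trans ?_)
    rw [mul_assoc]
    gcongr
    have := pow_le_pow_left₀ (norm_nonneg _) (norm_le_expWeight zero_le_one p.snd) 2
    rw [mul_pow] at this
    rwa [inv_mul_le_iff₀ (by positivity)]
  · rintro p q ⟨dζ, w, hH, hw, rfl⟩
    -- The trace `w 1` is not controlled by `p.snd` in `L²`; it is kept separate for the boundary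
    -- dissipation.
    have hK1 : S.K1op w = 𝒦 p.snd + act S.K₂ (w 1) := by
      rw [K1op, h𝒦, intervalIntegral.integral_of_le zero_le_one, integral_Ioc_eq_integral_Ioo]
      congr 1
      refine integral_congr_ae ?_
      filter_upwards [hH.ae_eq] with ξ h
      rw [h]
    simp only [add_apply, smul_apply, lumpedForm_apply, weightForm_apply, smul_eq_mul,
      State.mk_fst, State.mk_snd, map_zero, inner_zero_right, mul_zero, add_zero]
    have h1 := transport_dissipation (κ := 1) zero_le_one hl hH hw
    have h2 := hdiss p.fst
    -- The Lyapunov inequality concerns `A + B`, the generator only `A`; the difference is the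
    -- bounded term left on the right of the claim.
    rw [act_add, add_apply, inner_add_right] at h2
    rw [inner_add_right, real_inner_self_eq_norm_sq]
    have h3 : inner ℝ (P p.fst) (act S.G₁ (S.K1op w)) ≤
        N * ‖p.fst‖ * (k * ‖p.snd‖ + g * ‖w 1‖) := by
      refine (real_inner_le_norm _ _).trans ?_
      have e1 : ‖S.K1op w‖ ≤ k * ‖p.snd‖ + g * ‖w 1‖ := by
        rw [hK1]
        exact (norm_add_le _ _).trans (add_le_add (𝒦.le_opNorm _) ((act S.K₂).le_opNorm _))
      calc ‖P p.fst‖ * ‖act S.G₁ (S.K1op w)‖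
          ≤ (‖P‖ * ‖p.fst‖) * (‖act S.G₁‖ * (k * ‖p.snd‖ + g * ‖w 1‖)) := by
            gcongr
            · exact P.le_opNorm _
            · exact ((act S.G₁).le_opNorm _).trans (by gcongr)
        _ = _ := by rw [hN]; ring
    have h4 : ‖p.snd‖ ^ 2 ≤ E * ‖expWeight nz 1 p.snd‖ ^ 2 := by
      have := pow_le_pow_left₀ (norm_nonneg _) (norm_le_expWeight zero_le_one p.snd) 2
      rwa [mul_pow] at this
    have h5 : inner ℝ (P p.fst) p.fst ≤ ‖P‖ * ‖p.fst‖ ^ 2 := by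
      refine (real_inner_le_norm _ _).trans ?_
      rw [sq, ← mul_assoc]
      gcongr
      exact P.le_opNorm _
    have hW0 : 0 ≤ ‖expWeight nz 1 p.snd‖ ^ 2 := sq_nonneg _
    have hP0 : 0 ≤ inner ℝ (P p.fst) p.fst := (by positivity : 0 ≤ m * ‖p.fst‖ ^ 2).trans (hlow _)
    rw [hEinv] at h1
    generalize ‖expWeight nz 1 p.snd‖ ^ 2 = W at *
    have hE0 : 0 < E := one_pos.trans_le hE1
    set s := k * ‖p.snd‖ + g * ‖w 1‖ with hs
    have h6 : 2 * (N * ‖p.fst‖ * s) ≤ m / 2 * ‖p.fst‖ ^ 2 + 2 * N ^ 2 / m * s ^ 2 := by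
      have e : m / 2 * ‖p.fst‖ ^ 2 + 2 * N ^ 2 / m * s ^ 2 - 2 * (N * ‖p.fst‖ * s) =
          m / 2 * (‖p.fst‖ - 2 * N * s / m) ^ 2 := by field_simp; ring
      have : 0 ≤ m / 2 * (‖p.fst‖ - 2 * N * s / m) ^ 2 := by positivity
      linarith
    have h7 : 2 * N ^ 2 / m * s ^ 2 ≤ D * W + D * ‖w 1‖ ^ 2 := by
      have e1 : s ^ 2 ≤ 2 * (k ^ 2 * (E * W) + g ^ 2 * ‖w 1‖ ^ 2) := by
        have := mul_le_mul_of_nonneg_left h4 (sq_nonneg k)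
        nlinarith [sq_nonneg (k * ‖p.snd‖ - g * ‖w 1‖)]
      have hq : 0 ≤ 2 * N ^ 2 / m := by positivity
      have e2 : D = 2 * N ^ 2 / m * (2 * (k ^ 2 * E + g ^ 2)) := by rw [hD]; ring
      have e3 := mul_le_mul_of_nonneg_left e1 hq
      have e4 : 0 ≤ 2 * N ^ 2 / m * (g ^ 2 * W + k ^ 2 * E * ‖w 1‖ ^ 2) := by positivity
      rw [e2]
      linarith
    have h8 : D * ‖w 1‖ ^ 2 ≤ c * (E⁻¹ * l * ‖w 1‖ ^ 2) := by
      have : D ≤ c * (E⁻¹ * l) := by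
        rw [show c * (E⁻¹ * l) = c * l * E⁻¹ by ring, ← div_eq_mul_inv, le_div_iff₀ hE0]
        exact hcl
      calc _ ≤ c * (E⁻¹ * l) * ‖w 1‖ ^ 2 := by gcongr
        _ = _ := by ring
    have h9 : D * W ≤ c * l * W :=
      mul_le_mul_of_nonneg_right ((le_mul_of_one_le_right hD0 hE1).trans hcl) hW0
    have h10 := mul_le_mul_of_nonneg_left h1 hc0.le
    have h11 : min (m / (2 * (‖P‖ + 1))) l * inner ℝ (P p.fst) p.fst ≤ m / 2 * ‖p.fst‖ ^ 2 := by
      calc _ ≤ m / (2 * (‖P‖ + 1)) * (‖P‖ * ‖p.fst‖ ^ 2) := by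
            gcongr
            exact min_le_left _ _
        _ ≤ m / (2 * (‖P‖ + 1)) * ((‖P‖ + 1) * ‖p.fst‖ ^ 2) := by gcongr; linarith
        _ = _ := by field_simp
    have h12 : min (m / (2 * (‖P‖ + 1))) l * (c * W) ≤ l * (c * W) := by
      gcongr
      exact min_le_right _ _
    linarith

end Plant

/-! ### Algebra of the state space and decay from an energy -/

section States

variable {m n : ℕ}

theorem State.mk_add (Z Z' : Vec m) (ζ ζ' : L2 n) :
    State.mk Z ζ + State.mk Z' ζ' = State.mk (Z + Z') (ζ + ζ') := rfl

theorem State.mk_sub (Z Z' : Vec m) (ζ ζ' : L2 n) :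
    State.mk Z ζ - State.mk Z' ζ' = State.mk (Z - Z') (ζ - ζ') := rfl

theorem State.continuous_mk : Continuous fun p : Vec m × L2 n => State.mk p.1 p.2 :=
  (WithLp.prodContinuousLinearEquiv 2 ℝ (Vec m) (L2 n)).symm.continuous

theorem State.norm_mk_le (Z : Vec m) (ζ : L2 n) : ‖State.mk Z ζ‖ ≤ ‖Z‖ + ‖ζ‖ := by
  refine abs_le_of_sq_le_sq' ?_ (by positivity) |>.2
  rw [WithLp.prod_norm_sq_eq_of_L2, State.mk_fst, State.mk_snd]
  nlinarith [norm_nonneg Z, norm_nonneg ζ]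

/-- The operator `(Z, ζ) ↦ (B Z, 0)`. -/
def lumpedOp (n : ℕ) (B : Matrix (Fin m) (Fin m) ℝ) : State m n →L[ℝ] State m n :=
  (WithLp.prodContinuousLinearEquiv 2 ℝ (Vec m) (L2 n)).symm.toContinuousLinearMap ∘L
    ContinuousLinearMap.inl ℝ (Vec m) (L2 n) ∘L act B ∘L fstOp m n

theorem lumpedOp_apply (B : Matrix (Fin m) (Fin m) ℝ) (p : State m n) :
    lumpedOp n B p = State.mk (act B p.fst) 0 := rfl

end States

theorem two_mul_le_add_sq_div {a x y : ℝ} (ha : 0 < a) :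
    2 * (x * y) ≤ a * x ^ 2 + y ^ 2 / a := by
  have : a * x ^ 2 + y ^ 2 / a - 2 * (x * y) = a * (x - y / a) ^ 2 := by field_simp; ring
  have h : 0 ≤ a * (x - y / a) ^ 2 := by positivity
  linarith

theorem exp_neg_mul_sq (μ t : ℝ) : Real.exp (-μ * t) ^ 2 = Real.exp (-(2 * μ) * t) := by
  rw [sq, ← Real.exp_add]; ring_nf

/-- A strict coercive Lyapunov function for a bounded perturbation `𝒜 + J` of the generator implies
that mild solutions inherit the decay of the forcing. -/
theorem IsGenerator.decay_of_energy {E : Type*} [NormedAddCommGroup E] [NormedSpace ℝ E]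
    [CompleteSpace E] {T : ℝ → E →L[ℝ] E} {𝒜 : E → E → Prop} (hT : IsC0Semigroup T)
    (h𝒜 : IsGenerator T 𝒜) {b : E →L[ℝ] E →L[ℝ] ℝ} {J : E →L[ℝ] E} {a m : ℝ} (ha : 0 < a)
    (hm : 0 < m) (hsymm : ∀ x y, b x y = b y x) (hlow : ∀ x, m * ‖x‖ ^ 2 ≤ b x x)
    (hdiss : ∀ x y, 𝒜 x y → 2 * b x y ≤ -a * b x x - 2 * b x (J x)) {e g h : ℝ → E}
    (hec : ContinuousOn e (Ici 0)) (hg : ContinuousOn g (Ici 0))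
    (he : ∀ t, 0 ≤ t → e t = T t (e 0) + ∫ s in (0 : ℝ)..t, T (t - s) (g s))
    (hge : ∀ t, 0 ≤ t → g t = h t + J (e t)) {H μ : ℝ} (hμ : 0 ≤ μ)
    (hhb : ∀ t, 0 ≤ t → ‖h t‖ ≤ H * Real.exp (-μ * t)) :
    ∃ M σ : ℝ, (0 < μ → 0 < σ) ∧ 0 ≤ σ ∧ ∀ t, 0 ≤ t → ‖e t‖ ≤ M * Real.exp (-σ * t) := by
  -- Young's inequality spends half of the rate `a` on the forcing, so `ν` must stay strictly below
  -- `a / 2`. For `μ = 0` this gives `ν = 0`, that is, boundedness.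
  set ν := min (2 * μ) (a / 4) with hν
  have hν0 : 0 ≤ ν := by positivity
  set c := (-a) • b - (2 : ℝ) • b.bilinearComp (ContinuousLinearMap.id ℝ E) J with hc
  have hcx : ∀ x, c x x = -a * b x x - 2 * b x (J x) := fun x => rfl
  have hV := le_exp_of_dini (f := fun t => b (e t) (e t))
    (f' := fun t => c (e t) (e t) + 2 * b (e t) (g t)) (a := a / 2)
    (C := (‖b‖ * H) ^ 2 / (a / 2 * m)) (μ := ν)
    ((b.continuous.comp_continuousOn hec).clm_apply hec)
    (by linarith [min_le_right (2 * μ) (a / 4)]) (by positivity)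
    (fun t ht r hr => h𝒜.energy_mild_dini hT hsymm
      (fun x y hxy => by rw [hcx]; exact hdiss x y hxy) hg he ht hr)
    (fun t ht => by
      rw [hcx, hge t ht, map_add]
      have h1 : b (e t) (h t) ≤ ‖e t‖ * (‖b‖ * H * Real.exp (-μ * t)) := by
        refine (le_abs_self _).trans ((b.le_opNorm₂ _ _).trans ?_)
        calc ‖b‖ * ‖e t‖ * ‖h t‖ ≤ ‖b‖ * ‖e t‖ * (H * Real.exp (-μ * t)) := by
              gcongr; exact hhb t ht
          _ = _ := by ring
      have h2 := two_mul_le_add_sq_div (a := a / 2 * m) (x := ‖e t‖)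
        (y := ‖b‖ * H * Real.exp (-μ * t)) (by positivity)
      have h3 : (‖b‖ * H * Real.exp (-μ * t)) ^ 2 / (a / 2 * m) ≤
          (‖b‖ * H) ^ 2 / (a / 2 * m) * Real.exp (-ν * t) := by
        rw [mul_pow, exp_neg_mul_sq, mul_div_right_comm]
        gcongr
        nlinarith [min_le_left (2 * μ) (a / 4)]
      have h4 := mul_le_mul_of_nonneg_left (hlow (e t)) (half_pos ha).le
      linarith)
  set K' := |b (e 0) (e 0)| + (‖b‖ * H) ^ 2 / (a / 2 * m) / (a / 2 - ν) + 1 with hK'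
  have hK'0 : 0 ≤ K' := by
    have : 0 < a / 2 - ν := by linarith [min_le_right (2 * μ) (a / 4)]
    positivity
  refine ⟨√(K' / m), ν / 2, fun h => ?_, by positivity, fun t ht => ?_⟩
  · rw [hν]; positivity
  · refine abs_le_of_sq_le_sq' ?_ (by positivity) |>.2
    have h1 := (hlow (e t)).trans (hV t ht)
    have h2 : Real.exp (-(ν / 2) * t) ^ 2 = Real.exp (-ν * t) := by
      rw [exp_neg_mul_sq]; ring_nf
    rw [mul_pow, Real.sq_sqrt (by positivity), h2, div_mul_eq_mul_div, le_div_iff₀ hm, mul_comm]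
    exact h1

/-! ### Uniqueness of the semigroup and decay for the cascade -/

namespace Plant

variable {nX nz nU : ℕ} {S : Plant nX nz nU} {T : ℝ → State nX nz →L[ℝ] State nX nz}
  {A : Matrix (Fin nX) (Fin nX) ℝ}

/-- The semigroup generated by `linOp` is unique. -/
theorem semigroup_unique {T' : ℝ → State nX nz →L[ℝ] State nX nz} (hT : IsC0Semigroup T)
    (h𝒜 : IsGenerator T (S.linOp A)) (hT' : IsC0Semigroup T')
    (h𝒜' : IsGenerator T' (S.linOp A)) {t : ℝ} (ht : 0 ≤ t) : T t = T' t := by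
  -- Any `A` becomes Hurwitz after this lumped correction. Moving the correction back as a bounded
  -- operator makes `linOp` quasi-dissipative without assumptions on `A`.
  have hH : IsHurwitz (A + (-A - 1)) := by
    rw [show A + (-A - 1) = -1 by abel]
    intro μ hμ
    rw [spectrum.mem_iff, show (-1 : Matrix (Fin nX) (Fin nX) ℝ).map (fun a : ℝ => (a : ℂ)) =
      algebraMap ℂ _ (-1) by
        rw [map_neg, map_one]
        exact (Complex.ofRealHom.mapMatrix (m := Fin nX)).map_neg 1 |>.trans (by rw [map_one]),
      ← map_sub] at hμ
    by_contra h
    refine hμ ((IsUnit.mk0 _ fun h0 => h ?_).map (algebraMap ℂ _))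
    have : μ = -1 := by linear_combination h0
    rw [this]; norm_num
  obtain ⟨b, a, m, ha, hm, hsymm, hlow, hdiss⟩ := S.exists_lyapunov hH
  set J := lumpedOp nz (-A - 1) with hJ
  refine h𝒜.unique hT hT' h𝒜' (b := b) (K := 2 * (‖b‖ * ‖J‖ / m)) hsymm (fun x hx => ?_)
    (fun x y hxy => ?_) ht
  · have h1 := (hlow x).trans hx
    have h2 : ‖x‖ ^ 2 ≤ 0 := by
      by_contra! h
      have := mul_pos hm h
      linarith
    exact norm_eq_zero.1 (pow_eq_zero_iff two_ne_zero |>.1 (le_antisymm h2 (sq_nonneg _)))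
  · have h1 := hdiss x y hxy
    rw [← lumpedOp_apply, ← hJ] at h1
    have h2 : -b x (J x) ≤ ‖b‖ * ‖J‖ * ‖x‖ ^ 2 := by
      refine (neg_le_abs _).trans ((b.le_opNorm₂ x (J x)).trans ?_)
      calc ‖b‖ * ‖x‖ * ‖J x‖ ≤ ‖b‖ * ‖x‖ * (‖J‖ * ‖x‖) := by gcongr; exact J.le_opNorm x
        _ = _ := by ring
    have h3 : 0 ≤ b x x := (by positivity : 0 ≤ m * ‖x‖ ^ 2).trans (hlow x)
    have h4 : ‖b‖ * ‖J‖ * ‖x‖ ^ 2 ≤ ‖b‖ * ‖J‖ / m * b x x := by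
      calc ‖b‖ * ‖J‖ * ‖x‖ ^ 2 = ‖b‖ * ‖J‖ / m * (m * ‖x‖ ^ 2) := by field_simp
        _ ≤ _ := by gcongr; exact hlow x
    nlinarith

/-- Decay of the distributed component of mild solutions with bounded transport coefficients,
driven by an exponentially bounded forcing. -/
theorem transport_decay (hT : IsC0Semigroup T)
    (h𝒜 : IsGenerator T (S.linOp A)) {e g : ℝ → State nX nz}
    (hec : ContinuousOn e (Ici 0)) (hg : ContinuousOn g (Ici 0))
    (he : ∀ t, 0 ≤ t → e t = T t (e 0) + ∫ s in (0 : ℝ)..t, T (t - s) (g s))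
    {F : ℝ → Matrix (Fin nz) (Fin nz) ℝ} {f₂ : ℝ → L2 nz}
    (hge : ∀ t, 0 ≤ t → (g t).snd = actL2 (F t) (e t).snd + f₂ t)
    {C D μ : ℝ} (hμ : 0 ≤ μ) (hF : ∀ t, 0 ≤ t → ‖act (F t)‖ ≤ C)
    (hf₂ : ∀ t, 0 ≤ t → ‖f₂ t‖ ≤ D * Real.exp (-μ * t)) :
    ∃ K : ℝ, 0 ≤ K ∧ ∀ t, 0 ≤ t → ‖(e t).snd‖ ≤ K * Real.exp (-μ * t) := by
  obtain ⟨l, hl0, hl⟩ := S.exists_lam_lower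
  have hC0 : 0 ≤ C := (norm_nonneg _).trans (hF 0 le_rfl)
  -- The dissipation `2κl = 2C + 2 + 2μ` pays `2C` for the coefficient `F` and `1` for the forcing,
  -- leaving `2μ + 1 > 2μ`.
  set κ := (2 * C + 2 + 2 * μ) / (2 * l) with hκ
  have hκ0 : 0 ≤ κ := by positivity
  have hκl : 2 * κ * l = 2 * C + 2 + 2 * μ := by rw [hκ]; field_simp
  clear_value κ
  set M := ‖expWeight nz κ‖ with hM
  have hwf := le_exp_of_dini (f := fun t => weightForm nX nz κ (e t) (e t))
    (f' := fun t => (-(2 * κ * l) • weightForm nX nz κ) (e t) (e t) +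
      2 * weightForm nX nz κ (e t) (g t)) (a := 2 * μ + 1)
    (C := M ^ 2 * D ^ 2) (μ := 2 * μ)
    (((weightForm nX nz κ).continuous.comp_continuousOn hec).clm_apply hec) (by linarith)
    (by positivity)
    (fun t ht r hr => h𝒜.energy_mild_dini hT (fun x y => by simp [real_inner_comm])
      (fun x y hxy => linOp_transport hκ0 hl0.le hl hxy) hg he ht hr)
    (fun t ht => by
      -- `F t` does not depend on `ξ` and commutes with the weight, so its bound `C` is not inflated
      -- by `κ`.
      have e1 : weightForm nX nz κ (e t) (g t) = inner ℝ (expWeight nz κ (e t).snd)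
          (actL2 (F t) (expWeight nz κ (e t).snd)) +
          inner ℝ (expWeight nz κ (e t).snd) (expWeight nz κ (f₂ t)) := by
        rw [weightForm_apply, hge t ht, map_add, expWeight_actL2, inner_add_right]
      have e2 : weightForm nX nz κ (e t) (e t) = ‖expWeight nz κ (e t).snd‖ ^ 2 := by
        rw [weightForm_apply, real_inner_self_eq_norm_sq]
      rw [e1, smul_apply, smul_apply, e2, smul_eq_mul, hκl, ← exp_neg_mul_sq]
      have h1 : inner ℝ (expWeight nz κ (e t).snd) (actL2 (F t) (expWeight nz κ (e t).snd)) ≤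
          C * ‖expWeight nz κ (e t).snd‖ ^ 2 := by
        refine (real_inner_le_norm _ _).trans ?_
        have := (actL2 (F t)).le_of_opNorm_le ((norm_actL2_le _).trans (hF t ht))
          (expWeight nz κ (e t).snd)
        calc _ ≤ ‖expWeight nz κ (e t).snd‖ * (C * ‖expWeight nz κ (e t).snd‖) := by gcongr
          _ = _ := by ring
      have h2 : 2 * inner ℝ (expWeight nz κ (e t).snd) (expWeight nz κ (f₂ t)) ≤
          ‖expWeight nz κ (e t).snd‖ ^ 2 + M ^ 2 * D ^ 2 * Real.exp (-μ * t) ^ 2 := by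
        have h3 : ‖expWeight nz κ (f₂ t)‖ ≤ M * (D * Real.exp (-μ * t)) :=
          ((expWeight nz κ).le_opNorm _).trans (by gcongr; exact hf₂ t ht)
        have h4 := real_inner_le_norm (expWeight nz κ (e t).snd) (expWeight nz κ (f₂ t))
        have h5 := pow_le_pow_left₀ (norm_nonneg _) h3 2
        nlinarith [sq_nonneg (‖expWeight nz κ (e t).snd‖ - ‖expWeight nz κ (f₂ t)‖)]
      linarith)
  set K := |weightForm nX nz κ (e 0) (e 0)| + M ^ 2 * D ^ 2 / (2 * μ + 1 - 2 * μ) + 1 with hKdef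
  have hK0 : 0 ≤ K := by
    have : 2 * μ + 1 - 2 * μ = 1 := by ring
    rw [hKdef, this]; positivity
  refine ⟨Real.exp κ * √K, by positivity, fun t ht => ?_⟩
  have h1 := hwf t ht
  simp only [weightForm_apply (p := e t), real_inner_self_eq_norm_sq] at h1
  rw [← exp_neg_mul_sq] at h1
  have h2 : ‖expWeight nz κ (e t).snd‖ ≤ √K * Real.exp (-μ * t) := by
    refine abs_le_of_sq_le_sq' ?_ (by positivity) |>.2
    rwa [mul_pow, Real.sq_sqrt hK0]
  calc _ ≤ Real.exp κ * ‖expWeight nz κ (e t).snd‖ := norm_le_expWeight hκ0 _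
    _ ≤ Real.exp κ * (√K * Real.exp (-μ * t)) := by gcongr
    _ = _ := by ring

/-- Decay of mild solutions of the ODE-PDE cascade with bounded transport coefficients, driven by
exponentially bounded forcing terms. -/
theorem cascade_decay {B : Matrix (Fin nX) (Fin nX) ℝ} (hT : IsC0Semigroup T)
    (h𝒜 : IsGenerator T (S.linOp A)) (hAB : IsHurwitz (A + B)) {e g : ℝ → State nX nz}
    (hec : ContinuousOn e (Ici 0)) (hg : ContinuousOn g (Ici 0))
    (he : ∀ t, 0 ≤ t → e t = T t (e 0) + ∫ s in (0 : ℝ)..t, T (t - s) (g s))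
    {F : ℝ → Matrix (Fin nz) (Fin nz) ℝ} {f₁ : ℝ → Vec nX} {f₂ : ℝ → L2 nz}
    (hge : ∀ t, 0 ≤ t → g t = State.mk (act (S.G₁ * F t) (S.K2op (e t).snd) + f₁ t)
      (actL2 (F t) (e t).snd + f₂ t) + State.mk (act B (e t).fst) 0)
    {C D μ : ℝ} (hμ : 0 ≤ μ) (hF : ∀ t, 0 ≤ t → ‖act (F t)‖ ≤ C)
    (hf₁ : ∀ t, 0 ≤ t → ‖f₁ t‖ ≤ D * Real.exp (-μ * t))
    (hf₂ : ∀ t, 0 ≤ t → ‖f₂ t‖ ≤ D * Real.exp (-μ * t)) :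
    ∃ M σ : ℝ, (0 < μ → 0 < σ) ∧ 0 ≤ σ ∧ ∀ t, 0 ≤ t → ‖e t‖ ≤ M * Real.exp (-σ * t) := by
  have hC0 : 0 ≤ C := (norm_nonneg _).trans (hF 0 le_rfl)
  have hD0 : 0 ≤ D := by simpa using (norm_nonneg _).trans (hf₁ 0 le_rfl)
  -- The distributed component evolves independently of the lumped one. Once its decay is known, the
  -- terms with `F` are forcing, and only `B` remains as feedback.
  obtain ⟨K, hK0, hK⟩ := transport_decay hT h𝒜 hec hg he (F := F) (f₂ := f₂)
    (fun t ht => by rw [hge t ht, State.mk_add, State.mk_snd, add_zero]) hμ hF hf₂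
  obtain ⟨b, a, m, ha, hm, hsymm, hlow, hdiss⟩ := S.exists_lyapunov hAB
  obtain ⟨𝒦, h𝒦⟩ := exists_kernelOp S.K₃_cont
  have h𝒦' : ∀ ζ, S.K2op ζ = 𝒦 ζ := fun ζ => (h𝒦 ζ).symm
  refine h𝒜.decay_of_energy hT (J := lumpedOp nz B) ha hm hsymm hlow hdiss hec hg he hge hμ
    (H := ‖act S.G₁‖ * (C * (‖𝒦‖ * K)) + D + (C * K + D)) fun t ht => ?_
  refine (State.norm_mk_le _ _).trans ?_
  rw [add_mul, add_mul, add_mul]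
  have hz := hK t ht
  refine add_le_add ((norm_add_le _ _).trans (add_le_add ?_ (hf₁ t ht)))
    ((norm_add_le _ _).trans (add_le_add ?_ (hf₂ t ht)))
  · rw [act_mul, h𝒦']
    calc _ ≤ ‖act S.G₁‖ * (C * (‖𝒦‖ * (K * Real.exp (-μ * t)))) := by
          refine ((act S.G₁).le_opNorm _).trans ?_
          gcongr
          refine ((act (F t)).le_of_opNorm_le (hF t ht) _).trans ?_
          gcongr
          exact (𝒦.le_opNorm _).trans (by gcongr)
      _ = _ := by ring
  · calc _ ≤ C * (K * Real.exp (-μ * t)) :=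
          ((actL2 (F t)).le_of_opNorm_le ((norm_actL2_le _).trans (hF t ht)) _).trans
            (by gcongr)
      _ = _ := by ring

end Plant

/-! ## Scalar and vector differential inequalities -/

/-- The equation is given only for `t > 0`; continuity of the right-hand side supplies the right
derivative at `0`, as the limit of the derivatives. -/
theorem SolvesODE.hasDerivWithinAt {E : Type*} [NormedAddCommGroup E] [NormedSpace ℝ E]
    {f rhs : ℝ → E} (h : SolvesODE f rhs) (hrhs : ContinuousOn rhs (Ici 0)) {t : ℝ}
    (ht : 0 ≤ t) : HasDerivWithinAt f (rhs t) (Ici t) t := by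
  rcases ht.eq_or_lt with rfl | ht
  · refine hasDerivWithinAt_Ici_of_tendsto_deriv (s := Ioi 0)
      (fun s hs => (h.2 s hs).differentiableAt.differentiableWithinAt)
      ((h.1 0 self_mem_Ici).mono Ioi_subset_Ici_self) self_mem_nhdsWithin ?_
    refine (((hrhs 0 self_mem_Ici).mono Ioi_subset_Ici_self).tendsto).congr' ?_
    filter_upwards [self_mem_nhdsWithin] with s hs
    exact (h.2 s hs).deriv.symm
  · exact (h.2 t ht).hasDerivWithinAt

theorem frequently_slope_lt_of_hasDerivWithinAt {f : ℝ → ℝ} {f' t r : ℝ}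
    (h : HasDerivWithinAt f f' (Ici t) t) (hr : f' < r) :
    ∃ᶠ z in 𝓝[>] t, slope f t z < r := by
  rw [hasDerivWithinAt_iff_tendsto_slope, Ici_sdiff_left] at h
  exact (h.eventually_lt_const hr).frequently

theorem hasDerivWithinAt_vec {n : ℕ} {f : ℝ → Vec n} {f' : Vec n} {s : Set ℝ} {t : ℝ}
    (h : ∀ i, HasDerivWithinAt (fun t => f t i) (f' i) s t) : HasDerivWithinAt f f' s t :=
  (EuclideanSpace.equiv (Fin n) ℝ).symm.toContinuousLinearMap.hasFDerivAt.comp_hasDerivWithinAt t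
    (hasDerivWithinAt_pi.2 h)

theorem hasDerivWithinAt_vec_apply {n : ℕ} {f : ℝ → Vec n} {f' : Vec n} {s : Set ℝ} {t : ℝ}
    (h : HasDerivWithinAt f f' s t) (i : Fin n) : HasDerivWithinAt (fun t => f t i) (f' i) s t :=
  (EuclideanSpace.proj (𝕜 := ℝ) i).hasFDerivAt.comp_hasDerivWithinAt t h

/-- Exponential decay for a linear equation with exponentially decaying forcing. -/
theorem exists_norm_le_exp_of_ode {F : Type*} [NormedAddCommGroup F] [InnerProductSpace ℝ F]
    {r s : ℝ → F} {a ν C : ℝ} (hν : ν < a) (hrc : ContinuousOn r (Ici 0))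
    (hr : ∀ t, 0 ≤ t → HasDerivWithinAt r (-(a • r t) + s t) (Ici t) t)
    (hs : ∀ t, 0 ≤ t → ‖s t‖ ≤ C * Real.exp (-ν * t)) :
    ∃ K : ℝ, 0 ≤ K ∧ ∀ t, 0 ≤ t → ‖r t‖ ≤ K * Real.exp (-ν * t) := by
  have hδ : 0 < a - ν := sub_pos.2 hν
  -- Young's inequality with weight `a - ν` lowers the rate of `‖r‖²` from `2a` to `a + ν`, still
  -- above `2ν`.
  have h := le_exp_of_dini (f := fun t => ‖r t‖ ^ 2)
    (f' := fun t => 2 * inner ℝ (r t) (-(a • r t) + s t)) (a := a + ν) (μ := 2 * ν)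
    (C := C ^ 2 / (a - ν)) (hrc.norm.pow 2) (by linarith) (by positivity)
    (fun t ht q hq => frequently_slope_lt_of_hasDerivWithinAt (hr t ht).norm_sq hq)
    (fun t ht => by
      rw [inner_add_right, inner_neg_right, real_inner_smul_right, real_inner_self_eq_norm_sq,
        ← exp_neg_mul_sq]
      have h1 := real_inner_le_norm (r t) (s t)
      have h2 := two_mul_le_add_sq_div (x := ‖r t‖) (y := ‖s t‖) hδ
      have h3 : ‖s t‖ ^ 2 / (a - ν) ≤ C ^ 2 / (a - ν) * Real.exp (-ν * t) ^ 2 := by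
        rw [div_mul_eq_mul_div, ← mul_pow]
        gcongr
        exact hs t ht
      linarith)
  set K := |‖r 0‖ ^ 2| + C ^ 2 / (a - ν) / (a + ν - 2 * ν) + 1 with hK
  have hK0 : 0 ≤ K := by
    have : 0 < a + ν - 2 * ν := by linarith
    positivity
  refine ⟨√K, Real.sqrt_nonneg _, fun t ht => ?_⟩
  refine abs_le_of_sq_le_sq' ?_ (by positivity) |>.2
  rw [mul_pow, Real.sq_sqrt hK0, exp_neg_mul_sq]
  exact h t ht

/-- Boundedness from a differential inequality with an integrable coefficient. -/
theorem exists_le_of_dini_integrable {f f' : ℝ → ℝ} {c ν : ℝ} (hν : 0 < ν) (hc : 0 ≤ c)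
    (hf : ContinuousOn f (Ici 0)) (hf0 : ∀ t, 0 ≤ t → 0 ≤ f t)
    (hf' : ∀ t, 0 ≤ t → ∀ r, f' t < r → ∃ᶠ z in 𝓝[>] t, slope f t z < r)
    (hbound : ∀ t, 0 ≤ t → f' t ≤ c * Real.exp (-ν * t) * (f t + 1)) :
    ∃ K : ℝ, ∀ t, 0 ≤ t → f t ≤ K := by
  -- `p` is a bounded primitive of `(c + 1)e^{-νt}`. Using `c + 1` instead of `c` makes the barrier
  -- `(f 0 + 1)e^p - 1` strict.
  set p : ℝ → ℝ := fun t => (c + 1) / ν * (1 - Real.exp (-ν * t)) with hp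
  have hpd : ∀ t, HasDerivAt p ((c + 1) * Real.exp (-ν * t)) t := fun t => by
    have h1 : HasDerivAt (fun t : ℝ => -ν * t) (-ν) t := by
      simpa using (hasDerivAt_id t).const_mul (-ν)
    refine ((h1.exp.const_sub 1).const_mul ((c + 1) / ν)).congr_deriv ?_
    field_simp
  have hBd : ∀ t, HasDerivAt (fun t => (f 0 + 1) * Real.exp (p t) - 1)
      ((f 0 + 1) * (Real.exp (p t) * ((c + 1) * Real.exp (-ν * t)))) t := fun t =>
    ((hpd t).exp.const_mul _).sub_const 1
  refine ⟨(f 0 + 1) * Real.exp ((c + 1) / ν) - 1, fun t ht => ?_⟩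
  have h0 := hf0 0 le_rfl
  have key := image_le_of_liminf_slope_right_lt_deriv_boundary' (f := f) (f' := f') (a := 0)
    (b := t) (hf.mono Icc_subset_Ici_self) (fun x hx r hr => hf' x hx.1 r hr)
    (B := fun t => (f 0 + 1) * Real.exp (p t) - 1) (by simp [hp])
    (fun x _ => (hBd x).continuousAt.continuousWithinAt)
    (fun x _ => (hBd x).hasDerivWithinAt) (fun x hx hfx => by
      refine (hbound x hx.1).trans_lt ?_
      have h1 : f x + 1 = (f 0 + 1) * Real.exp (p x) := by rw [hfx]; ring
      rw [h1]
      have : 0 < (f 0 + 1) * Real.exp (p x) * Real.exp (-ν * x) := by positivity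
      linarith) (x := t) ⟨ht, le_rfl⟩
  refine key.trans ?_
  have h2 : p t ≤ (c + 1) / ν := by
    have : 0 ≤ (c + 1) / ν := by positivity
    have h3 := Real.exp_pos (-ν * t)
    simp only [hp]
    nlinarith
  gcongr

/-- Minimise over the compact unit sphere and scale. The sphere is empty only in dimension zero. -/
theorem exists_coercive_of_pos {n : ℕ} {P : Vec n →L[ℝ] Vec n}
    (hP : ∀ x, x ≠ 0 → 0 < inner ℝ (P x) x) :
    ∃ m : ℝ, 0 < m ∧ ∀ x, m * ‖x‖ ^ 2 ≤ inner ℝ (P x) x := by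
  rcases (Metric.sphere (0 : Vec n) 1).eq_empty_or_nonempty with h | h
  · refine ⟨1, one_pos, fun x => ?_⟩
    have hx : x = 0 := by
      by_contra hx
      have : ‖x‖⁻¹ • x ∈ Metric.sphere (0 : Vec n) 1 := by
        rw [mem_sphere_zero_iff_norm, norm_smul, norm_inv, norm_norm,
          inv_mul_cancel₀ (norm_ne_zero_iff.2 hx)]
      rw [h] at this
      exact this
    simp [hx]
  · obtain ⟨y, hy, hmin⟩ := (isCompact_sphere (0 : Vec n) 1).exists_isMinOn h
      (f := fun x => inner ℝ (P x) x) (by fun_prop)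
    refine ⟨inner ℝ (P y) y, hP y ?_, fun x => ?_⟩
    · rintro rfl
      simp at hy
    · rcases eq_or_ne x 0 with rfl | hx
      · simp
      have hxn : ‖x‖ ≠ 0 := norm_ne_zero_iff.2 hx
      have h1 : ‖x‖⁻¹ • x ∈ Metric.sphere (0 : Vec n) 1 := by
        rw [mem_sphere_zero_iff_norm, norm_smul, norm_inv, norm_norm, inv_mul_cancel₀ hxn]
      have h2 : inner ℝ (P y) y ≤ inner ℝ (P (‖x‖⁻¹ • x)) (‖x‖⁻¹ • x) := hmin h1
      rw [map_smul, real_inner_smul_left, real_inner_smul_right] at h2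
      calc _ ≤ ‖x‖⁻¹ * (‖x‖⁻¹ * inner ℝ (P x) x) * ‖x‖ ^ 2 := by gcongr
        _ = _ := by field_simp

/-! ## The gradient law with integral cost -/

section Gradient

variable {n : ℕ} {φ : ℝ → Vec n} {R : ℝ → Matrix (Fin n) (Fin n) ℝ} {ψ : ℝ}

/-- The integrating factor `e^{ψt}` removes the forgetting term and leaves a nonnegative derivative.
Symmetry of `R` is not needed. -/
theorem hasDerivWithinAt_quadratic {t : ℝ}
    (hR : ∀ i j, HasDerivWithinAt (fun t => R t i j)
      (-ψ * R t i j + φ t i * φ t j / (1 + ‖φ t‖ ^ 2)) (Ici t) t) (x : Vec n) :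
    HasDerivWithinAt (fun t => Real.exp (ψ * t) * inner ℝ x (act (R t) x))
      (Real.exp (ψ * t) * ((inner ℝ (φ t) x) ^ 2 / (1 + ‖φ t‖ ^ 2))) (Ici t) t := by
  have h1 : ∀ t, inner ℝ x (act (R t) x) = ∑ i, ∑ j, R t i j * (x i * x j) := fun t => by
    simp only [PiLp.inner_apply, act_apply, RCLike.inner_apply, conj_trivial, Finset.sum_mul]
    refine Finset.sum_congr rfl fun i _ => Finset.sum_congr rfl fun j _ => by ring
  simp only [h1]
  have h2 : HasDerivWithinAt (fun t => ∑ i, ∑ j, R t i j * (x i * x j))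
      (∑ i, ∑ j, (-ψ * R t i j + φ t i * φ t j / (1 + ‖φ t‖ ^ 2)) * (x i * x j)) (Ici t) t :=
    HasDerivWithinAt.fun_sum fun i _ => HasDerivWithinAt.fun_sum fun j _ => (hR i j).mul_const _
  have h3 : HasDerivAt (fun t : ℝ => ψ * t) ψ t := by
    simpa using (hasDerivAt_id t).const_mul ψ
  refine (h3.exp.hasDerivWithinAt.mul h2).congr_deriv ?_
  have h4 : ∑ i, ∑ j, (-ψ * R t i j + φ t i * φ t j / (1 + ‖φ t‖ ^ 2)) * (x i * x j) =
      -ψ * (∑ i, ∑ j, R t i j * (x i * x j)) + (inner ℝ (φ t) x) ^ 2 / (1 + ‖φ t‖ ^ 2) := by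
    have h5 : (inner ℝ (φ t) x) ^ 2 = ∑ i, ∑ j, φ t i * φ t j * (x i * x j) := by
      simp only [PiLp.inner_apply, RCLike.inner_apply, conj_trivial]
      rw [sq, Finset.sum_mul_sum]
      refine Finset.sum_congr rfl fun i _ => Finset.sum_congr rfl fun j _ => by ring
    rw [h5, Finset.sum_div, Finset.mul_sum, ← Finset.sum_add_distrib]
    refine Finset.sum_congr rfl fun i _ => ?_
    rw [Finset.sum_div, Finset.mul_sum, ← Finset.sum_add_distrib]
    refine Finset.sum_congr rfl fun j _ => by ring
  rw [h4]; ring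

variable (hφ : ContinuousOn φ (Ici 0))
  (hRc : ∀ i j, ContinuousOn (fun t => R t i j) (Ici 0))
  (hR : ∀ i j, ∀ t, 0 ≤ t → HasDerivWithinAt (fun t => R t i j)
    (-ψ * R t i j + φ t i * φ t j / (1 + ‖φ t‖ ^ 2)) (Ici t) t)
include hφ hRc hR

theorem quadratic_increment (x : Vec n) {a b : ℝ} (ha : 0 ≤ a) (hab : a ≤ b) :
    Real.exp (ψ * b) * inner ℝ x (act (R b) x) - Real.exp (ψ * a) * inner ℝ x (act (R a) x) =
      ∫ s in a..b, Real.exp (ψ * s) * ((inner ℝ (φ s) x) ^ 2 / (1 + ‖φ s‖ ^ 2)) := by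
  have hRM : ContinuousOn R (Ici 0) := continuousOn_pi.2 fun i => continuousOn_pi.2 fun j => hRc i j
  have hact : ContinuousOn (fun t => act (R t) x) (Ici 0) :=
    (continuous_act.comp_continuousOn hRM).clm_apply continuousOn_const
  have hrhs : ContinuousOn (fun s => Real.exp (ψ * s) *
      ((inner ℝ (φ s) x) ^ 2 / (1 + ‖φ s‖ ^ 2))) (Ici 0) := by
    refine ContinuousOn.mul (by fun_prop) (ContinuousOn.div (by fun_prop) (by fun_prop) ?_)
    intro s _
    positivity
  refine (intervalIntegral.integral_eq_sub_of_hasDeriv_right_of_le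
    (f := fun t => Real.exp (ψ * t) * inner ℝ x (act (R t) x)) hab ?_ ?_
    (intervalIntegrable_of_continuousOn_Ici hrhs ha (ha.trans hab))).symm
  · refine ContinuousOn.mono (s := Ici 0) ?_ fun s hs => ha.trans hs.1
    exact ContinuousOn.mul (by fun_prop) (continuousOn_const.inner hact)
  · intro t ht
    exact (hasDerivWithinAt_quadratic (fun i j => hR i j t (ha.trans ht.1.le)) x).mono
      Ioi_subset_Ici_self

/-- `R 0` may be indefinite, but its contribution is forgotten at rate `ψ`, and the data accumulated
since contribute nonnegatively. -/
theorem quadratic_lower (x : Vec n) {t : ℝ} (ht : 0 ≤ t) :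
    -(‖act (R 0)‖ * Real.exp (-ψ * t)) * ‖x‖ ^ 2 ≤ inner ℝ x (act (R t) x) := by
  have h1 := quadratic_increment hφ hRc hR x le_rfl ht
  have h2 : 0 ≤ ∫ s in (0 : ℝ)..t, Real.exp (ψ * s) *
      ((inner ℝ (φ s) x) ^ 2 / (1 + ‖φ s‖ ^ 2)) :=
    intervalIntegral.integral_nonneg ht fun s _ => by positivity
  have h3 : -(‖act (R 0)‖ * ‖x‖ ^ 2) ≤ inner ℝ x (act (R 0) x) := by
    have e1 := (abs_le.1 (abs_real_inner_le_norm x (act (R 0) x))).1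
    have e2 := mul_le_mul_of_nonneg_left ((act (R 0)).le_opNorm x) (norm_nonneg x)
    nlinarith
  rw [mul_zero, Real.exp_zero, one_mul] at h1
  have h4 : Real.exp (-ψ * t) * Real.exp (ψ * t) = 1 := by
    rw [← Real.exp_add]; simp
  have h5 := Real.exp_pos (-ψ * t)
  calc _ = Real.exp (-ψ * t) * (-(‖act (R 0)‖ * ‖x‖ ^ 2)) := by ring
    _ ≤ Real.exp (-ψ * t) * (Real.exp (ψ * t) * inner ℝ x (act (R t) x)) := by
        gcongr; linarith
    _ = _ := by rw [← mul_assoc, h4, one_mul]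

/-- The last window of length `T₀` alone suffices: forgetting discounts it by at most `e^{-ψT₀}`,
and normalisation by at most `1 + M²`. These factors form `β`. -/
theorem quadratic_lower_of_persistentlyExciting (hψ : 0 < ψ) (hb : BoundedSignal φ)
    (hPE : PersistentlyExciting φ) : ∃ β C : ℝ, 0 < β ∧ 0 ≤ C ∧ ∀ t, 0 ≤ t → ∀ x : Vec n,
      (β - C * Real.exp (-ψ * t)) * ‖x‖ ^ 2 ≤ inner ℝ x (act (R t) x) := by
  obtain ⟨M, hM⟩ := hb
  obtain ⟨T₀, α, hT₀, hα, hPE⟩ := hPE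
  set β := Real.exp (-ψ * T₀) * (α / (1 + M ^ 2)) with hβ
  have hβ0 : 0 < β := by positivity
  refine ⟨β, ‖act (R 0)‖ + β * Real.exp (ψ * T₀), hβ0, by positivity, fun t ht x => ?_⟩
  have hlow := fun s (hs : 0 ≤ s) => quadratic_lower hφ hRc hR x hs
  rcases lt_or_ge t T₀ with htT | htT
  -- No full window is available before `T₀`. The second summand of `C` then outweighs `β`, so the
  -- bound without excitation is enough.
  · have h1 : β ≤ β * Real.exp (ψ * T₀) * Real.exp (-ψ * t) := by
      rw [mul_assoc, ← Real.exp_add]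
      refine le_mul_of_one_le_right hβ0.le (Real.one_le_exp ?_)
      nlinarith
    refine le_trans ?_ (hlow t ht)
    gcongr
    linarith
  · have hs : 0 ≤ t - T₀ := by linarith
    have h1 := quadratic_increment hφ hRc hR x hs (by linarith : t - T₀ ≤ t)
    have h2 := hPE (t - T₀) hs x
    rw [sub_add_cancel] at h2
    have h3 : Real.exp (ψ * (t - T₀)) / (1 + M ^ 2) * ∫ s in (t - T₀)..t, (inner ℝ (φ s) x) ^ 2 ≤
        ∫ s in (t - T₀)..t, Real.exp (ψ * s) * ((inner ℝ (φ s) x) ^ 2 / (1 + ‖φ s‖ ^ 2)) := by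
      rw [← intervalIntegral.integral_const_mul]
      refine intervalIntegral.integral_mono_on (by linarith) ?_ ?_ fun s hs' => ?_
      · exact intervalIntegrable_of_continuousOn_Ici (by fun_prop) hs ht
      · refine intervalIntegrable_of_continuousOn_Ici ?_ hs ht
        refine ContinuousOn.mul (by fun_prop) (ContinuousOn.div (by fun_prop) (by fun_prop) ?_)
        intro s _
        positivity
      · have hs0 : 0 ≤ s := hs.trans hs'.1
        have e1 : ‖φ s‖ ^ 2 ≤ M ^ 2 := pow_le_pow_left₀ (norm_nonneg _) (hM s hs0) 2
        have e2 : Real.exp (ψ * (t - T₀)) ≤ Real.exp (ψ * s) :=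
          Real.exp_le_exp.2 (by nlinarith [hs'.1])
        rw [div_mul_eq_mul_div, mul_div_assoc]
        gcongr
    have h4 : Real.exp (ψ * (t - T₀)) / (1 + M ^ 2) * (α * ‖x‖ ^ 2) ≤
        Real.exp (ψ * (t - T₀)) / (1 + M ^ 2) * ∫ s in (t - T₀)..t, (inner ℝ (φ s) x) ^ 2 := by
      gcongr
    have h5 := hlow (t - T₀) hs
    have hE : ∀ p q : ℝ, Real.exp (-ψ * t) * (Real.exp (ψ * (t - p)) * q) =
        Real.exp (-ψ * p) * q := fun p q => by
      rw [← mul_assoc, ← Real.exp_add]; ring_nf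
    have h6 : Real.exp (-ψ * t) * (Real.exp (ψ * t) * inner ℝ x (act (R t) x)) =
        inner ℝ x (act (R t) x) := by
      have := hE 0 (inner ℝ x (act (R t) x))
      simpa using this
    have h7 : Real.exp (-ψ * T₀) * Real.exp (-ψ * (t - T₀)) = Real.exp (-ψ * t) := by
      rw [← Real.exp_add]; ring_nf
    have h8 : Real.exp (ψ * t) * inner ℝ x (act (R t) x) ≥
        Real.exp (ψ * (t - T₀)) * (-(‖act (R 0)‖ * Real.exp (-ψ * (t - T₀))) * ‖x‖ ^ 2) +
        Real.exp (ψ * (t - T₀)) * (α / (1 + M ^ 2) * ‖x‖ ^ 2) := by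
      have e1 := mul_le_mul_of_nonneg_left h5 (Real.exp_pos (ψ * (t - T₀))).le
      have e2 : Real.exp (ψ * (t - T₀)) * (α / (1 + M ^ 2) * ‖x‖ ^ 2) =
        Real.exp (ψ * (t - T₀)) / (1 + M ^ 2) * (α * ‖x‖ ^ 2) := by ring
      rw [e2]
      linarith
    have h9 := mul_le_mul_of_nonneg_left h8 (Real.exp_pos (-ψ * t)).le
    rw [h6, mul_add, hE, hE] at h9
    have h10 : Real.exp (-ψ * T₀) * (-(‖act (R 0)‖ * Real.exp (-ψ * (t - T₀))) * ‖x‖ ^ 2) =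
        -(‖act (R 0)‖ * Real.exp (-ψ * t)) * ‖x‖ ^ 2 := by rw [← h7]; ring
    rw [h10, ← mul_assoc, ← hβ] at h9
    have h11 : 0 ≤ β * Real.exp (ψ * T₀) * Real.exp (-ψ * t) * ‖x‖ ^ 2 := by positivity
    linarith

end Gradient

/-! ### Lyapunov analysis of the parameter error -/

section ParameterError

variable {n : ℕ} {R : ℝ → Matrix (Fin n) (Fin n) ℝ} {Q θhat : ℝ → Vec n} {θ : Vec n}
  {Γ : Matrix (Fin n) (Fin n) ℝ}

/-- The form is that of `Γ⁻¹`, which cancels the adaptation gain in the energy derivative. -/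
theorem exists_gain_form (hΓ : Γ.PosDef) : ∃ (P : Vec n →L[ℝ] Vec n) (m : ℝ), 0 < m ∧
    (∀ x, m * ‖x‖ ^ 2 ≤ inner ℝ (P x) x) ∧ (∀ x y, inner ℝ (P x) y = inner ℝ (P y) x) ∧
    ∀ x y, inner ℝ (P x) (act Γ y) = inner ℝ x y := by
  have hG := hΓ.inv
  have hGt : (Γ⁻¹).transpose = Γ⁻¹ := by
    have := hG.isHermitian
    rwa [Matrix.IsHermitian, Matrix.conjTranspose_eq_transpose_of_trivial] at this
  have hGΓ : Γ⁻¹ * Γ = 1 := Matrix.nonsing_inv_mul _ ((Matrix.isUnit_iff_isUnit_det _).1 hΓ.isUnit)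
  obtain ⟨m, hm, hlow⟩ := exists_coercive_of_pos (P := act Γ⁻¹) fun x hx => by
    have h1 : (fun i => x i) ≠ 0 := fun h => hx (by ext i; exact congrFun h i)
    have h2 := hG.dotProduct_mulVec_pos h1
    have h3 : inner ℝ (act Γ⁻¹ x) x = star (fun i => x i) ⬝ᵥ (Γ⁻¹).mulVec (fun i => x i) := by
      simp only [PiLp.inner_apply, act_apply, RCLike.inner_apply, conj_trivial, dotProduct,
        Matrix.mulVec, star_trivial]
    rwa [h3]
  refine ⟨act Γ⁻¹, m, hm, hlow, fun x y => ?_, fun x y => ?_⟩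
  · rw [act_transpose, hGt, real_inner_comm]
  · rw [act_transpose, hGt, ← act_mul, hGΓ, act_one]

variable (hΓ : Γ.PosDef) (hθc : ContinuousOn θhat (Ici 0))
  (hθ : ∀ t, 0 ≤ t → HasDerivWithinAt θhat (-(act Γ (act (R t) (θhat t) + Q t))) (Ici t) t)
  {K ν : ℝ} (hν : 0 < ν) (hK0 : 0 ≤ K)
  (hK : ∀ t, 0 ≤ t → ‖act (R t) θ + Q t‖ ≤ K * Real.exp (-ν * t))

include hθ in
-- Writing `R θhat + Q = (Rθ + Q) - R(θ - θhat)` separates the decaying residual from the feedback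
-- through `R`.
theorem hasDerivWithinAt_gain_form {P : Vec n →L[ℝ] Vec n}
    (hsymm : ∀ x y, inner ℝ (P x) y = inner ℝ (P y) x)
    (hPΓ : ∀ x y, inner ℝ (P x) (act Γ y) = inner ℝ x y) {t : ℝ} (ht : 0 ≤ t) :
    HasDerivWithinAt (fun t => inner ℝ (P (θ - θhat t)) (θ - θhat t))
      (2 * inner ℝ (θ - θhat t) (act (R t) θ + Q t)
        - 2 * inner ℝ (θ - θhat t) (act (R t) (θ - θhat t))) (Ici t) t := by
  have h1 := (hθ t ht).const_sub θ
  rw [neg_neg] at h1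
  refine ((P.hasFDerivAt.comp_hasDerivWithinAt t h1).inner ℝ h1).congr_deriv ?_
  simp only [Function.comp_apply]
  rw [hsymm (act Γ _), hPΓ, ← two_mul, ← mul_sub, ← inner_sub_right, map_sub]
  congr 3
  abel

include hΓ hθc hθ hν hK0 hK in
-- Residual and negative part of `R` both carry the factor `e^{-νt}`. With `2‖θ̃‖ ≤ 1 + ‖θ̃‖²` the
-- energy grows at most like an integrable coefficient times `V + 1`.
theorem exists_parameter_error_bound {C : ℝ} (hC : 0 ≤ C)
    (hR : ∀ t, 0 ≤ t → ∀ x : Vec n, -(C * Real.exp (-ν * t)) * ‖x‖ ^ 2 ≤ inner ℝ x (act (R t) x)) :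
    ∃ B : ℝ, 0 ≤ B ∧ ∀ t, 0 ≤ t → ‖θ - θhat t‖ ≤ B := by
  obtain ⟨P, m, hm, hlow, hsymm, hPΓ⟩ := exists_gain_form hΓ
  have hc : ContinuousOn (fun t => θ - θhat t) (Ici 0) := continuousOn_const.sub hθc
  have hpos : ∀ x, 0 ≤ inner ℝ (P x) x := fun x =>
    (by positivity : 0 ≤ m * ‖x‖ ^ 2).trans (hlow x)
  obtain ⟨L, hL⟩ := exists_le_of_dini_integrable hν
    (c := K + (K + 2 * C) / m) (by positivity)
    ((P.continuous.comp_continuousOn hc).inner hc) (fun t _ => hpos _)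
    (fun t ht r hr => frequently_slope_lt_of_hasDerivWithinAt
      (hasDerivWithinAt_gain_form hθ hsymm hPΓ ht) hr) (fun t ht => by
      have h1 := hR t ht (θ - θhat t)
      have h2 : inner ℝ (θ - θhat t) (act (R t) θ + Q t) ≤
          ‖θ - θhat t‖ * (K * Real.exp (-ν * t)) :=
        (real_inner_le_norm _ _).trans (by gcongr; exact hK t ht)
      have h3 : ‖θ - θhat t‖ ^ 2 ≤ inner ℝ (P (θ - θhat t)) (θ - θhat t) / m := by
        rw [le_div_iff₀ hm, mul_comm]; exact hlow _
      have hE := Real.exp_pos (-ν * t)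
      simp only [Function.comp_apply]
      have h4 : 2 * ‖θ - θhat t‖ ≤ 1 + ‖θ - θhat t‖ ^ 2 := by
        nlinarith [sq_nonneg (‖θ - θhat t‖ - 1)]
      calc _ ≤ 2 * (‖θ - θhat t‖ * (K * Real.exp (-ν * t))) +
            2 * (C * Real.exp (-ν * t) * ‖θ - θhat t‖ ^ 2) := by linarith
        _ = K * Real.exp (-ν * t) * (2 * ‖θ - θhat t‖) +
            2 * C * Real.exp (-ν * t) * ‖θ - θhat t‖ ^ 2 := by ring
        _ ≤ K * Real.exp (-ν * t) * (1 + ‖θ - θhat t‖ ^ 2) +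
            2 * C * Real.exp (-ν * t) * ‖θ - θhat t‖ ^ 2 := by gcongr
        _ = K * Real.exp (-ν * t) + (K + 2 * C) * Real.exp (-ν * t) * ‖θ - θhat t‖ ^ 2 := by ring
        _ ≤ K * Real.exp (-ν * t) + (K + 2 * C) * Real.exp (-ν * t) *
            (inner ℝ (P (θ - θhat t)) (θ - θhat t) / m) := by gcongr
        _ ≤ _ := by
          have e1 := mul_nonneg (mul_nonneg hK0 hE.le) (hpos (θ - θhat t))
          have e2 : 0 ≤ (K + 2 * C) / m * Real.exp (-ν * t) := by positivity
          have e3 : (K + 2 * C) * Real.exp (-ν * t) *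
            (inner ℝ (P (θ - θhat t)) (θ - θhat t) / m) = (K + 2 * C) / m * Real.exp (-ν * t) *
              inner ℝ (P (θ - θhat t)) (θ - θhat t) := by ring
          rw [e3]
          linarith)
  have hL0 : 0 ≤ L := (hpos _).trans (hL 0 le_rfl)
  refine ⟨√(L / m), Real.sqrt_nonneg _, fun t ht => Real.le_sqrt_of_sq_le ?_⟩
  rw [le_div_iff₀ hm, mul_comm]
  exact (hlow _).trans (hL t ht)

include hΓ hθc hθ hν hK0 hK in
-- Boundedness comes first: it turns the transient defect `C e^{-νt}‖θ̃‖²` into decaying forcing,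
-- against which the uniform part `β` provides genuine dissipation.
theorem exists_parameter_error_decay {C β : ℝ} (hβ : 0 < β) (hC : 0 ≤ C)
    (hR : ∀ t, 0 ≤ t → ∀ x : Vec n,
      (β - C * Real.exp (-ν * t)) * ‖x‖ ^ 2 ≤ inner ℝ x (act (R t) x)) :
    ∃ D μ : ℝ, 0 < μ ∧ ∀ t, 0 ≤ t → ‖θ - θhat t‖ ≤ D * Real.exp (-μ * t) := by
  obtain ⟨B, hB0, hB⟩ := exists_parameter_error_bound (C := C) hΓ hθc hθ hν hK0 hK hC
    fun t ht x => le_trans (by gcongr; linarith) (hR t ht x)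
  obtain ⟨P, m, hm, hlow, hsymm, hPΓ⟩ := exists_gain_form hΓ
  have hc : ContinuousOn (fun t => θ - θhat t) (Ici 0) := continuousOn_const.sub hθc
  have hup : ∀ x : Vec n, inner ℝ (P x) x ≤ (‖P‖ + 1) * ‖x‖ ^ 2 := fun x => by
    have h1 := (real_inner_le_norm (P x) x).trans
      (mul_le_mul_of_nonneg_right (P.le_opNorm x) (norm_nonneg x))
    nlinarith [sq_nonneg ‖x‖]
  set a := β / (‖P‖ + 1) with ha
  have ha0 : 0 < a := by positivity
  set μ := min (ν / 2) (a / 2) with hμ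
  have hμ0 : 0 < μ := by positivity
  have hμν : 2 * μ ≤ ν := by linarith [min_le_left (ν / 2) (a / 2)]
  have hμa : 2 * μ ≤ a := by linarith [min_le_right (ν / 2) (a / 2)]
  have key := le_exp_of_dini (f := fun t => inner ℝ (P (θ - θhat t)) (θ - θhat t)) (a := 2 * a)
    (C := 2 * B * K + 2 * C * B ^ 2) (μ := 2 * μ)
    ((P.continuous.comp_continuousOn hc).inner hc) (by linarith) (by positivity)
    (fun t ht r hr => frequently_slope_lt_of_hasDerivWithinAt
      (hasDerivWithinAt_gain_form hθ hsymm hPΓ ht) hr) (fun t ht => by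
      have h1 := hR t ht (θ - θhat t)
      have hE := Real.exp_pos (-ν * t)
      have h2 : inner ℝ (θ - θhat t) (act (R t) θ + Q t) ≤ B * (K * Real.exp (-ν * t)) :=
        (real_inner_le_norm _ _).trans (mul_le_mul (hB t ht) (hK t ht) (norm_nonneg _) hB0)
      have h3 : a * inner ℝ (P (θ - θhat t)) (θ - θhat t) ≤ β * ‖θ - θhat t‖ ^ 2 := by
        rw [ha, div_mul_eq_mul_div, div_le_iff₀ (by positivity), mul_assoc]
        gcongr
        linarith [hup (θ - θhat t)]
      have h4 : C * Real.exp (-ν * t) * ‖θ - θhat t‖ ^ 2 ≤ C * Real.exp (-ν * t) * B ^ 2 := by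
        gcongr; exact hB t ht
      have h5 : (2 * B * K + 2 * C * B ^ 2) * Real.exp (-ν * t) ≤
          (2 * B * K + 2 * C * B ^ 2) * Real.exp (-(2 * μ) * t) := by
        gcongr
      linarith)
  set L := |inner ℝ (P (θ - θhat 0)) (θ - θhat 0)| +
    (2 * B * K + 2 * C * B ^ 2) / (2 * a - 2 * μ) + 1 with hL
  have hL0 : 0 ≤ L := by
    have : 0 < 2 * a - 2 * μ := by linarith
    positivity
  refine ⟨√(L / m), μ, hμ0, fun t ht => ?_⟩
  refine abs_le_of_sq_le_sq' ?_ (by positivity) |>.2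
  rw [mul_pow, Real.sq_sqrt (by positivity), exp_neg_mul_sq, div_mul_eq_mul_div, le_div_iff₀ hm,
    mul_comm]
  exact (hlow _).trans (key t ht)

end ParameterError

/-! ## The identifier along a solution of the plant -/

section IdentifierError

variable {nX nz nU : ℕ} {S : Plant nX nz nU} {U : ℝ → Vec nU} {u : ℝ → State nX nz}
  {ϱ ψ : ℝ} {Γ : Matrix (Fin nz) (Fin nz) ℝ} {I : Identifier nz}

theorem continuous_Sig (hSig : ∀ i j, LocallyLipschitz fun v => S.Sig v i j) : Continuous S.Sig :=
  continuous_pi fun i => continuous_pi fun j => (hSig i j).continuous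

theorem continuousOn_vel (hU : ContinuousOn U (Ici 0)) (hu : ContinuousOn u (Ici 0)) :
    ContinuousOn (fun t => S.vel (u t).fst (U t)) (Ici 0) :=
  ((act S.A₂).continuous.comp_continuousOn ((fstOp nX nz).continuous.comp_continuousOn hu)).add
    ((act S.G₂).continuous.comp_continuousOn hU)

theorem continuousOn_Y₁ (hh₂ : LocallyLipschitz S.h₂) (hU : ContinuousOn U (Ici 0))
    (hu : ContinuousOn u (Ici 0)) : ContinuousOn (S.Y₁ U u) (Ici 0) :=
  hh₂.continuous.comp_continuousOn (continuousOn_vel hU hu)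

theorem continuousOn_Z₁ (hh₂ : LocallyLipschitz S.h₂) (hU : ContinuousOn U (Ici 0))
    (hu : ContinuousOn u (Ici 0)) : ContinuousOn (S.Z₁ U u) (Ici 0) :=
  continuousOn_finsetSum _ fun i _ =>
    (EuclideanSpace.proj (𝕜 := ℝ) i).continuous.comp_continuousOn (continuousOn_Y₁ hh₂ hU hu)

/-- Continuity of `h₂⁻¹` is never needed, since it is only applied to `Y₁ = h₂(v)` and returns `v`.
-/
theorem continuousOn_sourceMat (hSig : ∀ i j, LocallyLipschitz fun v => S.Sig v i j)
    (hU : ContinuousOn U (Ici 0)) (hu : ContinuousOn u (Ici 0)) :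
    ContinuousOn (S.sourceMat U u) (Ici 0) := by
  have h1 : ContinuousOn (fun t => S.Sig (S.h₂.symm (S.Y₁ U u t))) (Ici 0) := by
    simp only [Plant.Y₁, Equiv.symm_apply_apply]
    exact (continuous_Sig hSig).comp_continuousOn (continuousOn_vel hU hu)
  exact (continuousOn_const.mul h1).mul continuousOn_const

theorem continuousOn_rawRegressor (hSig : ∀ i j, LocallyLipschitz fun v => S.Sig v i j)
    (hh₂ : LocallyLipschitz S.h₂) (hU : ContinuousOn U (Ici 0)) (hu : ContinuousOn u (Ici 0)) :
    ContinuousOn (S.rawRegressor U u) (Ici 0) :=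
  ((continuous_act.comp_continuousOn (continuousOn_sourceMat hSig hU hu)).clm_apply
    (continuousOn_Y₁ hh₂ hU hu)).neg

/-- The filtered output satisfies the linear regression `Z₁ - ζ₁ - ζ₂ = φᵀ θ` up to an
exponentially decaying term. -/
theorem Identifier.IsDriven.regression (hI : I.IsDriven S U u ϱ ψ Γ)
    (hSig : ∀ i j, LocallyLipschitz fun v => S.Sig v i j) (hh₂ : LocallyLipschitz S.h₂)
    (hU : ContinuousOn U (Ici 0)) (hu : ContinuousOn u (Ici 0)) {ν : ℝ} (hν : ν < ϱ) :
    ∃ K : ℝ, 0 ≤ K ∧ ∀ t, 0 ≤ t →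
      |I.ζ₁ t + (I.ζ₂ t - S.Z₁ U u t) + inner ℝ (I.φ t) S.θ| ≤ K * Real.exp (-ν * t) := by
  have hZ := continuousOn_Z₁ hh₂ hU hu
  have hY := continuousOn_Y₁ hh₂ hU hu
  have hraw := continuousOn_rawRegressor hSig hh₂ hU hu
  have hφ := hI.φ_ode.1
  have hζ := hI.ζ₁_ode.1
  have hint : ContinuousOn (fun s => act (diag S.θ * S.sourceMat U u s) (S.Y₁ U u s)) (Ici 0) :=
    (continuous_act.comp_continuousOn
      (continuousOn_const.mul (continuousOn_sourceMat hSig hU hu))).clm_apply hY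
  -- Subtracting `Z₁` removes the part of `Z₂prim` that is merely continuous; what remains is an
  -- integral of continuous functions, hence differentiable.
  have hζ₂ : ∀ t, 0 ≤ t → I.ζ₂ t - S.Z₁ U u t = (I.ζ₂ 0 - S.Z₁ U u 0) +
      ((∫ s in (0 : ℝ)..t, -ϱ * I.ζ₂ s) +
        ∑ i, (∫ s in (0 : ℝ)..t, act (diag S.θ * S.sourceMat U u s) (S.Y₁ U u s)) i) := by
    intro t ht
    have h1 : S.Z₂prim U u t =
        (∑ i, (∫ s in (0 : ℝ)..t, act (diag S.θ * S.sourceMat U u s) (S.Y₁ U u s)) i) +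
          (S.Z₁ U u t - S.Z₁ U u 0) := by
      simp only [Plant.Z₂prim, Plant.Y₂prim, Plant.Z₁, PiLp.add_apply, PiLp.sub_apply,
        Finset.sum_add_distrib, Finset.sum_sub_distrib]
    rw [hI.ζ₂_ode t ht, h1]
    ring
  refine exists_norm_le_exp_of_ode (a := ϱ) (C := 0) (ν := ν)
    (r := fun t => I.ζ₁ t + (I.ζ₂ t - S.Z₁ U u t) + inner ℝ (I.φ t) S.θ) (s := fun _ => 0) hν
    ((hζ.add (hI.ζ₂_cont.sub hZ)).add (hφ.inner continuousOn_const)) (fun t ht => ?_)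
    (fun t _ => by simp)
  · have d1 := hI.ζ₁_ode.hasDerivWithinAt (continuousOn_const.mul (hζ.sub hZ)) ht
    have d2 : HasDerivWithinAt (fun t => I.ζ₂ t - S.Z₁ U u t)
        (-ϱ * I.ζ₂ t + ∑ i, act (diag S.θ * S.sourceMat U u t) (S.Y₁ U u t) i) (Ici t) t := by
      refine HasDerivWithinAt.congr ?_ (fun z hz => hζ₂ z (ht.trans hz)) (hζ₂ t ht)
      refine HasDerivWithinAt.const_add _ (HasDerivWithinAt.add ?_ ?_)
      · exact hasDerivWithinAt_integral_of_continuousOn_Ici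
          (continuousOn_const.mul hI.ζ₂_cont) le_rfl ht
      · exact HasDerivWithinAt.fun_sum fun i _ =>
          hasDerivWithinAt_vec_apply
            (hasDerivWithinAt_integral_of_continuousOn_Ici hint le_rfl ht) i
    have d3 := (hI.φ_ode.hasDerivWithinAt ((hφ.const_smul ϱ).neg.add hraw) ht).inner ℝ
      (hasDerivWithinAt_const t (Ici t) S.θ)
    refine ((d1.add d2).add d3).congr_deriv ?_
    have h1 : ∑ i, act (diag S.θ * S.sourceMat U u t) (S.Y₁ U u t) i =
        -inner ℝ (S.rawRegressor U u t) S.θ := by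
      simp only [Plant.rawRegressor, inner_neg_left, neg_neg, act_mul, PiLp.inner_apply,
        RCLike.inner_apply, conj_trivial]
      refine Finset.sum_congr rfl fun i _ => ?_
      rw [act_apply]
      simp [diag, Matrix.diagonal_apply]
    rw [h1, inner_zero_right, inner_add_left, inner_neg_left, real_inner_smul_left, smul_eq_mul]
    ring

/-- The signal `R θ + Q` decays exponentially. -/
theorem Identifier.IsDriven.gradient_error (hI : I.IsDriven S U u ϱ ψ Γ)
    (hSig : ∀ i j, LocallyLipschitz fun v => S.Sig v i j) (hh₂ : LocallyLipschitz S.h₂)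
    (hU : ContinuousOn U (Ici 0)) (hu : ContinuousOn u (Ici 0)) {ν : ℝ} (hν : ν < ϱ)
    (hνψ : ν < ψ) : ∃ K : ℝ, 0 ≤ K ∧ ∀ t, 0 ≤ t →
      ‖act (I.R t) S.θ + I.Q t‖ ≤ K * Real.exp (-ν * t) := by
  obtain ⟨K, hK0, hK⟩ := hI.regression hSig hh₂ hU hu hν
  have hZ := continuousOn_Z₁ hh₂ hU hu
  have hφ := hI.φ_ode.1
  have hζ := hI.ζ₁_ode.1
  have hQ := hI.Q_ode.1
  have hRM : ContinuousOn I.R (Ici 0) :=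
    continuousOn_pi.2 fun i => continuousOn_pi.2 fun j => (hI.R_ode i j).1
  set ρ : ℝ → ℝ := fun t => I.ζ₁ t + (I.ζ₂ t - S.Z₁ U u t) + inner ℝ (I.φ t) S.θ with hρ
  -- `Rθ + Q` obeys the forgetting dynamics driven by the regression residual `ρ` alone; the
  -- normalisation keeps `φ / (1 + ‖φ‖²)` bounded even when `φ` is not.
  refine exists_norm_le_exp_of_ode (a := ψ) (C := K) (ν := ν)
    (s := fun t => (ρ t / (1 + ‖I.φ t‖ ^ 2)) • I.φ t) hνψ
    (((continuous_act.comp_continuousOn hRM).clm_apply continuousOn_const).add hQ)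
    (fun t ht => ?_) (fun t ht => ?_)
  · have dQ := hI.Q_ode.hasDerivWithinAt ((hQ.const_smul ψ).neg.sub
      (((hZ.sub (hζ.add hI.ζ₂_cont)).div (by fun_prop) (fun s _ => by positivity)).smul hφ)) ht
    refine hasDerivWithinAt_vec fun i => ?_
    have dR : ∀ j, HasDerivWithinAt (fun t => I.R t i j)
        (-ψ * I.R t i j + I.φ t i * I.φ t j / (1 + ‖I.φ t‖ ^ 2)) (Ici t) t := fun j =>
      (hI.R_ode i j).hasDerivWithinAt ((continuousOn_const.mul (hI.R_ode i j).1).add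
        (ContinuousOn.div (by fun_prop) (by fun_prop) (fun s _ => by positivity))) ht
    have h1 := (HasDerivWithinAt.fun_sum (u := Finset.univ)
      fun j _ => (dR j).mul_const (S.θ j)).add (hasDerivWithinAt_vec_apply dQ i)
    have h2 : (fun t => (act (I.R t) S.θ + I.Q t) i) =
        (fun t => ∑ j, I.R t i j * S.θ j) + fun t => I.Q t i := by
      ext t
      rw [PiLp.add_apply, act_apply]; rfl
    rw [h2]
    refine h1.congr_deriv ?_
    have hd : (1 + ‖I.φ t‖ ^ 2) ≠ 0 := by positivity
    have h3 : ∑ j, (-ψ * I.R t i j + I.φ t i * I.φ t j / (1 + ‖I.φ t‖ ^ 2)) * S.θ j =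
        -ψ * (∑ j, I.R t i j * S.θ j) +
          I.φ t i * inner ℝ (I.φ t) S.θ / (1 + ‖I.φ t‖ ^ 2) := by
      simp only [PiLp.inner_apply, RCLike.inner_apply, conj_trivial]
      rw [Finset.mul_sum, Finset.mul_sum, Finset.sum_div, ← Finset.sum_add_distrib]
      refine Finset.sum_congr rfl fun j _ => by ring
    rw [h3]
    simp only [PiLp.add_apply, PiLp.sub_apply, PiLp.neg_apply, PiLp.smul_apply, smul_eq_mul,
      act_apply, hρ]
    field_simp
    ring
  · rw [norm_smul, Real.norm_eq_abs, abs_div, abs_of_pos (by positivity : 0 < 1 + ‖I.φ t‖ ^ 2),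
      div_mul_eq_mul_div, div_le_iff₀ (by positivity)]
    have h1 : ‖I.φ t‖ ≤ 1 + ‖I.φ t‖ ^ 2 := by nlinarith [sq_nonneg (‖I.φ t‖ - 1)]
    exact mul_le_mul (hK t ht) h1 (norm_nonneg _) (by positivity)

end IdentifierError

/-! ### Norm and continuity estimates for matrix products -/

section Norms

variable {l m n : ℕ}

theorem norm_act_mul_le (M : Matrix (Fin l) (Fin m) ℝ) (N : Matrix (Fin m) (Fin n) ℝ) :
    ‖act (M * N)‖ ≤ ‖act M‖ * ‖act N‖ := by
  refine (act (M * N)).opNorm_le_bound (by positivity) fun x => ?_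
  rw [act_mul, mul_assoc]
  exact ((act M).le_opNorm _).trans (by gcongr; exact (act N).le_opNorm _)

theorem act_diag_apply (a x : Vec n) (i : Fin n) : act (diag a) x i = a i * x i := by
  rw [act_apply]
  simp [diag, Matrix.diagonal_apply]

theorem norm_act_diag_le (a : Vec n) : ‖act (diag a)‖ ≤ ‖a‖ := by
  refine (act (diag a)).opNorm_le_bound (norm_nonneg _) fun x => ?_
  refine abs_le_of_sq_le_sq' ?_ (by positivity) |>.2
  rw [mul_pow, EuclideanSpace.norm_sq_eq (act (diag a) x), EuclideanSpace.norm_sq_eq x,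
    Finset.mul_sum]
  refine Finset.sum_le_sum fun i _ => ?_
  rw [act_diag_apply, norm_mul, mul_pow]
  gcongr
  exact PiLp.norm_apply_le a i

theorem diag_sub (a b : Vec n) : diag a - diag b = diag (a - b) := by
  simp [diag, Matrix.diagonal_sub]

theorem continuous_diag : Continuous (diag : Vec n → _) :=
  Continuous.matrix_diagonal (by fun_prop)

theorem continuous_constL2 : Continuous (constL2 : Vec n → L2 n) :=
  (Lp.constL 2 (volume.restrict (Ioo (0 : ℝ) 1)) ℝ).continuous

theorem continuousOn_matrix_mul {s : Set ℝ} {M : ℝ → Matrix (Fin l) (Fin m) ℝ}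
    {N : ℝ → Matrix (Fin m) (Fin n) ℝ} (hM : ContinuousOn M s) (hN : ContinuousOn N s) :
    ContinuousOn (fun t => M t * N t) s := by
  have h : Continuous fun p : Matrix (Fin l) (Fin m) ℝ × Matrix (Fin m) (Fin n) ℝ => p.1 * p.2 :=
    continuous_fst.matrix_mul continuous_snd
  exact h.comp_continuousOn (hM.prodMk hN)

theorem norm_act_mul_apply_le (G : Matrix (Fin l) (Fin m) ℝ) {N : Matrix (Fin m) (Fin n) ℝ}
    {x : Vec n} {c r : ℝ} (hN : ‖act N‖ ≤ c) (hx : ‖x‖ ≤ r) :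
    ‖act (G * N) x‖ ≤ ‖act G‖ * (c * r) := by
  have h : ‖act N x‖ ≤ c * r :=
    ((act N).le_opNorm x).trans
      (mul_le_mul hN hx (norm_nonneg _) ((norm_nonneg _).trans hN))
  rw [act_mul]
  exact ((act G).le_opNorm _).trans (mul_le_mul_of_nonneg_left h (norm_nonneg _))

theorem norm_actL2_apply_le {N : Matrix (Fin m) (Fin n) ℝ} {ζ : L2 n} {c r : ℝ}
    (hN : ‖act N‖ ≤ c) (hζ : ‖ζ‖ ≤ r) : ‖actL2 N ζ‖ ≤ c * r :=
  ((actL2 N).le_opNorm ζ).trans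
    (mul_le_mul ((norm_actL2_le N).trans hN) hζ (norm_nonneg _) ((norm_nonneg _).trans hN))

end Norms

/-! ### Forcing terms and decay of the observer error -/

namespace Plant

variable {nX nz nU : ℕ} {S : Plant nX nz nU} {U : ℝ → Vec nU} {u : ℝ → State nX nz}
  {θhat : ℝ → Vec nz}

theorem continuousOn_forcing {s : Set ℝ} {M : ℝ → Matrix (Fin nX) (Fin nz) ℝ}
    {N : ℝ → Matrix (Fin nz) (Fin nz) ℝ} {x : ℝ → State nX nz} {c : ℝ → Vec nX} {d : ℝ → L2 nz}
    (hM : ContinuousOn M s) (hN : ContinuousOn N s) (hx : ContinuousOn x s)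
    (hc : ContinuousOn c s) (hd : ContinuousOn d s) :
    ContinuousOn (fun t => State.mk (act (M t) (S.K2op (x t).snd) + c t)
      (actL2 (N t) (x t).snd + d t)) s := by
  obtain ⟨𝒦, h𝒦⟩ := exists_kernelOp S.K₃_cont
  have h𝒦' : ∀ ζ, S.K2op ζ = 𝒦 ζ := fun ζ => (h𝒦 ζ).symm
  simp only [h𝒦']
  have hs : ContinuousOn (fun t => (x t).snd) s := (sndOp nX nz).continuous.comp_continuousOn hx
  exact State.continuous_mk.comp_continuousOn
    ((((continuous_act.comp_continuousOn hM).clm_apply (𝒦.continuous.comp_continuousOn hs)).add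
      hc).prodMk (((continuous_actL2.comp_continuousOn hN).clm_apply hs).add hd))

theorem continuousOn_K2op {s : Set ℝ} {x : ℝ → State nX nz} (hx : ContinuousOn x s) :
    ContinuousOn (fun t => S.K2op (x t).snd) s := by
  obtain ⟨𝒦, h𝒦⟩ := exists_kernelOp S.K₃_cont
  have h𝒦' : ∀ ζ, S.K2op ζ = 𝒦 ζ := fun ζ => (h𝒦 ζ).symm
  simp only [h𝒦']
  exact 𝒦.continuous.comp_continuousOn ((sndOp nX nz).continuous.comp_continuousOn hx)

theorem continuousOn_plantForcing (hSig : ∀ i j, LocallyLipschitz fun v => S.Sig v i j)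
    (hh₁ : LocallyLipschitz S.h₁) (hh₂ : LocallyLipschitz S.h₂) (hU : ContinuousOn U (Ici 0))
    (hu : ContinuousOn u (Ici 0)) :
    ContinuousOn (fun t => S.plantForcing U t (u t)) (Ici 0) := by
  have hv := continuousOn_vel (S := S) hU hu
  have hS : ContinuousOn (fun t => S.Sig (S.vel (u t).fst (U t))) (Ici 0) :=
    (continuous_Sig hSig).comp_continuousOn hv
  exact continuousOn_forcing (continuousOn_matrix_mul continuousOn_const hS)
    (continuousOn_matrix_mul continuousOn_const hS) hu
    ((act S.G₁).continuous.comp_continuousOn (hh₁.continuous.comp_continuousOn hv))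
    (continuous_constL2.comp_continuousOn (hh₂.continuous.comp_continuousOn hv))

theorem continuousOn_observerForcing (hSig : ∀ i j, LocallyLipschitz fun v => S.Sig v i j)
    (hh₁ : LocallyLipschitz S.h₁) (hh₂ : LocallyLipschitz S.h₂) (hU : ContinuousOn U (Ici 0))
    (hu : ContinuousOn u (Ici 0)) (hθ : ContinuousOn θhat (Ici 0))
    (L₁ : Matrix (Fin nX) (Fin nz) ℝ) {o : ℝ → State nX nz} (ho : ContinuousOn o (Ici 0)) :
    ContinuousOn (fun t => S.observerForcing U u θhat L₁ t (o t)) (Ici 0) := by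
  have hv := continuousOn_vel (S := S) hU hu
  have hvo := continuousOn_vel (S := S) hU ho
  have hS : ContinuousOn (fun t => S.Sig (S.vel (u t).fst (U t))) (Ici 0) :=
    (continuous_Sig hSig).comp_continuousOn hv
  have hd : ContinuousOn (fun t => diag (θhat t)) (Ici 0) :=
    continuous_diag.comp_continuousOn hθ
  simp only [observerForcing, Y₁, Equiv.symm_apply_apply, add_sub_assoc]
  exact continuousOn_forcing
    (continuousOn_matrix_mul (continuousOn_matrix_mul continuousOn_const hd) hS)
    (continuousOn_matrix_mul hd hS) ho
    (((act S.G₁).continuous.comp_continuousOn (hh₁.continuous.comp_continuousOn hv)).sub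
      ((act L₁).continuous.comp_continuousOn (hv.sub hvo)))
    (continuous_constL2.comp_continuousOn (hh₂.continuous.comp_continuousOn hv))

theorem continuousOn_errorForcing (hSig : ∀ i j, LocallyLipschitz fun v => S.Sig v i j)
    (hU : ContinuousOn U (Ici 0)) (hu : ContinuousOn u (Ici 0)) (hθ : ContinuousOn θhat (Ici 0))
    {e : ℝ → State nX nz} (he : ContinuousOn e (Ici 0)) :
    ContinuousOn (fun t => S.errorForcing U u θhat t (e t)) (Ici 0) := by
  have hv := continuousOn_vel (S := S) hU hu
  have hS : ContinuousOn (fun t => S.Sig (S.vel (u t).fst (U t))) (Ici 0) :=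
    (continuous_Sig hSig).comp_continuousOn hv
  have hd : ContinuousOn (fun t => diag (θhat t)) (Ici 0) :=
    continuous_diag.comp_continuousOn hθ
  have hd' : ContinuousOn (fun t => diag S.θ - diag (θhat t)) (Ici 0) := continuousOn_const.sub hd
  exact continuousOn_forcing
    (continuousOn_matrix_mul (continuousOn_matrix_mul continuousOn_const hd) hS)
    (continuousOn_matrix_mul hd hS) he
    ((continuous_act.comp_continuousOn
      (continuousOn_matrix_mul (continuousOn_matrix_mul continuousOn_const hd') hS)).clm_apply
      (continuousOn_K2op hu))
    ((continuous_actL2.comp_continuousOn (continuousOn_matrix_mul hd' hS)).clm_apply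
      ((sndOp nX nz).continuous.comp_continuousOn hu))

/-- The forcing terms of plant and observer differ by the forcing of the error dynamics and the
output injection. -/
theorem plantForcing_sub_observerForcing (L₁ : Matrix (Fin nX) (Fin nz) ℝ) (o : ℝ → State nX nz)
    (t : ℝ) : S.plantForcing U t (u t) - S.observerForcing U u θhat L₁ t (o t) =
      S.errorForcing U u θhat t (u t - o t)
        + State.mk (act (L₁ * S.A₂) (u t - o t).fst) 0 := by
  obtain ⟨𝒦, h𝒦⟩ := exists_kernelOp S.K₃_cont
  have h𝒦' : ∀ ζ, S.K2op ζ = 𝒦 ζ := fun ζ => (h𝒦 ζ).symm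
  -- Since `v` is recovered exactly from `Y₁`, the terms with `h₁` and `h₂` cancel, and the output
  -- injection becomes linear in the lumped error.
  simp only [plantForcing, observerForcing, errorForcing, Y₁, Equiv.symm_apply_apply,
    State.mk_sub, State.mk_add, h𝒦', WithLp.sub_fst, WithLp.sub_snd, map_sub, map_add, sub_mul,
    act_sub, actL2_sub, sub_apply, vel, act_mul, add_zero]
  congr 1 <;> abel

/-- Bounded state and input confine `v` to a compact ball, so continuity of `Σ` replaces a global
bound. -/
theorem exists_Sig_bound (hSig : ∀ i j, LocallyLipschitz fun v => S.Sig v i j)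
    (hUb : BoundedSignal U) (hub : BoundedSignal u) :
    ∃ C : ℝ, ∀ t, 0 ≤ t → ‖act (S.Sig (S.vel (u t).fst (U t)))‖ ≤ C := by
  obtain ⟨MU, hMU⟩ := hUb
  obtain ⟨Mu, hMu⟩ := hub
  obtain ⟨C, hC⟩ := (isCompact_closedBall (0 : Vec nz)
    (‖act S.A₂‖ * Mu + ‖act S.G₂‖ * MU)).exists_bound_of_continuousOn
    (f := fun v => act (S.Sig v)) (continuous_act.comp (continuous_Sig hSig)).continuousOn
  refine ⟨C, fun t ht => hC _ ?_⟩
  rw [mem_closedBall_zero_iff]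
  refine (norm_add_le _ _).trans (add_le_add ?_ ?_)
  · refine ((act S.A₂).le_opNorm _).trans ?_
    gcongr
    exact (WithLp.norm_fst_le (Vec nX) (u t)).trans (hMu t ht)
  · exact ((act S.G₂).le_opNorm _).trans (by gcongr; exact hMU t ht)

/-- Decay of the observer error in terms of the decay of the parameter error. -/
theorem observer_error_decay (hSig : ∀ i j, LocallyLipschitz fun v => S.Sig v i j)
    (hUb : BoundedSignal U) (hub : BoundedSignal u) {D μ : ℝ} (hμ : 0 ≤ μ)
    (hθ : ∀ t, 0 ≤ t → ‖S.θ - θhat t‖ ≤ D * Real.exp (-μ * t))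
    {T : ℝ → State nX nz →L[ℝ] State nX nz} {A B : Matrix (Fin nX) (Fin nX) ℝ}
    (hT : IsC0Semigroup T) (h𝒜 : IsGenerator T (S.linOp A)) (hAB : IsHurwitz (A + B))
    {e g : ℝ → State nX nz} (hec : ContinuousOn e (Ici 0)) (hg : ContinuousOn g (Ici 0))
    (he : ∀ t, 0 ≤ t → e t = T t (e 0) + ∫ s in (0 : ℝ)..t, T (t - s) (g s))
    (hge : ∀ t, g t = S.errorForcing U u θhat t (e t) + State.mk (act B (e t).fst) 0) :
    ∃ M σ : ℝ, (0 < μ → 0 < σ) ∧ 0 ≤ σ ∧ ∀ t, 0 ≤ t → ‖e t‖ ≤ M * Real.exp (-σ * t) := by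
  obtain ⟨C, hC⟩ := exists_Sig_bound hSig hUb hub
  obtain ⟨M, hM⟩ := hub
  obtain ⟨𝒦, h𝒦⟩ := exists_kernelOp S.K₃_cont
  have h𝒦' : ∀ ζ, S.K2op ζ = 𝒦 ζ := fun ζ => (h𝒦 ζ).symm
  have hC0 : 0 ≤ C := (norm_nonneg _).trans (hC 0 le_rfl)
  have hM0 : 0 ≤ M := (norm_nonneg _).trans (hM 0 le_rfl)
  have hD0 : 0 ≤ D := by simpa using (norm_nonneg _).trans (hθ 0 le_rfl)
  have hz : ∀ t, 0 ≤ t → ‖(u t).snd‖ ≤ M := fun t ht =>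
    (WithLp.norm_snd_le (Vec nX) (u t)).trans (hM t ht)
  have htil : ∀ t, 0 ≤ t →
      ‖act ((diag S.θ - diag (θhat t)) * S.Sig (S.vel (u t).fst (U t)))‖ ≤
        D * Real.exp (-μ * t) * C := fun t ht => by
    refine (norm_act_mul_le _ _).trans (mul_le_mul ?_ (hC t ht) (norm_nonneg _) (by positivity))
    rw [diag_sub]
    exact (norm_act_diag_le _).trans (hθ t ht)
  -- The forcing is `Θ̃` times bounded signals and inherits its rate; `(‖θ‖ + D) C` bounds `Θ̂Σ`,
  -- because `‖θhat‖ ≤ ‖θ‖ + D`.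
  refine cascade_decay hT h𝒜 hAB hec hg he
    (F := fun t => diag (θhat t) * S.Sig (S.vel (u t).fst (U t)))
    (f₁ := fun t => act (S.G₁ * (diag S.θ - diag (θhat t)) * S.Sig (S.vel (u t).fst (U t)))
      (S.K2op (u t).snd))
    (f₂ := fun t => actL2 ((diag S.θ - diag (θhat t)) * S.Sig (S.vel (u t).fst (U t))) (u t).snd)
    (C := (‖S.θ‖ + D) * C) (D := ‖act S.G₁‖ * (D * C * (‖𝒦‖ * M)) + D * C * M) (μ := μ)
    (fun t _ => ?_) hμ (fun t ht => ?_) (fun t ht => ?_) (fun t ht => ?_)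
  · rw [hge t]
    simp only [errorForcing, Matrix.mul_assoc]
  · refine (norm_act_mul_le _ _).trans (mul_le_mul ?_ (hC t ht) (norm_nonneg _) (by positivity))
    refine (norm_act_diag_le _).trans ?_
    have h1 : D * Real.exp (-μ * t) ≤ D := mul_le_of_le_one_right hD0
      (Real.exp_le_one_iff.2 (by nlinarith))
    calc ‖θhat t‖ = ‖S.θ - (S.θ - θhat t)‖ := by rw [sub_sub_cancel]
      _ ≤ ‖S.θ‖ + ‖S.θ - θhat t‖ := norm_sub_le _ _
      _ ≤ ‖S.θ‖ + D := by gcongr; exact (hθ t ht).trans h1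
  · have h𝒦b : ‖S.K2op (u t).snd‖ ≤ ‖𝒦‖ * M := by
      rw [h𝒦']
      exact (𝒦.le_opNorm _).trans (mul_le_mul_of_nonneg_left (hz t ht) (norm_nonneg _))
    rw [Matrix.mul_assoc]
    calc _ ≤ ‖act S.G₁‖ * (D * Real.exp (-μ * t) * C * (‖𝒦‖ * M)) :=
          norm_act_mul_apply_le S.G₁ (htil t ht) h𝒦b
      _ = ‖act S.G₁‖ * (D * C * (‖𝒦‖ * M)) * Real.exp (-μ * t) := by ring
      _ ≤ _ := mul_le_mul_of_nonneg_right (le_add_of_nonneg_right (by positivity))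
          (Real.exp_nonneg _)
  · calc _ ≤ D * Real.exp (-μ * t) * C * M := norm_actL2_apply_le (htil t ht) (hz t ht)
      _ = D * C * M * Real.exp (-μ * t) := by ring
      _ ≤ _ := mul_le_mul_of_nonneg_right (le_add_of_nonneg_left (by positivity))
          (Real.exp_nonneg _)

/-- The difference of the plant state and a mild solution of the observer is a mild solution of
the error dynamics with output injection. -/
theorem mild_sub {T T' : ℝ → State nX nz →L[ℝ] State nX nz} {A : Matrix (Fin nX) (Fin nX) ℝ}
    (hT : IsC0Semigroup T) (h𝒜 : IsGenerator T (S.linOp A)) (hT' : IsC0Semigroup T')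
    (h𝒜' : IsGenerator T' (S.linOp A)) {x y f g : ℝ → State nX nz}
    (hf : ContinuousOn f (Ici 0)) (hg : ContinuousOn g (Ici 0))
    (hx : ∀ t, 0 ≤ t → x t = T t (x 0) + ∫ s in (0 : ℝ)..t, T (t - s) (f s))
    (hy : ∀ t, 0 ≤ t → y t = T' t (y 0) + ∫ s in (0 : ℝ)..t, T' (t - s) (g s)) {t : ℝ}
    (ht : 0 ≤ t) :
    x t - y t = T t (x 0 - y 0) + ∫ s in (0 : ℝ)..t, T (t - s) (f s - g s) := by
  have hi : ∀ {f : ℝ → State nX nz}, ContinuousOn f (Ici 0) →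
      IntervalIntegrable (fun s => T (t - s) (f s)) volume 0 t := fun hf => by
    refine ContinuousOn.intervalIntegrable ?_
    rw [uIcc_of_le ht]
    exact hT.continuousOn_convolution hf t
  -- Uniqueness permits both variation-of-constants formulas to be written with `T`; only
  -- nonnegative times occur.
  have hyT : ∫ s in (0 : ℝ)..t, T' (t - s) (g s) = ∫ s in (0 : ℝ)..t, T (t - s) (g s) := by
    refine intervalIntegral.integral_congr fun s hs => ?_
    rw [uIcc_of_le ht] at hs
    simp only [semigroup_unique hT h𝒜 hT' h𝒜' (sub_nonneg.2 hs.2)]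
  rw [hx t ht, hy t ht, hyT, ← semigroup_unique hT h𝒜 hT' h𝒜' ht]
  simp only [map_sub]
  rw [intervalIntegral.integral_sub (hi hf) (hi hg)]
  abel

end Plant

theorem BoundedSignal.of_exp {E : Type*} [NormedAddCommGroup E] {f : ℝ → E} {M σ : ℝ} (hσ : 0 ≤ σ)
    (h : ∀ t, 0 ≤ t → ‖f t‖ ≤ M * Real.exp (-σ * t)) : BoundedSignal f := by
  have hM0 : 0 ≤ M := by simpa using (norm_nonneg _).trans (h 0 le_rfl)
  exact ⟨M, fun t ht => (h t ht).trans (mul_le_of_le_one_right hM0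
    (Real.exp_le_one_iff.2 (by nlinarith)))⟩

/-! ### Boundedness and convergence of the parameter estimate -/

section Identification

variable {nX nz nU : ℕ} {S : Plant nX nz nU} {U : ℝ → Vec nU} {u : ℝ → State nX nz}
  {ϱ ψ : ℝ} {Γ : Matrix (Fin nz) (Fin nz) ℝ} {I : Identifier nz}

theorem Identifier.IsDriven.parameter_error (hI : I.IsDriven S U u ϱ ψ Γ) (hϱ : 0 < ϱ)
    (hψ : 0 < ψ) (hΓ : Γ.PosDef) (hSig : ∀ i j, LocallyLipschitz fun v => S.Sig v i j)
    (hh₂ : LocallyLipschitz S.h₂) (hU : ContinuousOn U (Ici 0)) (hu : ContinuousOn u (Ici 0)) :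
    (∃ B : ℝ, ∀ t, 0 ≤ t → ‖S.θ - I.θhat t‖ ≤ B) ∧
      (BoundedSignal I.φ → PersistentlyExciting I.φ → ∃ D μ : ℝ, 0 < μ ∧
        ∀ t, 0 ≤ t → ‖S.θ - I.θhat t‖ ≤ D * Real.exp (-μ * t)) := by
  -- One rate strictly below both the filter rate and the forgetting rate, serving the regression
  -- residual and the transient of `R` alike.
  set ν := min ϱ ψ / 2 with hν
  have hν0 : 0 < ν := by positivity
  have hνϱ : ν < ϱ := by linarith [min_le_left ϱ ψ, lt_min hϱ hψ]
  have hνψ : ν < ψ := by linarith [min_le_right ϱ ψ, lt_min hϱ hψ]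
  obtain ⟨K, hK0, hK⟩ := hI.gradient_error hSig hh₂ hU hu hνϱ hνψ
  have hφ := hI.φ_ode.1
  have hRc : ∀ i j, ContinuousOn (fun t => I.R t i j) (Ici 0) := fun i j => (hI.R_ode i j).1
  have hRM : ContinuousOn I.R (Ici 0) :=
    continuousOn_pi.2 fun i => continuousOn_pi.2 fun j => hRc i j
  have hR : ∀ i j, ∀ t, 0 ≤ t → HasDerivWithinAt (fun t => I.R t i j)
      (-ψ * I.R t i j + I.φ t i * I.φ t j / (1 + ‖I.φ t‖ ^ 2)) (Ici t) t := fun i j t ht =>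
    (hI.R_ode i j).hasDerivWithinAt ((continuousOn_const.mul (hRc i j)).add
      (ContinuousOn.div (by fun_prop) (by fun_prop) (fun s _ => by positivity))) ht
  have hθc := hI.θhat_ode.1
  have hθ : ∀ t, 0 ≤ t → HasDerivWithinAt I.θhat
      (-(act Γ (act (I.R t) (I.θhat t) + I.Q t))) (Ici t) t := fun t ht =>
    hI.θhat_ode.hasDerivWithinAt ((act Γ).continuous.comp_continuousOn
      (((continuous_act.comp_continuousOn hRM).clm_apply hθc).add hI.Q_ode.1)).neg ht
  have hexp : ∀ t, 0 ≤ t → Real.exp (-ψ * t) ≤ Real.exp (-ν * t) := fun t ht =>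
    Real.exp_le_exp.2 (by nlinarith)
  refine ⟨?_, fun hb hPE => ?_⟩
  · obtain ⟨B, -, hB⟩ := exists_parameter_error_bound hΓ hθc hθ hν0 hK0 hK
      (C := ‖act (I.R 0)‖) (norm_nonneg _) fun t ht x => le_trans (by
        gcongr ?_ * _
        exact neg_le_neg (mul_le_mul_of_nonneg_left (hexp t ht) (norm_nonneg _)))
        (quadratic_lower hφ hRc hR x ht)
    exact ⟨B, hB⟩
  · obtain ⟨β, C, hβ, hC, hlow⟩ :=
      quadratic_lower_of_persistentlyExciting hφ hRc hR hψ hb hPE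
    exact exists_parameter_error_decay hΓ hθc hθ hν0 hK0 hK hβ hC fun t ht x =>
      le_trans (by gcongr) (hlow t ht x)

end Identification

end RollingContact

end

/-! ### The main theorem -/

open RollingContact
theorem theorem2 {nX nz nU : ℕ} (S : Plant nX nz nU)
    -- local Lipschitz continuity of the nonlinear terms
    (hSig : ∀ i j, LocallyLipschitz fun v => S.Sig v i j)
    (hh₁ : LocallyLipschitz S.h₁) (hh₂ : LocallyLipschitz S.h₂)
    -- continuous bounded input, global bounded mild solution `u = (X, z)`
    (U : ℝ → Vec nU) (hU : ContinuousOn U (Set.Ici 0)) (hUb : BoundedSignal U)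
    (u : ℝ → State nX nz) (hu : S.IsPlantSolution U u) (hub : BoundedSignal u)
    -- detectability
    (hdet : Detectable S.A₁ S.A₂)
    -- filters and adaptive law
    (ϱ ψ : ℝ) (hϱ : 0 < ϱ) (hψ : 0 < ψ)
    (Γ : Matrix (Fin nz) (Fin nz) ℝ) (hΓ : Γ.PosDef)
    (I : Identifier nz) (hI : I.IsDriven S U u ϱ ψ Γ) :
    (∃ L₁ : Matrix (Fin nX) (Fin nz) ℝ, IsHurwitz (S.A₁ + L₁ * S.A₂)) ∧
    ∀ L₁ : Matrix (Fin nX) (Fin nz) ℝ, IsHurwitz (S.A₁ + L₁ * S.A₂) →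
      -- mild solutions of the observer error dynamics
      (∀ e : ℝ → State nX nz, S.IsErrorSolution U u I.θhat L₁ e →
        BoundedSignal e ∧
          (BoundedSignal I.φ → PersistentlyExciting I.φ → TendsToZeroExp e)) ∧
      -- the difference between the plant state and a mild solution of the observer
      (∀ o : ℝ → State nX nz, S.IsObserverSolution U u I.θhat L₁ o →
        BoundedSignal (fun t => u t - o t) ∧
          (BoundedSignal I.φ → PersistentlyExciting I.φ →
            TendsToZeroExp fun t => u t - o t)) := by
  obtain ⟨T, hT, h𝒜, huc, hue⟩ := hu
  obtain ⟨⟨B, hB⟩, hdecay⟩ := hI.parameter_error hϱ hψ hΓ hSig hh₂ hU huc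
  have hθc := hI.θhat_ode.1
  refine ⟨hdet, fun L₁ hL₁ => ?_⟩
  -- decay of the parameter error carries over to both kinds of observer errors
  have conclude : ∀ e : ℝ → State nX nz,
      (∀ D μ : ℝ, 0 ≤ μ → (∀ t, 0 ≤ t → ‖S.θ - I.θhat t‖ ≤ D * Real.exp (-μ * t)) →
        ∃ M σ : ℝ, (0 < μ → 0 < σ) ∧ 0 ≤ σ ∧ ∀ t, 0 ≤ t → ‖e t‖ ≤ M * Real.exp (-σ * t)) →
      BoundedSignal e ∧ (BoundedSignal I.φ → PersistentlyExciting I.φ → TendsToZeroExp e) := by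
    intro e he
    refine ⟨?_, fun hb hPE => ?_⟩
    -- Boundedness is the decay statement with rate `μ = 0` and the bound `B` on the parameter
    -- error.
    · obtain ⟨M, σ, -, hσ, hM⟩ := he B 0 le_rfl (by simpa using hB)
      exact BoundedSignal.of_exp hσ hM
    · obtain ⟨D, μ, hμ, hD⟩ := hdecay hb hPE
      obtain ⟨M, σ, hσ, -, hM⟩ := he D μ hμ.le hD
      exact ⟨M, σ, hσ hμ, hM⟩
  refine ⟨fun e he => conclude e fun D μ hμ hD => ?_, fun o ho => conclude _ fun D μ hμ hD => ?_⟩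
  · obtain ⟨T', hT', h𝒜', hec, hee⟩ := he
    -- Here the generator already contains the injection `L₁A₂`. For the observer below it contains
    -- only `A₁`, and the injection enters through the forcing with `B = L₁A₂`.
    refine Plant.observer_error_decay hSig hUb hub hμ hD hT' h𝒜' (B := 0) (by rwa [add_zero]) hec
      (Plant.continuousOn_errorForcing hSig hU huc hθc hec) hee fun t => ?_
    rw [act_zero, zero_apply]
    exact (add_zero _).symm
  · obtain ⟨T', hT', h𝒜', hoc, hoe⟩ := ho
    have hf := Plant.continuousOn_plantForcing hSig hh₁ hh₂ hU huc
    have hg := Plant.continuousOn_observerForcing hSig hh₁ hh₂ hU huc hθc L₁ hoc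
    exact Plant.observer_error_decay hSig hUb hub hμ hD hT h𝒜 (B := L₁ * S.A₂) hL₁
      (huc.sub hoc) (hf.sub hg) (fun t ht => Plant.mild_sub hT h𝒜 hT' h𝒜' hf hg hue hoe ht)
      fun t => Plant.plantForcing_sub_observerForcing L₁ o t
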